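/- \textbf{Theorem (Derivative loss: weakly hyperbolic case).} Let $H$ be a real Hilbert space and let $A$ be a nonnegative self-adjoint (densely defined, possibly unbounded) linear operator on $H$. Assume that there are a countable (not necessarily complete) orthonormal system $\{e_k\}_{k\ge 1}$ in $H$ and a nondecreasing unbounded sequence $\{\lambda_k\}_{k\ge1}$ of positive real numbers with $Ae_k=\lambda_k^2e_k$ for every $k$. Let $\omega:[0,\infty)\to[0,\infty)$ be a continuity modulus, i.e. a continuous nondecreasing function with $\omega(0)=0$, $\omega(\sigma)>0$ for $\sigma>0$, and $\omega(a+b)\le\omega(a)+\omega(b)$ for all $a,b\ge0$; assume that $\sigma\mapsto\sigma/\omega(\sigma)$ is nondecreasing on $(0,\infty)$. For every $k$ let $\sigma_k>0$ be the (unique) solution of $$\frac{\sigma_k}{\sqrt{\omega(1/\sigma_k)}}=\lambda_k .$$ Let $\varphi:[0,\infty)\to[1,\infty)$ be a function such that $$\lim_{k\to\infty}\sigma_k\left[\varphi\left(\frac{\sigma_k}{\sqrt{\omega(1/\sigma_k)}}\right)\right]^{-1}=+\infty .$$ (This holds in particular if $\sigma\,[\varphi(\sigma/\sqrt{\omega(1/\sigma)})]^{-1}\to+\infty$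 as $\sigma\to+\infty$.) Notation: for $x\in H$ let $\mu_x$ be the spectral measure of $A$ at $x$, a finite Borel measure on $[0,\infty)$. For $\alpha\ge0$ put $|A^\alpha x|^2=\int s^{2\alpha}\,d\mu_x(s)\in[0,\infty]$ and $D(A^\alpha)=\{x:|A^\alpha x|<\infty\}$, with norm $(|x|^2+|A^\alpha x|^2)^{1/2}$. Let $\mathcal G_{\varphi,\infty,\alpha}(A)$ be the set of all $x\in H$ such that $s\mapsto s^{2\alpha}\exp(r\varphi(\sqrt s))$ is $\mu_x$-integrable for every $r>0$. (If $x=\sum_k x_ke_k$, these integrals are $\sum_k\lambda_k^{4\alpha}x_k^2$ and $\sum_k\lambda_k^{4\alpha}x_k^2e^{r\varphi(\lambda_k)}$.) Then there exist a function $m:[0,\infty)\to[0,3/2]$, which is $\omega$-continuous (i.e. $|m(a)-m(b)|\le L\,\omega(|a-b|)$ for all $a,b\ge 0$ and some constant $L$), a number $T>0$, and a solution $u$ of $$u''(t)+m\big(|A^{1/2}u(t)|^2\big)Au(t)=0,\qquad t\in[0,T)$$ (the equation is tested with arbitrary vectors of $D(A)$) which has (i) instantaneous strong derivative loss of type $\mathcal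 G_{\varphi,\infty,3/4}(A)\times\mathcal G_{\varphi,\infty,1/4}(A)\to D(A)\times D(A^{1/2})$, and (ii) instantaneous weak derivative loss of type $\mathcal G_{\varphi,\infty,3/4}(A)\times\mathcal G_{\varphi,\infty,1/4}(A)\to D(A^{3/4})\times D(A^{1/4})$. Here $u$ has instantaneous strong (resp. weak) derivative loss of type $\mathcal G_{\varphi,\infty,3/4}(A)\times\mathcal G_{\varphi,\infty,1/4}(A)\to D(A^{\alpha+1/2})\times D(A^{\alpha})$ if there is $T_0\in(0,T)$ such that $u\in C^1([0,T_0];D(A^{1/4}))\cap C^0([0,T_0];D(A^{3/4}))$, $(u(0),u'(0))\in\mathcal G_{\varphi,\infty,3/4}(A)\times\mathcal G_{\varphi,\infty,1/4}(A)$, and - (strong) $(u(t),u'(t))\notin D(A^{\alpha+1/2+\varepsilon})\times D(A^{\alpha+\varepsilon})$ for all $\varepsilon>0$ and all $t\in(0,T_0]$; - (weak) there is a sequence $\tau_k\to0^+$ in $(0,T_0]$ such that $|A^{\alpha+1/2+\varepsilon}u(\tau_k)|\to+\infty$ for every $\varepsilon>0$. -/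

import Mathlib

open Set Filter Topology MeasureTheory
open scoped NNReal ENNReal

namespace Kirchhoff

noncomputable section

/-- A continuity modulus on `[0, ∞)`. Only monotonicity in the wide sense together with positivity
on `(0, ∞)` is asked for, so that strictly increasing moduli are covered in particular. -/
structure IsContinuityModulus (ω : ℝ → ℝ) : Prop where
  continuousOn : ContinuousOn ω (Ici 0)
  monotoneOn : MonotoneOn ω (Ici 0)
  map_zero : ω 0 = 0
  pos : ∀ a, 0 < a → 0 < ω a
  subadditive : ∀ a b, 0 ≤ a → 0 ≤ b → ω (a + b) ≤ ω a + ω b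

/-- `ω`-continuity of a function on `[0, ∞)`. -/
def IsOmegaContinuous (ω m : ℝ → ℝ) : Prop :=
  ∃ L : ℝ, ∀ a b, 0 ≤ a → 0 ≤ b → |m a - m b| ≤ L * ω |a - b|

section Operator

variable {H : Type*} [NormedAddCommGroup H] [InnerProductSpace ℝ H]

/-- `A` is nonnegative: `⟨A x, x⟩ ≥ 0` on its domain. -/
def IsNonneg (A : H →ₗ.[ℝ] H) : Prop :=
  ∀ x : A.domain, 0 ≤ inner ℝ (A x) (x : H)

/-- `μ` is the spectral measure at the vector `x` of the nonnegative self-adjoint operator `A`,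
i.e. `μ(B) = ⟨E(B) x, x⟩` with `E` the resolution of the identity of `A`. It is characterized
as the finite Borel measure on `[0, ∞)` whose Stieltjes transform is
`⟨(A + c)⁻¹ x, x⟩ = ∫ 1 / (s + c) dμ(s)` for `c > 0` (here `y = (A + c)⁻¹ x`, which exists and is
unique because `A` is self-adjoint and nonnegative). -/
structure IsSpectralMeasure (A : H →ₗ.[ℝ] H) (x : H) (μ : Measure ℝ≥0) : Prop where
  finite : IsFiniteMeasure μ
  resolvent : ∀ c : ℝ, 0 < c → ∀ y : A.domain, A y + c • (y : H) = x →
    inner ℝ (y : H) x = ∫ s : ℝ≥0, ((s : ℝ) + c)⁻¹ ∂μ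

open Classical in
/-- The spectral measure of `A` at `x`. For self-adjoint nonnegative `A` it exists by the spectral
theorem, and it is unique because the Stieltjes transform determines a finite measure; the
value `0` of the other branch is never used. If `x = ∑ xₖ eₖ` with `A eₖ = λₖ² eₖ`, it is
`∑ xₖ² δ_{λₖ²}`. -/
def spectralMeasure (A : H →ₗ.[ℝ] H) (x : H) : Measure ℝ≥0 :=
  if h : ∃ μ, IsSpectralMeasure A x μ then h.choose else 0

/-- The norm `|A^α x|`, with value `∞` when `x` is not in `D(A^α)`. -/
def powNorm (A : H →ₗ.[ℝ] H) (α : ℝ) (x : H) : ℝ≥0∞ :=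
  (∫⁻ s : ℝ≥0, ENNReal.ofReal ((s : ℝ) ^ (2 * α)) ∂(spectralMeasure A x)) ^ (1 / 2 : ℝ)

/-- The domain `D(A^α)`, for `α ≥ 0`. -/
def powDomain (A : H →ₗ.[ℝ] H) (α : ℝ) : Set H :=
  {x | powNorm A α x < ∞}

/-- The generalized Gevrey space `G_{φ,r,α}(A)`, the domain of `A^α exp((r / 2) φ(A^{1/2}))`. In a
basis with `A eₖ = λₖ² eₖ` the condition is that `∑ λₖ^{4α} xₖ² exp(r φ(λₖ))` converges. -/
def gevrey (A : H →ₗ.[ℝ] H) (φ : ℝ → ℝ) (r α : ℝ) : Set H :=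
  {x | Integrable (fun s : ℝ≥0 => (s : ℝ) ^ (2 * α) * Real.exp (r * φ (√(s : ℝ))))
    (spectralMeasure A x)}

/-- The space `G_{φ,∞,α}(A)`, the intersection of `G_{φ,r,α}(A)` over all `r > 0`. -/
def gevreyInfty (A : H →ₗ.[ℝ] H) (φ : ℝ → ℝ) (α : ℝ) : Set H :=
  {x | ∀ r, 0 < r → x ∈ gevrey A φ r α}

/-- `u ∈ C⁰([0, T]; D(A^α))`, where `D(A^α)` has the norm `(|x|² + |A^α x|²)^{1/2}`. -/
structure IsC0 (A : H →ₗ.[ℝ] H) (α T : ℝ) (u : ℝ → H) : Prop where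
  mem : ∀ t ∈ Icc 0 T, u t ∈ powDomain A α
  continuousOn : ContinuousOn u (Icc 0 T)
  tendsto_powNorm : ∀ t ∈ Icc 0 T,
    Tendsto (fun s => powNorm A α (u s - u t)) (𝓝[Icc 0 T] t) (𝓝 0)

/-- `u ∈ C¹([0, T]; D(A^α))` with derivative `u'`. -/
structure IsC1 (A : H →ₗ.[ℝ] H) (α T : ℝ) (u u' : ℝ → H) : Prop where
  c0 : IsC0 A α T u
  c0_deriv : IsC0 A α T u'
  hasDeriv : ∀ t ∈ Icc 0 T, HasDerivWithinAt u (u' t) (Icc 0 T) t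
  tendsto_powNorm : ∀ t ∈ Icc 0 T,
    Tendsto (fun s => powNorm A α ((s - t)⁻¹ • (u s - u t) - u' t))
      (𝓝[Icc 0 T \ {t}] t) (𝓝 0)

/-- `u`, with derivative `u'`, solves `u'' + m(|A^{1/2} u|²) A u = 0` on `[0, T)`. For a solution
in `C¹([0, T); D(A^{1/4})) ∩ C⁰([0, T); D(A^{3/4}))` the terms `u''` and `A u` take their values in
the dual of `D(A^{1/4})`; the equation is tested with the vectors of `D(A)`, which is dense
in `D(A^{1/4})`. -/
structure IsSolution (A : H →ₗ.[ℝ] H) (m : ℝ → ℝ) (T : ℝ) (u u' : ℝ → H) : Prop where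
  mem : ∀ t ∈ Ico 0 T, u t ∈ powDomain A (1 / 2)
  hasDeriv : ∀ t ∈ Ico 0 T, HasDerivWithinAt u (u' t) (Ico 0 T) t
  equation : ∀ t ∈ Ico 0 T, ∀ w : A.domain,
    HasDerivWithinAt (fun s => inner ℝ (u' s) (w : H))
      (-(m ((powNorm A (1 / 2) (u t)).toReal ^ 2) * inner ℝ (u t) (A w))) (Ico 0 T) t

/-- Conditions (regularity of the solution on `[0, T₀]`, high regularity at `t = 0`) common to both
notions of derivative loss. -/
structure IsRegularWithSmoothData (A : H →ₗ.[ℝ] H) (φ : ℝ → ℝ) (T₀ : ℝ) (u u' : ℝ → H) :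
    Prop where
  c1 : IsC1 A (1 / 4) T₀ u u'
  c0 : IsC0 A (3 / 4) T₀ u
  data : u 0 ∈ gevreyInfty A φ (3 / 4) ∧ u' 0 ∈ gevreyInfty A φ (1 / 4)

/-- Instantaneous strong derivative loss of type
`G_{φ,∞,3/4}(A) × G_{φ,∞,1/4}(A) → D(A^{α+1/2}) × D(A^α)`
of a solution `u` on `[0, T)` with derivative `u'`. -/
def HasStrongDerivativeLoss (A : H →ₗ.[ℝ] H) (φ : ℝ → ℝ) (α T : ℝ) (u u' : ℝ → H) : Prop :=
  ∃ T₀ ∈ Ioo 0 T, IsRegularWithSmoothData A φ T₀ u u' ∧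
    ∀ ε > 0, ∀ t ∈ Ioc 0 T₀,
      ¬ (u t ∈ powDomain A (α + 1 / 2 + ε) ∧ u' t ∈ powDomain A (α + ε))

/-- Instantaneous weak derivative loss of type
`G_{φ,∞,3/4}(A) × G_{φ,∞,1/4}(A) → D(A^{α+1/2}) × D(A^α)`
of a solution `u` on `[0, T)` with derivative `u'`. -/
def HasWeakDerivativeLoss (A : H →ₗ.[ℝ] H) (φ : ℝ → ℝ) (α T : ℝ) (u u' : ℝ → H) : Prop :=
  ∃ T₀ ∈ Ioo 0 T, IsRegularWithSmoothData A φ T₀ u u' ∧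
    ∃ τ : ℕ → ℝ, (∀ k, τ k ∈ Ioc 0 T₀) ∧ Tendsto τ atTop (𝓝 0) ∧
      ∀ ε > 0, Tendsto (fun k => powNorm A (α + 1 / 2 + ε) (u (τ k))) atTop (𝓝 ∞)

end Operator

end

end Kirchhoff

/-! The nonlinearity is recovered at the very end. Once a coefficient `c` depending on time is
fixed, `u'' + c(t) A u = 0` splits along eigenvectors into `v'' + lam² c v = 0`. If `θ(t) = |A^{1/2}
u(t)|²` increases at a rate bounded below, then `θ⁻¹` is Lipschitz, `m = c ∘ θ⁻¹` inherits the
`ω`-continuity of `c`, and `u` solves the nonlinear equation (`exists_nonlinearity`,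
`IsModeFamily.isSolution`). The increase of `θ` comes from one fixed mode that outweighs all the
others (`exists_moving_mode`, `IsModeFamily.increments`).

It remains to find an `ω`-continuous `c ≥ 0` for which infinitely many modes lose derivatives. The
source is parametric resonance: `w'' + bump w = 0` has an exponentially growing solution.
Oscillations of frequency `S` and amplitude `ω(1/S)` respect the modulus `ω` uniformly, and `lam²
ω(1/σ) = σ²` says exactly that the mode `lam` resonates with them when `S = σ`. In a fixed time the
mode gains a factor exponential in `σ`, while the regularity of the data only costs `exp(r φ(lam))`;
since `σ / φ(lam) → ∞`, every `r` can be afforded. The coefficient `coef` is a supremum of such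
stages accumulating at `t = 0`, with amplitudes so separated that one stage at a time is visible.
The mode of a stage is tiny at time `0` and reaches its normalized size when the stage ends
(`IsCascade.exists_mode`).

Afterwards `c` still varies, but only through stages of lower frequency, so that `c e^{ρt}` is
nondecreasing with `ρ` comparable to the previous frequency. Although `c` need not be
differentiable, the energies then change by a factor at most `e^ρ` in the required direction
(`energy_lower`, `energy_upper`, both from `le_of_touching_minorant`), and each frequency is chosen
so large that this is negligible against every power `lam^{4ε}`. The peak of a mode near the end of
its stage gives the weak loss at `D(A^{3/4})`. The energy that persists is of order `σ²`, which is
only known to be at least `ω(1) lam`; this is why the strong loss is stated at `D(A) × D(A^{1/2})`.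

Powers of `A` are defined through spectral measures. On sums of eigenvectors these are explicit,
because the Stieltjes transform determines a finite measure (`ext_of_integral_resolvent`,
`spectralMeasure_of_hasSum`). -/

namespace Kirchhoff

/-! ### Injectivity of the Stieltjes transform. -/

open scoped BoundedContinuousFunction

/-- The bounded continuous function `s ↦ (s + c)⁻¹` on `[0, ∞)`. -/
noncomputable def resolventFun (c : ℝ) (hc : 0 < c) : ℝ≥0 →ᵇ ℝ :=
  BoundedContinuousFunction.ofNormedAddCommGroup (fun s : ℝ≥0 => ((s : ℝ) + c)⁻¹)
    (by
      refine Continuous.inv₀ (by fun_prop) fun s => ?_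
      have := s.2
      positivity) c⁻¹
    (fun s => by
      have hs := s.2
      rw [Real.norm_of_nonneg (by positivity)]
      gcongr
      linarith)

@[simp] lemma resolventFun_apply (c : ℝ) (hc : 0 < c) (s : ℝ≥0) :
    resolventFun c hc s = ((s : ℝ) + c)⁻¹ := rfl

lemma integrable_bcf (μ : Measure ℝ≥0) [IsFiniteMeasure μ] (g : ℝ≥0 →ᵇ ℝ) : Integrable g μ :=
  g.integrable μ

lemma tendsto_integral_mul_resolventFun (μ : Measure ℝ≥0) [IsFiniteMeasure μ] (g : ℝ≥0 →ᵇ ℝ)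
    (c : ℝ) (hc : 0 < c) :
    Tendsto (fun n : ℕ => ∫ s, g s * ((s : ℝ) + (c + 1 / (n + 1)))⁻¹ ∂μ) atTop
      (𝓝 (∫ s, g s * ((s : ℝ) + c)⁻¹ ∂μ)) := by
  refine tendsto_integral_of_dominated_convergence (fun _ => ‖g‖ * c⁻¹) ?_ (integrable_const _)
    ?_ ?_
  · intro n
    exact (integrable_bcf μ (g * resolventFun (c + 1 / (n + 1)) (by positivity))).1
  · intro n
    refine Eventually.of_forall fun s => ?_
    have hs := s.2
    rw [norm_mul]
    refine mul_le_mul (g.norm_coe_le_norm s) ?_ (norm_nonneg _) (norm_nonneg _)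
    rw [Real.norm_of_nonneg (by positivity)]
    gcongr
    have : (0:ℝ) ≤ 1 / ((n:ℝ) + 1) := by positivity
    linarith
  · refine Eventually.of_forall fun s => ?_
    have hs := s.2
    refine Tendsto.const_mul _ (Tendsto.inv₀ ?_ (by positivity))
    have := (tendsto_one_div_add_atTop_nhds_zero_nat (𝕜 := ℝ)).const_add ((s : ℝ) + c)
    simpa [add_assoc] using this

/-- Since `n / (s + n)` tends to `1` boundedly, the weight can be removed: equality of the weighted
integrals of `g` implies equality of the integrals of `g`. -/
lemma tendsto_integral_smul_resolventFun (μ : Measure ℝ≥0) [IsFiniteMeasure μ] (g : ℝ≥0 →ᵇ ℝ) :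
    Tendsto (fun n : ℕ => ((n : ℝ) + 1) * ∫ s, g s * ((s : ℝ) + (n + 1))⁻¹ ∂μ) atTop
      (𝓝 (∫ s, g s ∂μ)) := by
  simp_rw [← integral_const_mul]
  refine tendsto_integral_of_dominated_convergence (fun _ => ‖g‖) ?_ (integrable_const _) ?_ ?_
  · intro n
    exact ((integrable_bcf μ (g * resolventFun (n + 1) (by positivity))).const_mul _).1
  · intro n
    refine Eventually.of_forall fun s => ?_
    have hs := s.2
    rw [mul_left_comm, norm_mul]
    refine mul_le_of_le_one_right (norm_nonneg _) ?_ |>.trans (g.norm_coe_le_norm s)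
    rw [Real.norm_of_nonneg (by positivity), ← div_eq_mul_inv, div_le_one (by positivity)]
    linarith
  · refine Eventually.of_forall fun s => ?_
    have hs := s.2
    have h1 : Tendsto (fun n : ℕ => 1 - (s : ℝ) * ((s : ℝ) + (n + 1))⁻¹) atTop (𝓝 (1 - s * 0)) := by
      refine Tendsto.const_sub _ (Tendsto.const_mul _ ?_)
      refine tendsto_inv_atTop_zero.comp ?_
      refine tendsto_atTop_add_const_left _ _ (tendsto_atTop_add_const_right _ _ ?_)
      exact tendsto_natCast_atTop_atTop
    have h2 := h1.const_mul (g s)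
    simp only [mul_zero, sub_zero, mul_one] at h2
    refine h2.congr fun n => ?_
    have : (s : ℝ) + (n + 1) ≠ 0 := by positivity
    field_simp
    ring

/-- Two finite measures on `[0, ∞)` with the same Stieltjes transform coincide. -/
theorem ext_of_integral_resolvent (μ ν : Measure ℝ≥0) [IsFiniteMeasure μ] [IsFiniteMeasure ν]
    (h : ∀ c : ℝ, 0 < c → ∫ s : ℝ≥0, ((s : ℝ) + c)⁻¹ ∂μ = ∫ s : ℝ≥0, ((s : ℝ) + c)⁻¹ ∂ν) :
    μ = ν := by
  let P : (ℝ≥0 →ᵇ ℝ) → Prop := fun g => ∀ c : ℝ, 0 < c →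
    ∫ s : ℝ≥0, g s * ((s : ℝ) + c)⁻¹ ∂μ = ∫ s : ℝ≥0, g s * ((s : ℝ) + c)⁻¹ ∂ν
  have hP1 : P 1 := fun c hc => by simpa using h c hc
  -- Partial fractions: for `c ≠ d` a product of two resolvents is a combination of the two single
  -- ones.
  have hne : ∀ g, P g → ∀ c (hc : 0 < c) d (_ : 0 < d), c ≠ d →
      ∫ s : ℝ≥0, (g * resolventFun c hc) s * ((s : ℝ) + d)⁻¹ ∂μ =
        ∫ s : ℝ≥0, (g * resolventFun c hc) s * ((s : ℝ) + d)⁻¹ ∂ν := by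
    intro g hg c hc d hd hcd
    have key : ∀ (κ : Measure ℝ≥0) [IsFiniteMeasure κ],
        ∫ s : ℝ≥0, (g * resolventFun c hc) s * ((s : ℝ) + d)⁻¹ ∂κ =
        (d - c)⁻¹ * (∫ s : ℝ≥0, g s * ((s : ℝ) + c)⁻¹ ∂κ
          - ∫ s : ℝ≥0, g s * ((s : ℝ) + d)⁻¹ ∂κ) := by
      intro κ _
      have hi1 : Integrable (fun s : ℝ≥0 => g s * ((s : ℝ) + c)⁻¹) κ :=
        integrable_bcf κ (g * resolventFun c hc)
      have hi2 : Integrable (fun s : ℝ≥0 => g s * ((s : ℝ) + d)⁻¹) κ :=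
        integrable_bcf κ (g * resolventFun d hd)
      rw [← integral_sub hi1 hi2, ← integral_const_mul]
      refine integral_congr_ae (Eventually.of_forall fun s => ?_)
      have hs := s.2
      have h1 : (s : ℝ) + c ≠ 0 := by positivity
      have h2 : (s : ℝ) + d ≠ 0 := by positivity
      have h3 : d - c ≠ 0 := sub_ne_zero.2 hcd.symm
      simp only [BoundedContinuousFunction.coe_mul, Pi.mul_apply, resolventFun_apply]
      field_simp
      ring
    rw [key μ, key ν, hg c hc, hg d hd]
  have hPmul : ∀ g, P g → ∀ c (hc : 0 < c), P (g * resolventFun c hc) := by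
    intro g hg c hc d hd
    -- The repeated factor `c = d` is reached by moving `d` to `d + 1/(n+1)`, which differs from `c`
    -- for large `n`.
    refine tendsto_nhds_unique_of_eventuallyEq
      (tendsto_integral_mul_resolventFun μ (g * resolventFun c hc) d hd)
      (tendsto_integral_mul_resolventFun ν (g * resolventFun c hc) d hd) ?_
    have hlim : Tendsto (fun n : ℕ => d + 1 / ((n : ℝ) + 1)) atTop (𝓝 d) := by
      simpa using (tendsto_one_div_add_atTop_nhds_zero_nat (𝕜 := ℝ)).const_add d
    have hev : ∀ᶠ n : ℕ in atTop, c ≠ d + 1 / ((n : ℝ) + 1) := by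
      rcases lt_or_ge d c with hlt | hge
      · filter_upwards [hlim.eventually (gt_mem_nhds hlt)] with n hn using hn.ne'
      · refine Eventually.of_forall fun n => ?_
        have : (0:ℝ) < 1 / ((n:ℝ) + 1) := by positivity
        linarith
    filter_upwards [hev] with n hn
    exact hne g hg c hc _ (by positivity) hn
  have hPint : ∀ g, P g → ∫ s, g s ∂μ = ∫ s, g s ∂ν := by
    intro g hg
    refine tendsto_nhds_unique_of_eventuallyEq (tendsto_integral_smul_resolventFun μ g)
      (tendsto_integral_smul_resolventFun ν g) (Eventually.of_forall fun n => ?_)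
    simp only [hg ((n : ℝ) + 1) (by positivity)]
  let S : Set (ℝ≥0 →ᵇ ℝ) := {g | ∃ c, ∃ hc : 0 < c, g = resolventFun c hc}
  have hcl : ∀ g ∈ Submonoid.closure S, P g := by
    intro g hg
    induction hg using Submonoid.closure_induction_right with
    | one => exact hP1
    | mul_right x hx y hy ih =>
      obtain ⟨c, hc, rfl⟩ := hy
      exact hPmul x ih c hc
  let B : StarSubalgebra ℝ (ℝ≥0 →ᵇ ℝ) :=
    { Algebra.adjoin ℝ S with
      star_mem' := fun {a} ha => by
        have : star a = a := by ext s; simp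
        rw [this]; exact ha }
  -- Products of resolvents span an algebra on which the integrals agree, and the single function
  -- `(s + 1)⁻¹`, being injective, already separates points.
  refine ext_of_forall_mem_subalgebra_integral_eq_of_polish (𝕜 := ℝ) (A := B) ?_ ?_
  · intro s t hst
    refine ⟨fun s => ((s : ℝ) + 1)⁻¹, ⟨(resolventFun 1 one_pos : ℝ≥0 →ᵇ ℝ).toContinuousMap,
      ⟨resolventFun 1 one_pos, Algebra.subset_adjoin ⟨1, one_pos, rfl⟩, rfl⟩, rfl⟩, ?_⟩
    intro heq
    apply hst
    have := inv_injective heq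
    exact NNReal.coe_injective (by linarith)
  · intro g hg
    have hg' : g ∈ Submodule.span ℝ (Submonoid.closure S : Set (ℝ≥0 →ᵇ ℝ)) := by
      rw [← Algebra.adjoin_eq_span]; exact hg
    induction hg' using Submodule.span_induction with
    | mem x hx => exact hPint x (hcl x hx)
    | zero => simp
    | add x y hx hy ihx ihy =>
      have e : ∀ (κ : Measure ℝ≥0) [IsFiniteMeasure κ], ∫ s, (x + y) s ∂κ
          = ∫ s, x s ∂κ + ∫ s, y s ∂κ := fun κ _ => by
        rw [← integral_add (integrable_bcf κ x) (integrable_bcf κ y)]; rfl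
      have hx' : x ∈ B := by
        change x ∈ Subalgebra.toSubmodule (Algebra.adjoin ℝ S); rwa [Algebra.adjoin_eq_span]
      have hy' : y ∈ B := by
        change y ∈ Subalgebra.toSubmodule (Algebra.adjoin ℝ S); rwa [Algebra.adjoin_eq_span]
      rw [e μ, e ν, ihx hx', ihy hy']
    | smul a x hx ihx =>
      have hx' : x ∈ B := by
        change x ∈ Subalgebra.toSubmodule (Algebra.adjoin ℝ S); rwa [Algebra.adjoin_eq_span]
      simp only [BoundedContinuousFunction.coe_smul, integral_smul, ihx hx']

/-! ### Spectral measures on the span of eigenvectors. -/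

section Spectral

variable {H : Type*} [NormedAddCommGroup H] [InnerProductSpace ℝ H] {A : H →ₗ.[ℝ] H}

/-- The resolvent identity constrains a measure only at those `c` for which `(A + c) y = x` is
solvable, so solvability at this particular `x` is required before uniqueness can be used. -/
theorem spectralMeasure_eq {x : H} {μ : Measure ℝ≥0} (hμ : IsSpectralMeasure A x μ)
    (hx : ∀ c : ℝ, 0 < c → ∃ y : A.domain, A y + c • (y : H) = x) :
    spectralMeasure A x = μ := by
  have hex : ∃ μ, IsSpectralMeasure A x μ := ⟨μ, hμ⟩
  rw [spectralMeasure, dif_pos hex]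
  have h1 := hex.choose_spec
  have := h1.finite
  have := hμ.finite
  refine ext_of_integral_resolvent _ _ fun c hc => ?_
  obtain ⟨y, hy⟩ := hx c hc
  rw [← h1.resolvent c hc y hy, ← hμ.resolvent c hc y hy]

variable [CompleteSpace H]

theorem inner_apply_comm (hA : IsSelfAdjoint A) (x y : A.domain) :
    inner ℝ (A x) (y : H) = inner ℝ (x : H) (A y) := by
  have h := LinearPMap.adjoint_isFormalAdjoint hA.dense_domain
  rw [LinearPMap.isSelfAdjoint_def.1 hA] at h
  exact h x y

variable {f : ℕ → H} {Λ : ℕ → ℝ}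

/-- `f` is an orthonormal system of eigenvectors of `A` with the eigenvalues `Λ k ^ 2`. -/
structure IsEigenSystem (A : H →ₗ.[ℝ] H) (f : ℕ → H) (Λ : ℕ → ℝ) : Prop where
  orthonormal : Orthonormal ℝ f
  pos : ∀ k, 0 < Λ k
  eig : ∀ k, ∃ h : f k ∈ A.domain, A ⟨f k, h⟩ = (Λ k ^ 2) • f k

omit [CompleteSpace H] in
lemma inner_hasSum (hf : Orthonormal ℝ f) {x : ℕ → ℝ} {X : H}
    (hX : HasSum (fun k => x k • f k) X) (k : ℕ) : inner ℝ (f k) X = x k := by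
  have h1 := hX.mapL (innerSL ℝ (f k))
  refine h1.unique ?_
  convert hasSum_single k ?_ using 1
  · simp [hf.1 k]
  · intro j hj
    simp [hf.2 hj.symm]

lemma summable_smul_iff (hf : Orthonormal ℝ f) {x : ℕ → ℝ} :
    Summable (fun k => x k • f k) ↔ Summable (fun k => x k ^ 2) := by
  have := hf.orthogonalFamily.summable_iff_norm_sq_summable (f := fun k => x k)
  simpa using this

lemma inner_apply_eig (hA : IsSelfAdjoint A) (hE : IsEigenSystem A f Λ) (y : A.domain) (k : ℕ) :
    inner ℝ (f k) (A y) = Λ k ^ 2 * inner ℝ (f k) (y : H) := by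
  obtain ⟨h, hk⟩ := hE.eig k
  have := inner_apply_comm hA ⟨f k, h⟩ y
  rw [hk, inner_smul_left] at this
  simpa using this.symm

omit [CompleteSpace H] in
lemma hasSum_inner_left {x : ℕ → ℝ} {X : H} (hX : HasSum (fun k => x k • f k) X) (w : H) :
    HasSum (fun k => x k * inner ℝ (f k) w) (inner ℝ X w) := by
  have h1 := hX.mapL (innerSL ℝ w)
  simp only [innerSL_apply_apply, inner_smul_right] at h1
  simpa only [real_inner_comm] using h1

/-- The domain of `A` contains all sums `∑ yₖ fₖ` with `∑ Λₖ⁴ yₖ² < ∞`. -/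
lemma mem_domain_of_hasSum (hA : IsSelfAdjoint A) (hE : IsEigenSystem A f Λ) {y : ℕ → ℝ} {Y Z : H}
    (hY : HasSum (fun k => y k • f k) Y) (hZ : HasSum (fun k => (Λ k ^ 2 * y k) • f k) Z) :
    ∃ h : Y ∈ A.domain, A ⟨Y, h⟩ = Z := by
  have key : ∀ x : A.domain, inner ℝ Z (x : H) = inner ℝ Y (A x) := fun x => by
    have h1 := hasSum_inner_left hZ (x : H)
    have h2 := hasSum_inner_left hY (A x)
    simp only [inner_apply_eig hA hE] at h2
    refine h1.unique ?_
    convert h2 using 2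
    ring
  have hadj := LinearPMap.isSelfAdjoint_def.1 hA
  have hmem : Y ∈ (LinearPMap.adjoint A).domain :=
    LinearPMap.mem_adjoint_domain_of_exists Y ⟨Z, key⟩
  have hval : LinearPMap.adjoint A ⟨Y, hmem⟩ = Z :=
    LinearPMap.adjoint_apply_eq hA.dense_domain ⟨Y, hmem⟩ key
  -- The value of a partial map depends on a membership proof, so the equality of `A` and its
  -- adjoint is transported by generalizing the operator.
  have : ∀ B : H →ₗ.[ℝ] H, B = A → (∃ h : Y ∈ B.domain, B ⟨Y, h⟩ = Z) →
      ∃ h : Y ∈ A.domain, A ⟨Y, h⟩ = Z := by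
    rintro B rfl h; exact h
  exact this _ hadj ⟨hmem, hval⟩

/-- The measure `∑ xₖ² δ_{Λₖ²}`. -/
noncomputable def coordMeasure (Λ x : ℕ → ℝ) : Measure ℝ≥0 :=
  Measure.sum fun k => ENNReal.ofReal (x k ^ 2) • Measure.dirac (Real.toNNReal (Λ k ^ 2))

lemma lintegral_coordMeasure (Λ x : ℕ → ℝ) (g : ℝ≥0 → ℝ≥0∞) :
    ∫⁻ s, g s ∂(coordMeasure Λ x) =
      ∑' k, ENNReal.ofReal (x k ^ 2) * g (Real.toNNReal (Λ k ^ 2)) := by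
  simp [coordMeasure, lintegral_sum_measure, lintegral_smul_measure]

lemma isFiniteMeasure_coordMeasure (Λ : ℕ → ℝ) {x : ℕ → ℝ} (hx : Summable fun k => x k ^ 2) :
    IsFiniteMeasure (coordMeasure Λ x) := by
  refine ⟨?_⟩
  rw [← setLIntegral_one, Measure.restrict_univ, lintegral_coordMeasure]
  simp only [mul_one]
  rw [← ENNReal.ofReal_tsum_of_nonneg (fun k => sq_nonneg _) hx]
  exact ENNReal.ofReal_lt_top

/-- Pairing `A y + c y = X` with `f k` forces the coordinates of `y` to be `x k / (Λ k ^ 2 + c)`,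
whatever the part of `y` orthogonal to the system. -/
lemma isSpectralMeasure_coordMeasure (hA : IsSelfAdjoint A) (hE : IsEigenSystem A f Λ)
    {x : ℕ → ℝ} {X : H} (hX : HasSum (fun k => x k • f k) X) :
    IsSpectralMeasure A X (coordMeasure Λ x) := by
  have hx : Summable fun k => x k ^ 2 := (summable_smul_iff hE.orthonormal).1 hX.summable
  have hfin := isFiniteMeasure_coordMeasure Λ hx
  refine ⟨hfin, fun c hc y hy => ?_⟩
  have hyk : ∀ k, inner ℝ (f k) (y : H) = x k * (Λ k ^ 2 + c)⁻¹ := fun k => by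
    have h1 : inner ℝ (f k) X = (Λ k ^ 2 + c) * inner ℝ (f k) (y : H) := by
      rw [← hy, inner_add_right, inner_apply_eig hA hE, inner_smul_right]; ring
    rw [inner_hasSum hE.orthonormal hX] at h1
    have : Λ k ^ 2 + c ≠ 0 := by positivity
    rw [h1]; field_simp
  have h2 := hasSum_inner_left hX (y : H)
  rw [real_inner_comm, ← h2.tsum_eq, integral_eq_lintegral_of_nonneg_ae, lintegral_coordMeasure]
  · simp_rw [hyk]
    have hnn : ∀ k, 0 ≤ x k * (x k * (Λ k ^ 2 + c)⁻¹) := fun k => by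
      rw [← mul_assoc]; exact mul_nonneg (mul_self_nonneg _) (by positivity)
    have hs : Summable fun k => x k * (x k * (Λ k ^ 2 + c)⁻¹) := by
      simpa only [hyk] using h2.summable
    rw [← ENNReal.toReal_ofReal (tsum_nonneg hnn), ENNReal.ofReal_tsum_of_nonneg hnn hs]
    congr 1
    refine tsum_congr fun k => ?_
    rw [← ENNReal.ofReal_mul (sq_nonneg _), Real.coe_toNNReal _ (sq_nonneg _)]
    congr 1
    ring
  · exact Eventually.of_forall fun s => by
      have := s.2
      simp only [Pi.zero_apply]
      positivity
  · exact (integrable_bcf _ (resolventFun c hc)).1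

/-- The resolvent equation is solved by the explicit series with coefficients `x k / (Λ k ^ 2 + c)`,
so surjectivity of `A + c` on all of `H` is never needed. -/
theorem spectralMeasure_of_hasSum (hA : IsSelfAdjoint A) (hE : IsEigenSystem A f Λ)
    {x : ℕ → ℝ} {X : H} (hX : HasSum (fun k => x k • f k) X) :
    spectralMeasure A X = coordMeasure Λ x := by
  refine spectralMeasure_eq (isSpectralMeasure_coordMeasure hA hE hX) fun c hc => ?_
  have hx : Summable fun k => x k ^ 2 := (summable_smul_iff hE.orthonormal).1 hX.summable
  have hy : Summable fun k => (x k * (Λ k ^ 2 + c)⁻¹) • f k := by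
    rw [summable_smul_iff hE.orthonormal]
    refine Summable.of_nonneg_of_le (fun _ => sq_nonneg _) (fun k => ?_) (hx.mul_left (c⁻¹ ^ 2))
    rw [mul_pow, mul_comm]
    gcongr
    nlinarith [sq_nonneg (Λ k)]
  have hz : Summable fun k => (Λ k ^ 2 * (x k * (Λ k ^ 2 + c)⁻¹)) • f k := by
    rw [summable_smul_iff hE.orthonormal]
    refine Summable.of_nonneg_of_le (fun _ => sq_nonneg _) (fun k => ?_) hx
    have : Λ k ^ 2 * (x k * (Λ k ^ 2 + c)⁻¹) = x k * (Λ k ^ 2 / (Λ k ^ 2 + c)) := by ring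
    rw [this, mul_pow]
    refine mul_le_of_le_one_right (sq_nonneg _) (pow_le_one₀ (by positivity) ?_)
    rw [div_le_one (by positivity)]
    linarith
  obtain ⟨h, hAY⟩ := mem_domain_of_hasSum hA hE hy.hasSum hz.hasSum
  refine ⟨⟨_, h⟩, ?_⟩
  rw [hAY]
  have h3 := hz.hasSum.add (hy.hasSum.const_smul c)
  refine h3.unique ?_
  convert hX using 2 with k
  have : Λ k ^ 2 + c ≠ 0 := by positivity
  rw [smul_smul, ← add_smul]
  congr 1
  field_simp

theorem powNorm_of_hasSum (hA : IsSelfAdjoint A) (hE : IsEigenSystem A f Λ) (α : ℝ)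
    {x : ℕ → ℝ} {X : H} (hX : HasSum (fun k => x k • f k) X) :
    powNorm A α X = (∑' k, ENNReal.ofReal (Λ k ^ (4 * α) * x k ^ 2)) ^ (1 / 2 : ℝ) := by
  rw [powNorm, spectralMeasure_of_hasSum hA hE hX, lintegral_coordMeasure]
  congr 1
  refine tsum_congr fun k => ?_
  rw [← ENNReal.ofReal_mul (sq_nonneg _), Real.coe_toNNReal _ (sq_nonneg _),
    ← Real.rpow_natCast, ← Real.rpow_natCast, ← Real.rpow_mul (hE.pos k).le, mul_comm]
  congr 3
  push_cast
  ring

theorem mem_gevrey_of_hasSum (hA : IsSelfAdjoint A) (hE : IsEigenSystem A f Λ) (φ : ℝ → ℝ)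
    (r α : ℝ) {x : ℕ → ℝ} {X : H} (hX : HasSum (fun k => x k • f k) X)
    (hsum : Summable fun k => Λ k ^ (4 * α) * x k ^ 2 * Real.exp (r * φ (Λ k))) :
    X ∈ gevrey A φ r α := by
  rw [gevrey, mem_ofPred_eq, spectralMeasure_of_hasSum hA hE hX]
  refine integrable_sum_dirac (fun _ => ENNReal.ofReal_ne_top) (hsum.congr fun k => ?_)
  have hpow : (Λ k ^ 2) ^ (2 * α) = Λ k ^ (4 * α) := by
    rw [← Real.rpow_natCast, ← Real.rpow_mul (hE.pos k).le]
    congr 1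
    push_cast
    ring
  rw [ENNReal.toReal_ofReal (sq_nonneg _), Real.coe_toNNReal _ (sq_nonneg _),
    Real.sqrt_sq (hE.pos k).le, hpow, Real.norm_of_nonneg]
  · ring
  · exact mul_nonneg (Real.rpow_nonneg (hE.pos k).le _) (Real.exp_nonneg _)

end Spectral

/-! ### Norms of eigenvector series and dominated convergence. -/

section Series

variable {H : Type*} [NormedAddCommGroup H] [InnerProductSpace ℝ H] [CompleteSpace H]
  {A : H →ₗ.[ℝ] H} {f : ℕ → H} {Λ : ℕ → ℝ}

lemma powNorm_quarter (hA : IsSelfAdjoint A) (hE : IsEigenSystem A f Λ) (n : ℕ) {α : ℝ}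
    (hα : 4 * α = n) {x : ℕ → ℝ} {X : H} (hX : HasSum (fun k => x k • f k) X)
    (hs : Summable fun k => Λ k ^ n * x k ^ 2) :
    powNorm A α X = ENNReal.ofReal (∑' k, Λ k ^ n * x k ^ 2) ^ (1 / 2 : ℝ) := by
  rw [powNorm_of_hasSum hA hE α hX, hα, ENNReal.ofReal_tsum_of_nonneg _ hs]
  · simp only [Real.rpow_natCast]
  · intro k
    have := hE.pos k
    positivity

/-- Dominated convergence for the series of squares. All continuity and differentiability statements
in `D(A^α)` reduce to this, with convergence checked one coordinate at a time. -/
lemma tendsto_powNorm_zero (hA : IsSelfAdjoint A) (hE : IsEigenSystem A f Λ) (n : ℕ) {α : ℝ}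
    (hα : 4 * α = n) {F : Filter ℝ} {y : ℕ → ℝ → ℝ} {Y : ℝ → H} {D : ℕ → ℝ} (hD : Summable D)
    (hY : ∀ᶠ s in F, HasSum (fun k => y k s • f k) (Y s))
    (hy : ∀ k, Tendsto (y k) F (𝓝 0))
    (hb : ∀ᶠ s in F, ∀ k, Λ k ^ n * y k s ^ 2 ≤ D k) :
    Tendsto (fun s => powNorm A α (Y s)) F (𝓝 0) := by
  have hnn : ∀ k s, 0 ≤ Λ k ^ n * y k s ^ 2 := fun k s => by
    have := hE.pos k
    positivity
  have h1 : Tendsto (fun s => ∑' k, Λ k ^ n * y k s ^ 2) F (𝓝 (∑' _ : ℕ, (0:ℝ))) := by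
    refine tendsto_tsum_of_dominated_convergence hD (fun k => ?_) ?_
    · simpa using ((hy k).pow 2).const_mul (Λ k ^ n)
    · filter_upwards [hb] with s hs k
      rw [Real.norm_of_nonneg (hnn k s)]
      exact hs k
  rw [tsum_zero] at h1
  have h2 := ((ENNReal.continuous_rpow_const (y := (1 / 2 : ℝ))).tendsto _).comp
    (ENNReal.tendsto_ofReal h1)
  simp only [ENNReal.ofReal_zero] at h2
  rw [ENNReal.zero_rpow_of_pos (by norm_num)] at h2
  refine h2.congr' ?_
  filter_upwards [hY, hb] with s hs hbs
  rw [powNorm_quarter hA hE n hα hs (Summable.of_nonneg_of_le (fun k => hnn k s) hbs hD)]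
  rfl

omit [CompleteSpace H] in
lemma norm_sq_of_hasSum (hf : Orthonormal ℝ f) {x : ℕ → ℝ} {X : H}
    (hX : HasSum (fun k => x k • f k) X) : HasSum (fun k => x k ^ 2) (‖X‖ ^ 2) := by
  have := hasSum_inner_left hX X
  simp only [inner_hasSum hf hX, real_inner_self_eq_norm_sq] at this
  simpa only [sq] using this

omit [CompleteSpace H] in
lemma tendsto_zero_of_hasSum (hf : Orthonormal ℝ f) {F : Filter ℝ} {y : ℕ → ℝ → ℝ} {Y : ℝ → H}
    {D : ℕ → ℝ} (hD : Summable D)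
    (hY : ∀ᶠ s in F, HasSum (fun k => y k s • f k) (Y s))
    (hy : ∀ k, Tendsto (y k) F (𝓝 0))
    (hb : ∀ᶠ s in F, ∀ k, y k s ^ 2 ≤ D k) :
    Tendsto Y F (𝓝 0) := by
  have h1 : Tendsto (fun s => ∑' k, y k s ^ 2) F (𝓝 (∑' _ : ℕ, (0:ℝ))) := by
    refine tendsto_tsum_of_dominated_convergence hD (fun k => ?_) ?_
    · simpa using (hy k).pow 2
    · filter_upwards [hb] with s hs k
      rw [Real.norm_of_nonneg (sq_nonneg _)]
      exact hs k
  rw [tsum_zero] at h1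
  rw [tendsto_zero_iff_norm_tendsto_zero]
  have h2 : Tendsto (fun s => ‖Y s‖ ^ 2) F (𝓝 0) := by
    refine h1.congr' ?_
    filter_upwards [hY] with s hs
    exact (norm_sq_of_hasSum hf hs).tsum_eq
  simpa [Function.comp_def] using (Real.continuous_sqrt.tendsto 0).comp h2

end Series

/-! ### Scalar calculus and the recovery of the nonlinearity. -/

section Scalar

lemma abs_sub_le_of_hasDerivWithinAt {T B : ℝ} {g g' : ℝ → ℝ}
    (hg : ∀ t ∈ Icc 0 T, HasDerivWithinAt g (g' t) (Icc 0 T) t)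
    (hB : ∀ t ∈ Icc 0 T, |g' t| ≤ B) {s t : ℝ} (hs : s ∈ Icc 0 T) (ht : t ∈ Icc 0 T) :
    |g s - g t| ≤ B * |s - t| :=
  (convex_Icc 0 T).norm_image_sub_le_of_norm_hasDerivWithin_le hg hB ht hs

lemma abs_slope_sub_le {T B : ℝ} {g g' : ℝ → ℝ}
    (hg : ∀ t ∈ Icc 0 T, HasDerivWithinAt g (g' t) (Icc 0 T) t)
    (hB : ∀ t ∈ Icc 0 T, |g' t| ≤ B) {s t : ℝ} (hs : s ∈ Icc 0 T) (ht : t ∈ Icc 0 T)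
    (hst : s ≠ t) : |(s - t)⁻¹ * (g s - g t) - g' t| ≤ 2 * B := by
  have h1 : |(s - t)⁻¹ * (g s - g t)| ≤ B := by
    have := abs_pos.2 (sub_ne_zero.2 hst)
    rw [abs_mul, abs_inv, inv_mul_le_iff₀ this, mul_comm]
    exact abs_sub_le_of_hasDerivWithinAt hg hB hs ht
  have h2 := hB t ht
  have := abs_sub ((s - t)⁻¹ * (g s - g t)) (g' t)
  linarith

lemma tendsto_slope_sub {T : ℝ} {g : ℝ → ℝ} {d t : ℝ}
    (hg : HasDerivWithinAt g d (Icc 0 T) t) :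
    Tendsto (fun s => (s - t)⁻¹ * (g s - g t) - d) (𝓝[Icc 0 T \ {t}] t) (𝓝 0) := by
  have := (hasDerivWithinAt_iff_tendsto_slope.1 hg).sub_const d
  simpa [slope_def_field, div_eq_inv_mul, slope] using this

/-- By the mean value inequality the difference quotients minus the derivatives are dominated by `2
B k`, so they can be summed in the limit. -/
lemma hasDerivWithinAt_tsum_Icc {T : ℝ} {g g' : ℕ → ℝ → ℝ} {B : ℕ → ℝ} (hBs : Summable B)
    (hg : ∀ k, ∀ t ∈ Icc 0 T, HasDerivWithinAt (g k) (g' k t) (Icc 0 T) t)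
    (hB : ∀ k, ∀ t ∈ Icc 0 T, |g' k t| ≤ B k)
    (hsum : ∀ t ∈ Icc 0 T, Summable fun k => g k t) {t : ℝ} (ht : t ∈ Icc 0 T) :
    HasDerivWithinAt (fun s => ∑' k, g k s) (∑' k, g' k t) (Icc 0 T) t := by
  rw [hasDerivWithinAt_iff_tendsto_slope]
  have hg's : Summable fun k => g' k t := by
    refine Summable.of_norm_bounded hBs fun k => hB k t ht
  have h1 : Tendsto (fun s => ∑' k, ((s - t)⁻¹ * (g k s - g k t) - g' k t))
      (𝓝[Icc 0 T \ {t}] t) (𝓝 (∑' _ : ℕ, (0:ℝ))) := by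
    refine tendsto_tsum_of_dominated_convergence (hBs.mul_left 2)
      (fun k => tendsto_slope_sub (hg k t ht)) ?_
    filter_upwards [self_mem_nhdsWithin] with s hs k
    exact abs_slope_sub_le (hg k) (hB k) hs.1 ht hs.2
  rw [tsum_zero] at h1
  have h2 := h1.add_const (∑' k, g' k t)
  rw [zero_add] at h2
  refine h2.congr' ?_
  filter_upwards [self_mem_nhdsWithin] with s hs
  have hd : Summable fun k => (s - t)⁻¹ * (g k s - g k t) :=
    ((hsum s hs.1).sub (hsum t ht)).mul_left _
  rw [hd.tsum_sub hg's, tsum_mul_left, (hsum s hs.1).tsum_sub (hsum t ht), slope_def_field]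
  ring

/-- A continuous function with increments at least `κ (t - s)` has an inverse with which the
coefficient `c` can be written as an `ω`-continuous function of `θ`. -/
lemma exists_nonlinearity {ω : ℝ → ℝ} (hω : IsContinuityModulus ω) {T κ L : ℝ} (hT : 0 ≤ T)
    (hκ : 0 < κ) (hL : 0 ≤ L) {θ c : ℝ → ℝ} (hθ : ContinuousOn θ (Icc 0 T))
    (hinc : ∀ s ∈ Icc 0 T, ∀ t ∈ Icc 0 T, s ≤ t → κ * (t - s) ≤ θ t - θ s)
    (hc : ∀ a b, |c a - c b| ≤ L * ω |a - b|) (hcb : ∀ t, c t ∈ Icc 0 (3 / 2)) :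
    ∃ m : ℝ → ℝ, IsOmegaContinuous ω m ∧ (∀ a, m a ∈ Icc 0 (3 / 2)) ∧
      ∀ t ∈ Icc 0 T, m (θ t) = c t := by
  have h0 : (0:ℝ) ∈ Icc 0 T := ⟨le_rfl, hT⟩
  have h1 : T ∈ Icc 0 T := ⟨hT, le_rfl⟩
  have hle : θ 0 ≤ θ T := by
    have := hinc 0 h0 T h1 hT
    nlinarith
  -- The argument is clamped to the range of `θ`, which makes the inverse `τ`, and hence `m`,
  -- defined on all reals.
  have hex : ∀ a : ℝ, ∃ t ∈ Icc 0 T, θ t = max (θ 0) (min a (θ T)) := fun a => by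
    have := intermediate_value_Icc hT hθ
    obtain ⟨t, ht, h⟩ := this (a := max (θ 0) (min a (θ T)))
      ⟨le_max_left _ _, max_le hle (min_le_right _ _)⟩
    exact ⟨t, ht, h⟩
  choose τ hτ hτθ using hex
  have habs : ∀ s ∈ Icc 0 T, ∀ t ∈ Icc 0 T, κ * |s - t| ≤ |θ s - θ t| := by
    intro s hs t ht
    rcases le_total s t with h | h
    · rw [abs_sub_comm s, abs_sub_comm (θ s), abs_of_nonneg (sub_nonneg.2 h)]
      exact (hinc s hs t ht h).trans (le_abs_self _)
    · rw [abs_of_nonneg (sub_nonneg.2 h)]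
      exact (hinc t ht s hs h).trans (le_abs_self _)
  have hωn : ∀ n : ℕ, ∀ d, 0 ≤ d → ω (n * d) ≤ n * ω d := by
    intro n d hd
    induction n with
    | zero => simp [hω.map_zero]
    | succ n ih =>
      have := hω.subadditive (n * d) d (by positivity) hd
      push_cast
      rw [add_mul, one_mul, add_mul, one_mul]
      linarith
  -- The inverse has Lipschitz constant `κ⁻¹`; an integer above it is absorbed by the subadditivity
  -- of `ω`.
  obtain ⟨n, hn⟩ := exists_nat_ge κ⁻¹
  refine ⟨fun a => c (τ a), ⟨L * n, fun a b _ _ => ?_⟩, fun a => hcb _, fun t ht => ?_⟩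
  · have h2 : |θ (τ a) - θ (τ b)| ≤ |a - b| := by
      rw [hτθ, hτθ]
      rw [max_comm, max_comm (θ 0)]
      refine (abs_max_sub_max_le_abs _ _ _).trans ((abs_min_sub_min_le_max _ _ _ _).trans ?_)
      simp
    have h3 := habs _ (hτ a) _ (hτ b)
    have h4 : |τ a - τ b| ≤ n * |a - b| := by
      have : |τ a - τ b| ≤ κ⁻¹ * |a - b| := by
        rw [le_inv_mul_iff₀ hκ]; linarith
      exact this.trans (by gcongr)
    calc |c (τ a) - c (τ b)| ≤ L * ω |τ a - τ b| := hc _ _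
      _ ≤ L * ω (n * |a - b|) := by
          gcongr
          exact hω.monotoneOn (mem_Ici.2 (abs_nonneg _)) (mem_Ici.2 (by positivity)) h4
      _ ≤ L * (n * ω |a - b|) := by gcongr; exact hωn n _ (abs_nonneg _)
      _ = L * n * ω |a - b| := by ring
  · have h2 : θ (τ (θ t)) = θ t := by
      rw [hτθ]
      have e1 := hinc 0 h0 t ht ht.1
      have e2 := hinc t ht T h1 ht.2
      rw [min_eq_left, max_eq_right]
      · nlinarith [ht.1]
      · nlinarith [ht.2]
    have h3 := habs _ (hτ (θ t)) _ ht
    rw [h2, sub_self, abs_zero] at h3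
    have h4 : |τ (θ t) - t| ≤ 0 := by nlinarith [abs_nonneg (τ (θ t) - t)]
    have h5 : τ (θ t) = t := by
      have := abs_nonpos_iff.1 h4
      linarith
    simp only [h5]

end Scalar

/-! ### From scalar modes to a solution in `H`. -/

/-- `v`, with derivative `v'`, solves `v'' + q v = 0` on `[0, T]`. -/
structure IsOscillation (q : ℝ → ℝ) (T : ℝ) (v v' : ℝ → ℝ) : Prop where
  deriv : ∀ t ∈ Icc 0 T, HasDerivWithinAt v (v' t) (Icc 0 T) t
  deriv2 : ∀ t ∈ Icc 0 T, HasDerivWithinAt v' (-(q t * v t)) (Icc 0 T) t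

lemma IsOscillation.mono {q : ℝ → ℝ} {T T' : ℝ} {v v' : ℝ → ℝ} (h : IsOscillation q T v v')
    (hT : T' ≤ T) : IsOscillation q T' v v' :=
  ⟨fun t ht => (h.deriv t (Icc_subset_Icc_right hT ht)).mono (Icc_subset_Icc_right hT),
    fun t ht => (h.deriv2 t (Icc_subset_Icc_right hT ht)).mono (Icc_subset_Icc_right hT)⟩

/-- Solutions `V k` of `v'' + Λ k ^ 2 c v = 0` on `[0, T]` which are square summable in the
norm of `D(A^{3/4}) × D(A^{1/4})`, uniformly in time. -/
structure IsModeFamily (Λ : ℕ → ℝ) (c : ℝ → ℝ) (T : ℝ) (Q : ℕ → ℝ) (V V' : ℕ → ℝ → ℝ) :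
    Prop where
  lower : ∃ l > 0, ∀ k, l ≤ Λ k
  osc : ∀ k, IsOscillation (fun t => Λ k ^ 2 * c t) T (V k) (V' k)
  summable : Summable fun k => Q k ^ 2
  bound : ∀ k, ∀ t ∈ Icc 0 T, Λ k ^ 3 * V k t ^ 2 ≤ Q k ^ 2
  bound' : ∀ k, ∀ t ∈ Icc 0 T, Λ k * V' k t ^ 2 ≤ Q k ^ 2

/-- The function `t ↦ ∑ V k t • f k`. -/
noncomputable def modeSum {H : Type*} [NormedAddCommGroup H] [InnerProductSpace ℝ H] (f : ℕ → H)
    (V : ℕ → ℝ → ℝ) (t : ℝ) : H := ∑' k, V k t • f k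

section Modes

variable {Λ : ℕ → ℝ} {c : ℝ → ℝ} {T : ℝ} {Q : ℕ → ℝ} {V V' : ℕ → ℝ → ℝ}

lemma IsModeFamily.mono (h : IsModeFamily Λ c T Q V V') {T' : ℝ} (hT : T' ≤ T) :
    IsModeFamily Λ c T' Q V V' :=
  ⟨h.lower, fun k => (h.osc k).mono hT, h.summable,
    fun k t ht => h.bound k t (Icc_subset_Icc_right hT ht),
    fun k t ht => h.bound' k t (Icc_subset_Icc_right hT ht)⟩

lemma IsModeFamily.pos (h : IsModeFamily Λ c T Q V V') (k : ℕ) : 0 < Λ k := by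
  obtain ⟨l, hl, h⟩ := h.lower
  exact hl.trans_le (h k)

/-- The geometric mean of the two bounds; it controls the derivative of `Λ k ^ 2 * V k ^ 2`. -/
lemma IsModeFamily.abs_mul_le (h : IsModeFamily Λ c T Q V V') (k : ℕ) {t : ℝ}
    (ht : t ∈ Icc 0 T) : Λ k ^ 2 * |V k t * V' k t| ≤ Q k ^ 2 := by
  have h1 := h.bound k t ht
  have h2 := h.bound' k t ht
  have hp := h.pos k
  have h3 : (Λ k ^ 2 * |V k t * V' k t|) ^ 2 ≤ (Q k ^ 2) ^ 2 := by
    calc (Λ k ^ 2 * |V k t * V' k t|) ^ 2 = (Λ k ^ 3 * V k t ^ 2) * (Λ k * V' k t ^ 2) := by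
          rw [mul_pow, sq_abs]; ring
      _ ≤ Q k ^ 2 * Q k ^ 2 := by gcongr
      _ = _ := by ring
  exact (le_abs_self _).trans (abs_le_of_sq_le_sq h3 (sq_nonneg _))

/-- Bounds for lower powers of the eigenvalues. -/
lemma IsModeFamily.exists_bound (h : IsModeFamily Λ c T Q V V') : ∃ D : ℕ → ℝ, Summable D ∧
    (∀ n ≤ 3, ∀ k, ∀ t ∈ Icc 0 T, Λ k ^ n * V k t ^ 2 ≤ D k) ∧
    (∀ n ≤ 1, ∀ k, ∀ t ∈ Icc 0 T, Λ k ^ n * V' k t ^ 2 ≤ D k) ∧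
    (∀ k, ∀ t ∈ Icc 0 T, Λ k ^ 2 * |V k t * V' k t| ≤ D k) := by
  obtain ⟨l, hl, hle⟩ := h.lower
  obtain ⟨C, hC1, hC⟩ : ∃ C : ℝ, 1 ≤ C ∧ ∀ n ≤ 3, 1 ≤ C * l ^ n := by
    -- Lowering a power of `Λ k` by `j ≤ 3` costs at most `l⁻¹ ^ j`, since `l` bounds the
    -- eigenvalues from below.
    refine ⟨1 + l⁻¹ ^ 1 + l⁻¹ ^ 2 + l⁻¹ ^ 3, ?_, fun n hn => ?_⟩
    · have : 0 ≤ l⁻¹ ^ 1 + l⁻¹ ^ 2 + l⁻¹ ^ 3 := by positivity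
      linarith
    · have h1 : l⁻¹ ^ n ≤ 1 + l⁻¹ ^ 1 + l⁻¹ ^ 2 + l⁻¹ ^ 3 := by
        have p1 : 0 < l⁻¹ ^ 1 := by positivity
        have p2 : 0 < l⁻¹ ^ 2 := by positivity
        have p3 : 0 < l⁻¹ ^ 3 := by positivity
        rcases n with _ | _ | _ | _ | n
        · rw [pow_zero]; linarith
        · linarith
        · linarith
        · linarith
        · omega
      calc (1 : ℝ) = l⁻¹ ^ n * l ^ n := by rw [← mul_pow, inv_mul_cancel₀ hl.ne', one_pow]
        _ ≤ _ := by gcongr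
  have key : ∀ m ≤ 3, ∀ n ≤ m, ∀ k, ∀ a : ℝ, Λ k ^ m * a ^ 2 ≤ Q k ^ 2 →
      Λ k ^ n * a ^ 2 ≤ C * Q k ^ 2 := by
    intro m hm n hn k a ha
    obtain ⟨j, rfl⟩ := Nat.exists_eq_add_of_le hn
    have h1 := hC j (by omega)
    have hp := h.pos k
    have h2 : l ^ j ≤ Λ k ^ j := by gcongr; exact hle k
    have h3 : 0 ≤ Λ k ^ n * a ^ 2 := by positivity
    have hC0 : 0 ≤ C := by linarith
    calc Λ k ^ n * a ^ 2 = 1 * (Λ k ^ n * a ^ 2) := by ring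
      _ ≤ (C * Λ k ^ j) * (Λ k ^ n * a ^ 2) := by
          gcongr
          exact h1.trans (by gcongr)
      _ = C * (Λ k ^ (n + j) * a ^ 2) := by ring
      _ ≤ C * Q k ^ 2 := by gcongr
  refine ⟨fun k => C * Q k ^ 2, h.summable.mul_left C, fun n hn k t ht =>
    key 3 le_rfl n hn k _ (h.bound k t ht), fun n hn k t ht =>
    key 1 (by norm_num) n hn k _ (by simpa using h.bound' k t ht), fun k t ht => ?_⟩
  exact (h.abs_mul_le k ht).trans (le_mul_of_one_le_left (sq_nonneg _) hC1)

lemma IsModeFamily.continuousWithinAt (h : IsModeFamily Λ c T Q V V') (k : ℕ) {t : ℝ}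
    (ht : t ∈ Icc 0 T) : ContinuousWithinAt (V k) (Icc 0 T) t :=
  ((h.osc k).deriv t ht).continuousWithinAt

lemma IsModeFamily.continuousWithinAt' (h : IsModeFamily Λ c T Q V V') (k : ℕ) {t : ℝ}
    (ht : t ∈ Icc 0 T) : ContinuousWithinAt (V' k) (Icc 0 T) t :=
  ((h.osc k).deriv2 t ht).continuousWithinAt

variable {H : Type*} [NormedAddCommGroup H] [InnerProductSpace ℝ H] [CompleteSpace H]
  {A : H →ₗ.[ℝ] H} {f : ℕ → H}

lemma IsModeFamily.hasSum (h : IsModeFamily Λ c T Q V V') (hf : Orthonormal ℝ f) {t : ℝ}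
    (ht : t ∈ Icc 0 T) : HasSum (fun k => V k t • f k) (modeSum f V t) := by
  obtain ⟨D, hD, h1, -⟩ := h.exists_bound
  refine ((summable_smul_iff hf).2 ?_).hasSum
  refine Summable.of_nonneg_of_le (fun k => sq_nonneg _) (fun k => ?_) hD
  simpa using h1 0 (by norm_num) k t ht

lemma IsModeFamily.hasSum' (h : IsModeFamily Λ c T Q V V') (hf : Orthonormal ℝ f) {t : ℝ}
    (ht : t ∈ Icc 0 T) : HasSum (fun k => V' k t • f k) (modeSum f V' t) := by
  obtain ⟨D, hD, -, h1, -⟩ := h.exists_bound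
  refine ((summable_smul_iff hf).2 ?_).hasSum
  refine Summable.of_nonneg_of_le (fun k => sq_nonneg _) (fun k => ?_) hD
  simpa using h1 0 (by norm_num) k t ht

lemma isC0_of_bound (hA : IsSelfAdjoint A) (hE : IsEigenSystem A f Λ) {n : ℕ} {α : ℝ}
    (hα : 4 * α = n) {W : ℕ → ℝ → ℝ} {D : ℕ → ℝ} (hD : Summable D)
    (hW0 : ∀ k, ∀ t ∈ Icc 0 T, W k t ^ 2 ≤ D k)
    (hW : ∀ k, ∀ t ∈ Icc 0 T, Λ k ^ n * W k t ^ 2 ≤ D k)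
    (hc : ∀ k, ∀ t ∈ Icc 0 T, ContinuousWithinAt (W k) (Icc 0 T) t) :
    IsC0 A α T (modeSum f W) := by
  have hs : ∀ t ∈ Icc 0 T, HasSum (fun k => W k t • f k) (modeSum f W t) := fun t ht =>
    ((summable_smul_iff hE.orthonormal).2
      (Summable.of_nonneg_of_le (fun k => sq_nonneg _) (fun k => hW0 k t ht) hD)).hasSum
  have hlim : ∀ t ∈ Icc 0 T, ∀ k, Tendsto (fun s => W k s - W k t) (𝓝[Icc 0 T] t) (𝓝 0) :=
    fun t ht k => by simpa using Tendsto.sub_const (hc k t ht) (W k t)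
  have hdiff : ∀ t ∈ Icc 0 T, ∀ᶠ s in 𝓝[Icc 0 T] t,
      HasSum (fun k => (W k s - W k t) • f k) (modeSum f W s - modeSum f W t) := by
    intro t ht
    filter_upwards [self_mem_nhdsWithin] with s hs'
    simpa only [sub_smul] using (hs s hs').sub (hs t ht)
  have hnn : ∀ k, 0 ≤ Λ k ^ n := fun k => by have := hE.pos k; positivity
  have hsq : ∀ a b : ℝ, (a - b) ^ 2 ≤ 2 * a ^ 2 + 2 * b ^ 2 := fun a b => by
    nlinarith [sq_nonneg (a + b)]
  refine ⟨fun t ht => ?_, fun t ht => ?_, fun t ht => ?_⟩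
  · have hsum : Summable fun k => Λ k ^ n * W k t ^ 2 :=
      Summable.of_nonneg_of_le (fun k => mul_nonneg (hnn k) (sq_nonneg _))
        (fun k => hW k t ht) hD
    rw [powDomain, mem_ofPred_eq, powNorm_quarter hA hE n hα (hs t ht) hsum]
    exact ENNReal.rpow_lt_top_of_nonneg (by norm_num) ENNReal.ofReal_ne_top
  · have := tendsto_zero_of_hasSum hE.orthonormal (hD.mul_left 4) (hdiff t ht) (hlim t ht) (by
      filter_upwards [self_mem_nhdsWithin] with s hs' k
      have h1 := hW0 k s hs'
      have h2 := hW0 k t ht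
      linarith [hsq (W k s) (W k t)])
    have h3 := this.add_const (modeSum f W t)
    simpa [ContinuousWithinAt] using h3
  · refine tendsto_powNorm_zero hA hE n hα (hD.mul_left 4) (hdiff t ht) (hlim t ht) ?_
    filter_upwards [self_mem_nhdsWithin] with s hs' k
    have h1 := hW k s hs'
    have h2 := hW k t ht
    have h3 := mul_le_mul_of_nonneg_left (hsq (W k s) (W k t)) (hnn k)
    linarith

theorem IsModeFamily.isC0 (h : IsModeFamily Λ c T Q V V') (hA : IsSelfAdjoint A)
    (hE : IsEigenSystem A f Λ) {n : ℕ} {α : ℝ} (hα : 4 * α = n) (hn : n ≤ 3) :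
    IsC0 A α T (modeSum f V) := by
  obtain ⟨D, hD, h1, -⟩ := h.exists_bound
  exact isC0_of_bound hA hE hα hD (fun k t ht => by simpa using h1 0 (by norm_num) k t ht)
    (h1 n hn) fun k t ht => h.continuousWithinAt k ht

theorem IsModeFamily.isC0' (h : IsModeFamily Λ c T Q V V') (hA : IsSelfAdjoint A)
    (hE : IsEigenSystem A f Λ) {n : ℕ} {α : ℝ} (hα : 4 * α = n) (hn : n ≤ 1) :
    IsC0 A α T (modeSum f V') := by
  obtain ⟨D, hD, -, h1, -⟩ := h.exists_bound
  exact isC0_of_bound hA hE hα hD (fun k t ht => by simpa using h1 0 (by norm_num) k t ht)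
    (h1 n hn) fun k t ht => h.continuousWithinAt' k ht

/-- The mean value inequality bounds the error of the difference quotient of each mode by twice the
supremum of `V'`, hence its weighted square by `4 D k`, uniformly in time. -/
theorem IsModeFamily.isC1 (h : IsModeFamily Λ c T Q V V') (hA : IsSelfAdjoint A)
    (hE : IsEigenSystem A f Λ) : IsC1 A (1 / 4) T (modeSum f V) (modeSum f V') := by
  obtain ⟨D, hD, -, h1, -⟩ := h.exists_bound
  have hq : ∀ n ≤ 1, ∀ k, ∀ t ∈ Icc 0 T, ∀ s ∈ Icc 0 T \ {t},
      Λ k ^ n * ((s - t)⁻¹ * (V k s - V k t) - V' k t) ^ 2 ≤ 4 * D k := by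
    intro n hn k t ht s hs
    have hp : 0 < Λ k ^ n := pow_pos (hE.pos k) n
    have hB : ∀ t ∈ Icc 0 T, |V' k t| ≤ √(D k / Λ k ^ n) := fun t ht => by
      refine Real.abs_le_sqrt ?_
      rw [le_div_iff₀ hp, mul_comm]
      exact h1 n hn k t ht
    have h2 := abs_slope_sub_le (h.osc k).deriv hB hs.1 ht hs.2
    have h3 : ((s - t)⁻¹ * (V k s - V k t) - V' k t) ^ 2 ≤ (2 * √(D k / Λ k ^ n)) ^ 2 := by
      rw [← sq_abs]; gcongr
    have hD0 : 0 ≤ D k := le_trans (by positivity) (h1 n hn k t ht)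
    rw [mul_pow, Real.sq_sqrt (by positivity)] at h3
    calc _ ≤ Λ k ^ n * (2 ^ 2 * (D k / Λ k ^ n)) := by gcongr
      _ = 4 * D k := by field_simp; ring
  have hdiff : ∀ t ∈ Icc 0 T, ∀ s ∈ Icc 0 T \ {t},
      HasSum (fun k => ((s - t)⁻¹ * (V k s - V k t) - V' k t) • f k)
        ((s - t)⁻¹ • (modeSum f V s - modeSum f V t) - modeSum f V' t) := by
    intro t ht s hs
    have := (((h.hasSum hE.orthonormal hs.1).sub (h.hasSum hE.orthonormal ht)).const_smul
      (s - t)⁻¹).sub (h.hasSum' hE.orthonormal ht)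
    convert this using 2 with k
    rw [sub_smul, mul_smul, sub_smul]
  refine ⟨h.isC0 hA hE (n := 1) (by norm_num) (by norm_num),
    h.isC0' hA hE (n := 1) (by norm_num) (by norm_num), fun t ht => ?_, fun t ht => ?_⟩
  · rw [hasDerivWithinAt_iff_tendsto_slope]
    have := tendsto_zero_of_hasSum hE.orthonormal (hD.mul_left 4) (F := 𝓝[Icc 0 T \ {t}] t)
      (by filter_upwards [self_mem_nhdsWithin] with s hs using hdiff t ht s hs)
      (fun k => tendsto_slope_sub ((h.osc k).deriv t ht))
      (by filter_upwards [self_mem_nhdsWithin] with s hs k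
          simpa using hq 0 (by norm_num) k t ht s hs)
    have h3 := this.add_const (modeSum f V' t)
    simp only [sub_add_cancel, zero_add] at h3
    exact h3
  · refine tendsto_powNorm_zero hA hE 1 (by norm_num) (hD.mul_left 4)
      (by filter_upwards [self_mem_nhdsWithin] with s hs using hdiff t ht s hs)
      (fun k => tendsto_slope_sub ((h.osc k).deriv t ht))
      (by filter_upwards [self_mem_nhdsWithin] with s hs k using hq 1 le_rfl k t ht s hs)

/-- The square of the norm of `D(A^{1/2})` along the mode sum. -/
theorem IsModeFamily.powNorm_half_sq (h : IsModeFamily Λ c T Q V V') (hA : IsSelfAdjoint A)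
    (hE : IsEigenSystem A f Λ) {t : ℝ} (ht : t ∈ Icc 0 T) :
    (powNorm A (1 / 2) (modeSum f V t)).toReal ^ 2 = ∑' k, Λ k ^ 2 * V k t ^ 2 := by
  obtain ⟨D, hD, h1, -⟩ := h.exists_bound
  have hnn : ∀ k, 0 ≤ Λ k ^ 2 * V k t ^ 2 := fun k => by positivity
  rw [powNorm_quarter hA hE 2 (by norm_num) (h.hasSum hE.orthonormal ht)
    (Summable.of_nonneg_of_le hnn (fun k => h1 2 (by norm_num) k t ht) hD),
    ← ENNReal.toReal_rpow, ENNReal.toReal_ofReal (tsum_nonneg hnn), ← Real.sqrt_eq_rpow,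
    Real.sq_sqrt (tsum_nonneg hnn)]

/-- The series of second derivatives need not converge in `H`. Against a test vector `w` in the
domain the factor `Λ k ^ 2` is moved onto `w`, where `⟨f k, A w⟩` is square summable by Bessel's
inequality. -/
theorem IsModeFamily.isSolution (h : IsModeFamily Λ c T Q V V') (hA : IsSelfAdjoint A)
    (hE : IsEigenSystem A f Λ) {M : ℝ} (hcM : ∀ t ∈ Icc 0 T, |c t| ≤ M) {m : ℝ → ℝ}
    (hm : ∀ t ∈ Icc 0 T, m (∑' k, Λ k ^ 2 * V k t ^ 2) = c t) :
    IsSolution A m T (modeSum f V) (modeSum f V') := by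
  obtain ⟨D, hD, h1, h1', -⟩ := h.exists_bound
  refine ⟨fun t ht => (h.isC0 hA hE (n := 2) (by norm_num) (by norm_num)).mem t
      (Ico_subset_Icc_self ht), fun t ht => ((h.isC1 hA hE).hasDeriv t
      (Ico_subset_Icc_self ht)).mono Ico_subset_Icc_self, fun t ht w => ?_⟩
  have ht' := Ico_subset_Icc_self ht
  have hM : 0 ≤ M := (abs_nonneg _).trans (hcM t ht')
  rw [h.powNorm_half_sq hA hE ht', hm t ht']
  have e1 : ∀ s ∈ Icc 0 T, inner ℝ (modeSum f V' s) (w : H)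
      = ∑' k, V' k s * inner ℝ (f k) (w : H) := fun s hs =>
    (hasSum_inner_left (h.hasSum' hE.orthonormal hs) (w : H)).tsum_eq.symm
  have e2 : -(c t * inner ℝ (modeSum f V t) (A w)) =
      ∑' k, -(Λ k ^ 2 * c t * V k t) * inner ℝ (f k) (w : H) := by
    rw [← (hasSum_inner_left (h.hasSum hE.orthonormal ht') (A w)).tsum_eq, ← tsum_mul_left,
      ← tsum_neg]
    refine tsum_congr fun k => ?_
    rw [inner_apply_eig hA hE]
    ring
  have hD0 : ∀ k, 0 ≤ D k := fun k => le_trans (by positivity) (h1 0 (by norm_num) k t ht')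
  have hAw : Summable fun k => (inner ℝ (f k) (A w)) ^ 2 := by
    have := hE.orthonormal.inner_products_summable (x := A w)
    simpa using this
  have key := hasDerivWithinAt_tsum_Icc (T := T)
    (g := fun k s => V' k s * inner ℝ (f k) (w : H))
    (g' := fun k s => -(Λ k ^ 2 * c s * V k s) * inner ℝ (f k) (w : H))
    (B := fun k => M * (D k + (inner ℝ (f k) (A w)) ^ 2))
    ((hD.add hAw).mul_left M) (fun k s hs => ((h.osc k).deriv2 s hs).mul_const _) ?_ ?_ ht'
  · rw [e2]
    refine (key.congr (fun s hs => e1 s hs) (e1 t ht')).mono Ico_subset_Icc_self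
  · intro k s hs
    have h3 : -(Λ k ^ 2 * c s * V k s) * inner ℝ (f k) (w : H) =
        -(c s * (V k s * inner ℝ (f k) (A w))) := by
      rw [inner_apply_eig hA hE]; ring
    rw [h3, abs_neg, abs_mul]
    have h4 := h1 0 (by norm_num) k s hs
    simp only [pow_zero, one_mul] at h4
    have h5 : |V k s * inner ℝ (f k) (A w)| ≤ D k + (inner ℝ (f k) (A w)) ^ 2 := by
      rw [abs_le]
      constructor <;> nlinarith [sq_nonneg (V k s + inner ℝ (f k) (A w)),
        sq_nonneg (V k s - inner ℝ (f k) (A w)), hD0 k]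
    exact mul_le_mul (hcM s hs) h5 (abs_nonneg _) hM
  · intro s hs
    exact (hasSum_inner_left (h.hasSum' hE.orthonormal hs) (w : H)).summable

/-- The function `∑ Λ k ^ 2 V k ^ 2` has positive increments if the first mode dominates. -/
lemma IsModeFamily.increments (h : IsModeFamily Λ c T Q V V') {κ : ℝ}
    (h0 : ∀ t ∈ Icc 0 T, 2 * κ ≤ 2 * Λ 0 ^ 2 * (V 0 t * V' 0 t))
    (hQ : ∑' k, 2 * Q (k + 1) ^ 2 ≤ κ) {s t : ℝ} (hs : s ∈ Icc 0 T) (ht : t ∈ Icc 0 T)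
    (hst : s ≤ t) :
    κ * (t - s) ≤ ∑' k, Λ k ^ 2 * V k t ^ 2 - ∑' k, Λ k ^ 2 * V k s ^ 2 := by
  obtain ⟨D, hD, h1, -⟩ := h.exists_bound
  have hsum : ∀ t ∈ Icc 0 T, Summable fun k => Λ k ^ 2 * V k t ^ 2 := fun t ht =>
    Summable.of_nonneg_of_le (fun k => by positivity) (fun k => h1 2 (by norm_num) k t ht) hD
  have hder : ∀ k, ∀ t ∈ Icc 0 T, HasDerivWithinAt (fun t => Λ k ^ 2 * V k t ^ 2)
      (2 * (Λ k ^ 2 * (V k t * V' k t))) (Icc 0 T) t := fun k t ht => by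
    refine ((((h.osc k).deriv t ht).fun_pow 2).const_mul (Λ k ^ 2)).congr_deriv ?_
    push_cast
    ring
  -- The first mode contributes a slope at least `2 κ`, and the other modes together can take away
  -- at most `κ`.
  have hfirst : 2 * κ * (t - s) ≤ Λ 0 ^ 2 * V 0 t ^ 2 - Λ 0 ^ 2 * V 0 s ^ 2 := by
    have hmono : MonotoneOn (fun t => Λ 0 ^ 2 * V 0 t ^ 2 - 2 * κ * t) (Icc 0 T) := by
      refine monotoneOn_of_hasDerivWithinAt_nonneg (convex_Icc 0 T)
        (f' := fun t => 2 * (Λ 0 ^ 2 * (V 0 t * V' 0 t)) - 2 * κ) ?_ ?_ ?_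
      · intro t ht
        exact ((hder 0 t ht).continuousWithinAt).sub (by fun_prop)
      · intro t ht
        exact (((hder 0 t (interior_subset ht)).mono interior_subset).sub
          (((hasDerivWithinAt_id t (interior (Icc 0 T))).const_mul (2 * κ)))).congr_deriv (by ring)
      · intro t ht
        have := h0 t (interior_subset ht)
        linarith
    have := hmono hs ht hst
    simp only at this
    linarith
  have htail : ∀ k, -(2 * Q k ^ 2) * (t - s) ≤ Λ k ^ 2 * V k t ^ 2 - Λ k ^ 2 * V k s ^ 2 := by
    intro k
    have h2 := abs_sub_le_of_hasDerivWithinAt (hder k) (B := 2 * Q k ^ 2) (fun t ht => by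
      rw [abs_mul, abs_mul, abs_of_pos (two_pos), abs_of_nonneg (sq_nonneg (Λ k))]
      have := h.abs_mul_le k ht
      linarith) ht hs
    rw [abs_of_nonneg (sub_nonneg.2 hst)] at h2
    have := (abs_le.1 h2).1
    linarith
  have hdsum := (hsum t ht).sub (hsum s hs)
  rw [← (hsum t ht).tsum_sub (hsum s hs), hdsum.tsum_eq_zero_add]
  have hQs : Summable fun k => -(2 * Q (k + 1) ^ 2) * (t - s) :=
    ((((summable_nat_add_iff 1).2 h.summable).mul_left 2).neg).mul_right _
  have h3 := hQs.tsum_le_tsum (fun k => htail (k + 1)) ((summable_nat_add_iff 1).2 hdsum)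
  rw [tsum_mul_right, tsum_neg] at h3
  have h4 := mul_le_mul_of_nonneg_right hQ (sub_nonneg.2 hst)
  linarith

lemma IsModeFamily.continuousOn_energy (h : IsModeFamily Λ c T Q V V') :
    ContinuousOn (fun t => ∑' k, Λ k ^ 2 * V k t ^ 2) (Icc 0 T) := by
  obtain ⟨D, hD, h1, -⟩ := h.exists_bound
  refine continuousOn_tsum (u := D) (fun k => ?_) hD fun k t ht => ?_
  · exact continuousOn_const.mul (ContinuousOn.pow (fun t ht => h.continuousWithinAt k ht) 2)
  · rw [Real.norm_of_nonneg (by positivity)]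
    exact h1 2 (by norm_num) k t ht

end Modes

/-! ### Gronwall inequalities and monotonicity without derivatives. -/

section Gronwall

variable {a b : ℝ}

lemma monotoneOn_mul_exp {g g' : ℝ → ℝ} {k : ℝ}
    (hg : ∀ t ∈ Icc a b, HasDerivWithinAt g (g' t) (Icc a b) t)
    (hk : ∀ t ∈ Icc a b, 0 ≤ g' t + k * g t) :
    MonotoneOn (fun t => g t * Real.exp (k * t)) (Icc a b) := by
  have hd : ∀ t ∈ Icc a b, HasDerivWithinAt (fun t => g t * Real.exp (k * t))
      ((g' t + k * g t) * Real.exp (k * t)) (Icc a b) t := fun t ht => by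
    refine ((hg t ht).mul (((hasDerivAt_id t).const_mul k).exp.hasDerivWithinAt)).congr_deriv ?_
    simp only [id]
    ring
  refine monotoneOn_of_hasDerivWithinAt_nonneg (convex_Icc a b)
    (fun t ht => (hd t ht).continuousWithinAt)
    (fun t ht => (hd t (interior_subset ht)).mono interior_subset) fun t ht => ?_
  exact mul_nonneg (hk t (interior_subset ht)) (Real.exp_nonneg _)

lemma antitoneOn_mul_exp {g g' : ℝ → ℝ} {k : ℝ}
    (hg : ∀ t ∈ Icc a b, HasDerivWithinAt g (g' t) (Icc a b) t)
    (hk : ∀ t ∈ Icc a b, g' t ≤ k * g t) :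
    AntitoneOn (fun t => g t * Real.exp (-k * t)) (Icc a b) := by
  have h := monotoneOn_mul_exp (g := fun t => -g t) (g' := fun t => -g' t) (k := -k)
    (fun t ht => (hg t ht).fun_neg) (fun t ht => by have := hk t ht; linarith)
  intro s hs t ht hst
  have := h hs ht hst
  simp only at this ⊢
  linarith

lemma le_mul_exp_sub {x y p q : ℝ} (h : x * Real.exp p ≤ y * Real.exp q) :
    x ≤ y * Real.exp (q - p) := by
  rw [Real.exp_sub, ← mul_div_assoc, le_div_iff₀ (Real.exp_pos p)]
  exact h

lemma le_mul_exp_abs {g g' : ℝ → ℝ} {k : ℝ}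
    (hg : ∀ t ∈ Icc a b, HasDerivWithinAt g (g' t) (Icc a b) t)
    (hk : ∀ t ∈ Icc a b, |g' t| ≤ k * g t) {s t : ℝ} (hs : s ∈ Icc a b) (ht : t ∈ Icc a b) :
    g t ≤ g s * Real.exp (k * |t - s|) := by
  rcases le_total s t with hst | hts
  · have h := antitoneOn_mul_exp hg (fun t ht => (abs_le.1 (hk t ht)).2) hs ht hst
    refine (le_mul_exp_sub h).trans_eq ?_
    rw [abs_of_nonneg (sub_nonneg.2 hst)]
    congr 2
    ring
  · have h := monotoneOn_mul_exp hg (fun t ht => by have := (abs_le.1 (hk t ht)).1; linarith)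
      ht hs hts
    refine (le_mul_exp_sub h).trans_eq ?_
    rw [abs_of_nonpos (sub_nonpos.2 hts)]
    congr 2
    ring

/-- A continuous function which at every point has a touching minorant with nonnegative right
derivative is nondecreasing. -/
lemma le_of_touching_minorant {f : ℝ → ℝ} (hf : ContinuousOn f (Icc a b))
    (h : ∀ x ∈ Ico a b, ∃ g : ℝ → ℝ, ∃ g' : ℝ, HasDerivWithinAt g g' (Icc a b) x ∧ 0 ≤ g' ∧
      g x = f x ∧ ∀ z ∈ Ioc x b, g z ≤ f z) {t : ℝ} (ht : t ∈ Icc a b) : f a ≤ f t := by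
  -- Applied to `-f` against the constant `-f a`: to the right of `x` the slopes of `f` are at least
  -- those of the touching function `g`.
  have key := image_le_of_liminf_slope_right_le_deriv_boundary (f := fun t => -f t) (a := a)
    (b := b) hf.neg (B := fun _ => -f a) (B' := fun _ => 0) le_rfl continuousOn_const
    (fun x _ => hasDerivWithinAt_const _ _ _) (fun x hx r hr => ?_) ht
  · simpa using key
  · obtain ⟨g, g', hg, hg', hgx, hle⟩ := h x hx
    have h1 : HasDerivWithinAt g g' (Ioc x b) x :=
      hg.mono (fun z hz => ⟨hx.1.trans hz.1.le, hz.2⟩)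
    rw [hasDerivWithinAt_iff_tendsto_slope' (by simp)] at h1
    rw [nhdsWithin_Ioc_eq_nhdsGT hx.2] at h1
    have h2 : ∀ᶠ z in 𝓝[>] x, -r < slope g x z := h1.eventually (lt_mem_nhds (by linarith))
    have h3 : ∀ᶠ z in 𝓝[>] x, z ∈ Ioc x b := Ioc_mem_nhdsGT hx.2
    refine Eventually.frequently ?_
    filter_upwards [h2, h3] with z hz1 hz2
    rw [slope_def_field] at hz1 ⊢
    have hpos : 0 < z - x := sub_pos.2 hz2.1
    have h4 := hle z hz2
    have h5 : (g z - g x) / (z - x) ≤ (f z - f x) / (z - x) := by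
      gcongr
      linarith
    have h6 : (-f z - -f x) / (z - x) = -((f z - f x) / (z - x)) := by ring
    rw [h6]
    linarith

end Gronwall

/-! ### Energy estimates and the linear Cauchy problem. -/

section Energy

variable {a b lam ρ : ℝ} {c v v' : ℝ → ℝ}

/-- Lower bound for the energy if `c` decreases at most at the exponential rate `ρ`. -/
theorem energy_lower (hc : ContinuousOn c (Icc a b))
    (hmono : MonotoneOn (fun t => c t * Real.exp (ρ * t)) (Icc a b)) (hρ : 0 ≤ ρ)
    (hv : ∀ t ∈ Icc a b, HasDerivWithinAt v (v' t) (Icc a b) t)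
    (hv' : ∀ t ∈ Icc a b, HasDerivWithinAt v' (-(lam ^ 2 * c t * v t)) (Icc a b) t)
    {t : ℝ} (ht : t ∈ Icc a b) :
    (v' a ^ 2 + lam ^ 2 * c a * v a ^ 2) * Real.exp (ρ * a) ≤
      (v' t ^ 2 + lam ^ 2 * c t * v t ^ 2) * Real.exp (ρ * t) := by
  have hcv : ContinuousOn v (Icc a b) := fun t ht => (hv t ht).continuousWithinAt
  have hcv' : ContinuousOn v' (Icc a b) := fun t ht => (hv' t ht).continuousWithinAt
  refine le_of_touching_minorant
    (f := fun t => (v' t ^ 2 + lam ^ 2 * c t * v t ^ 2) * Real.exp (ρ * t))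
    (by fun_prop) (fun x hx => ?_) ht
  have hx' := Ico_subset_Icc_self hx
  -- Only the monotone quantity `c e^{ρt}` is frozen at `x`. What remains is differentiable, the
  -- cross terms cancel by the equation, and the derivative at `x` is the nonnegative term left by
  -- the exponential.
  refine ⟨fun z => v' z ^ 2 * Real.exp (ρ * z) + (c x * Real.exp (ρ * x)) * (lam ^ 2 * v z ^ 2),
    ρ * v' x ^ 2 * Real.exp (ρ * x), ?_, by positivity, by ring, fun z hz => ?_⟩
  · have h1 := (((hv' x hx').fun_pow 2).mul
      (((hasDerivAt_id x).const_mul ρ).exp.hasDerivWithinAt)).add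
      ((((hv x hx').fun_pow 2).const_mul (lam ^ 2)).const_mul (c x * Real.exp (ρ * x)))
    refine h1.congr_deriv ?_
    simp only [id]
    push_cast
    ring
  · have h2 := hmono hx' ⟨hx.1.trans hz.1.le, hz.2⟩ hz.1.le
    have h3 := mul_le_mul_of_nonneg_right h2 (show 0 ≤ lam ^ 2 * v z ^ 2 by positivity)
    simp only at h3 ⊢
    linarith

/-- Upper bound for the hyperbolic energy if `c` decreases at most at the exponential rate `ρ`. -/
theorem energy_upper (hc : ContinuousOn c (Icc a b)) (hpos : ∀ t ∈ Icc a b, 0 < c t)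
    (hmono : MonotoneOn (fun t => c t * Real.exp (ρ * t)) (Icc a b)) (hρ : 0 ≤ ρ)
    (hv : ∀ t ∈ Icc a b, HasDerivWithinAt v (v' t) (Icc a b) t)
    (hv' : ∀ t ∈ Icc a b, HasDerivWithinAt v' (-(lam ^ 2 * c t * v t)) (Icc a b) t)
    {t : ℝ} (ht : t ∈ Icc a b) :
    (v' t ^ 2 / c t + lam ^ 2 * v t ^ 2) * Real.exp (-ρ * t) ≤
      (v' a ^ 2 / c a + lam ^ 2 * v a ^ 2) * Real.exp (-ρ * a) := by
  have hcv : ContinuousOn v (Icc a b) := fun t ht => (hv t ht).continuousWithinAt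
  have hcv' : ContinuousOn v' (Icc a b) := fun t ht => (hv' t ht).continuousWithinAt
  have key := le_of_touching_minorant
    (f := fun t => -((v' t ^ 2 / c t + lam ^ 2 * v t ^ 2) * Real.exp (-ρ * t)))
    (ContinuousOn.neg (ContinuousOn.mul (ContinuousOn.add
      (ContinuousOn.div (by fun_prop) hc fun t ht => (hpos t ht).ne') (by fun_prop))
      (by fun_prop))) (fun x hx => ?_) ht
  · simpa using key
  have hx' := Ico_subset_Icc_self hx
  have hcx := hpos x hx'
  -- Here the frozen quantity is `e^{-ρt} / c`, the reciprocal of the monotone one and hence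
  -- nonincreasing; the other exponential keeps varying and supplies the sign.
  refine ⟨fun z => -(v' z ^ 2 * (Real.exp (-ρ * x) / c x)
    + (lam ^ 2 * v z ^ 2) * Real.exp (-ρ * z)),
    ρ * (lam ^ 2 * v x ^ 2) * Real.exp (-ρ * x), ?_, by positivity, by field_simp,
    fun z hz => ?_⟩
  · have h1 := ((((hv' x hx').fun_pow 2).mul_const (Real.exp (-ρ * x) / c x)).add
      ((((hv x hx').fun_pow 2).const_mul (lam ^ 2)).mul
      (((hasDerivAt_id x).const_mul (-ρ)).exp.hasDerivWithinAt))).fun_neg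
    refine h1.congr_deriv ?_
    simp only [id]
    push_cast
    field_simp
    ring
  · have hz' : z ∈ Icc a b := ⟨hx.1.trans hz.1.le, hz.2⟩
    have h2 := hmono hx' hz' hz.1.le
    have hcz := hpos z hz'
    have h3 : Real.exp (-ρ * z) / c z ≤ Real.exp (-ρ * x) / c x := by
      rw [div_le_div_iff₀ hcz hcx]
      have e1 : Real.exp (-ρ * z) = (Real.exp (ρ * z))⁻¹ := by rw [← Real.exp_neg]; ring_nf
      have e2 : Real.exp (-ρ * x) = (Real.exp (ρ * x))⁻¹ := by rw [← Real.exp_neg]; ring_nf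
      rw [e1, e2, inv_mul_le_iff₀ (Real.exp_pos _), ← mul_assoc, mul_comm, ← mul_assoc,
        ← div_eq_mul_inv, le_div_iff₀ (Real.exp_pos _)]
      linarith
    have h4 := mul_le_mul_of_nonneg_left h3 (sq_nonneg (v' z))
    have h5 : v' z ^ 2 / c z * Real.exp (-ρ * z) = v' z ^ 2 * (Real.exp (-ρ * z) / c z) := by ring
    simp only
    rw [add_mul, h5]
    linarith

/-- Growth backwards in time in the regime `lam ^ 2 * c ≤ σ ^ 2`. -/
theorem energy_backward {σ : ℝ} (hσ : 0 ≤ σ)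
    (hc : ∀ t ∈ Icc a b, 0 ≤ lam ^ 2 * c t ∧ lam ^ 2 * c t ≤ σ ^ 2)
    (hv : ∀ t ∈ Icc a b, HasDerivWithinAt v (v' t) (Icc a b) t)
    (hv' : ∀ t ∈ Icc a b, HasDerivWithinAt v' (-(lam ^ 2 * c t * v t)) (Icc a b) t)
    {t : ℝ} (ht : t ∈ Icc a b) :
    v' t ^ 2 + σ ^ 2 * v t ^ 2 ≤
      (v' b ^ 2 + σ ^ 2 * v b ^ 2) * Real.exp (σ * (b - t)) := by
  have hb : b ∈ Icc a b := ⟨ht.1.trans ht.2, le_rfl⟩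
  have h := monotoneOn_mul_exp (g := fun t => v' t ^ 2 + σ ^ 2 * v t ^ 2)
    (g' := fun t => 2 * v t * v' t * (σ ^ 2 - lam ^ 2 * c t)) (k := σ) (a := a) (b := b)
    (fun t ht => ?_) (fun t ht => ?_) ht hb ht.2
  · refine (le_mul_exp_sub h).trans_eq ?_
    rw [mul_sub]
  · refine (((hv' t ht).fun_pow 2).add (((hv t ht).fun_pow 2).const_mul (σ ^ 2))).congr_deriv ?_
    push_cast
    ring
  · obtain ⟨h1, h2⟩ := hc t ht
    have h3 : |2 * v t * v' t * (σ ^ 2 - lam ^ 2 * c t)| ≤ σ * (v' t ^ 2 + σ ^ 2 * v t ^ 2) := by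
      rw [abs_mul, abs_of_nonneg (sub_nonneg.2 h2)]
      calc |2 * v t * v' t| * (σ ^ 2 - lam ^ 2 * c t) ≤ |2 * v t * v' t| * σ ^ 2 := by
            gcongr
            linarith
        _ = σ * |2 * (σ * v t) * v' t| := by
            simp only [abs_mul, abs_of_nonneg hσ]; ring
        _ ≤ _ := by
            gcongr
            rw [abs_le]
            constructor <;> nlinarith [sq_nonneg (σ * v t - v' t), sq_nonneg (σ * v t + v' t)]
    have := (abs_le.1 h3).1
    linarith

/-- Uniqueness for the Cauchy problem. -/
theorem eqOn_of_oscillation {q w w' : ℝ → ℝ} {M : ℝ} (hq : ∀ t ∈ Icc a b, |q t| ≤ M)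
    (hv : ∀ t ∈ Icc a b, HasDerivWithinAt v (v' t) (Icc a b) t)
    (hv' : ∀ t ∈ Icc a b, HasDerivWithinAt v' (-(q t * v t)) (Icc a b) t)
    (hw : ∀ t ∈ Icc a b, HasDerivWithinAt w (w' t) (Icc a b) t)
    (hw' : ∀ t ∈ Icc a b, HasDerivWithinAt w' (-(q t * w t)) (Icc a b) t)
    {s : ℝ} (hs : s ∈ Icc a b) (h0 : v s = w s) (h0' : v' s = w' s) {t : ℝ} (ht : t ∈ Icc a b) :
    v t = w t ∧ v' t = w' t := by
  have h := le_mul_exp_abs (g := fun t => (v t - w t) ^ 2 + (v' t - w' t) ^ 2)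
    (g' := fun t => 2 * (v t - w t) * (v' t - w' t) * (1 - q t)) (k := 1 + M) (a := a) (b := b)
    (fun t ht => ?_) (fun t ht => ?_) hs ht
  · simp only [h0, h0', sub_self, ne_eq, OfNat.ofNat_ne_zero, not_false_eq_true, zero_pow,
      add_zero, zero_mul] at h
    have h1 : (v t - w t) ^ 2 = 0 := by nlinarith [sq_nonneg (v t - w t), sq_nonneg (v' t - w' t)]
    have h2 : (v' t - w' t) ^ 2 = 0 := by
      nlinarith [sq_nonneg (v t - w t), sq_nonneg (v' t - w' t)]
    exact ⟨sub_eq_zero.1 (pow_eq_zero_iff two_ne_zero |>.1 h1),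
      sub_eq_zero.1 (pow_eq_zero_iff two_ne_zero |>.1 h2)⟩
  · refine ((((hv t ht).sub (hw t ht)).fun_pow 2).add
      (((hv' t ht).sub (hw' t ht)).fun_pow 2)).congr_deriv ?_
    simp only [Pi.sub_apply]
    push_cast
    ring
  · have h1 := abs_sub (1 : ℝ) (q t)
    have h2 := hq t ht
    rw [abs_mul, mul_comm]
    refine mul_le_mul (by simp at h1; linarith) ?_ (abs_nonneg _) (by linarith [abs_nonneg (q t)])
    rw [abs_le]
    constructor <;> nlinarith [sq_nonneg (v t - w t - (v' t - w' t)),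
      sq_nonneg (v t - w t + (v' t - w' t))]

lemma abs_clamp_sub_le (R x y : ℝ) :
    |max (-R) (min x R) - max (-R) (min y R)| ≤ |x - y| := by
  rw [max_comm, max_comm (-R)]
  refine (abs_max_sub_max_le_abs _ _ _).trans ((abs_min_sub_min_le_max _ _ _ _).trans ?_)
  simp

lemma clamp_of_abs_le {R x : ℝ} (h : |x| ≤ R) : max (-R) (min x R) = x := by
  rw [min_eq_left (abs_le.1 h).2, max_eq_right (abs_le.1 h).1]

lemma abs_clamp_le {R : ℝ} (hR : 0 ≤ R) (x : ℝ) : |max (-R) (min x R)| ≤ R :=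
  abs_le.2 ⟨le_max_left _ _, max_le (by linarith) (min_le_right _ _)⟩

lemma abs_clamp_le_abs {R : ℝ} (hR : 0 ≤ R) (x : ℝ) : |max (-R) (min x R)| ≤ |x| := by
  have := abs_clamp_sub_le R x 0
  rwa [clamp_of_abs_le (x := 0) (by simpa using hR), sub_zero, sub_zero] at this

/-- Global existence for the linear equation `v'' + q v = 0`. -/
theorem exists_oscillation {q : ℝ → ℝ} {T M : ℝ} (hqc : ContinuousOn q (Icc 0 T))
    (hq : ∀ t ∈ Icc 0 T, |q t| ≤ M) {s : ℝ} (hs : s ∈ Icc 0 T) (x₀ y₀ : ℝ) :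
    ∃ v v' : ℝ → ℝ, IsOscillation q T v v' ∧ v s = x₀ ∧ v' s = y₀ ∧
      ∀ t ∈ Icc 0 T, v t ^ 2 + v' t ^ 2 ≤ (x₀ ^ 2 + y₀ ^ 2) * Real.exp ((1 + M) * |t - s|) := by
  have hM : 0 ≤ M := (abs_nonneg _).trans (hq s hs)
  have hT : 0 ≤ T := hs.1.trans hs.2
  -- `R` is the a priori Gronwall bound on `[0, T]`. Clamping the field at `R` makes it bounded, so
  -- Picard–Lindelöf reaches all of `[0, T]`; the clamped solution obeys the same bound, hence the
  -- clamp is never active.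
  set R : ℝ := √((x₀ ^ 2 + y₀ ^ 2) * Real.exp ((1 + M) * T)) with hRdef
  have hR : 0 ≤ R := Real.sqrt_nonneg _
  let cl : ℝ → ℝ := fun x => max (-R) (min x R)
  let F : ℝ → ℝ × ℝ → ℝ × ℝ := fun t p => (cl p.2, -(q t * cl p.1))
  have hPL : IsPicardLindelof F (⟨s, hs⟩ : Icc 0 T) ((x₀, y₀) : ℝ × ℝ)
      (Real.toNNReal ((1 + M) * R * T)) 0 (Real.toNNReal ((1 + M) * R))
      (Real.toNNReal (1 + M)) := by
    constructor
    · intro t ht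
      refine LipschitzOnWith.of_dist_le_mul fun p _ p' _ => ?_
      rw [Real.coe_toNNReal _ (by positivity), Prod.dist_eq, Prod.dist_eq, Real.dist_eq,
        Real.dist_eq, Real.dist_eq, Real.dist_eq]
      have h1 := abs_clamp_sub_le R p.2 p'.2
      have h2 := abs_clamp_sub_le R p.1 p'.1
      refine max_le ?_ ?_
      · refine h1.trans ((le_max_right _ _).trans (le_mul_of_one_le_left (by positivity) ?_))
        linarith
      · have h3 : |-(q t * cl p.1) - -(q t * cl p'.1)| = |q t| * |cl p.1 - cl p'.1| := by
          rw [← abs_mul, ← abs_neg]; ring_nf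
        refine h3.le.trans (mul_le_mul ?_ (h2.trans (le_max_left _ _)) (abs_nonneg _)
          (by positivity))
        linarith [hq t ht]
    · intro p _
      exact continuousOn_const.prodMk ((hqc.mul continuousOn_const).neg)
    · intro t ht p _
      rw [Real.coe_toNNReal _ (by positivity), Prod.norm_def]
      refine max_le ?_ ?_
      · refine (abs_clamp_le hR p.2).trans ?_
        nlinarith
      · have h3 : ‖-(q t * cl p.1)‖ = |q t| * |cl p.1| := by
          rw [norm_neg, Real.norm_eq_abs, abs_mul]
        refine h3.le.trans (mul_le_mul ?_ (abs_clamp_le hR p.1) (abs_nonneg _) (by positivity))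
        linarith [hq t ht]
    · rw [Real.coe_toNNReal _ (by positivity), Real.coe_toNNReal _ (by positivity)]
      simp only [NNReal.coe_zero, sub_zero]
      gcongr
      exact max_le (by linarith [hs.1]) hs.2
  obtain ⟨α, hα0, hα⟩ := hPL.exists_eq_forall_mem_Icc_hasDerivWithinAt₀
  have hd1 : ∀ t ∈ Icc 0 T, HasDerivWithinAt (fun t => (α t).1) (cl (α t).2) (Icc 0 T) t :=
    fun t ht => ((hasFDerivAt_fst (𝕜 := ℝ) (p := α t)).comp_hasDerivWithinAt t (hα t ht))
  have hd2 : ∀ t ∈ Icc 0 T,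
      HasDerivWithinAt (fun t => (α t).2) (-(q t * cl (α t).1)) (Icc 0 T) t :=
    fun t ht => ((hasFDerivAt_snd (𝕜 := ℝ) (p := α t)).comp_hasDerivWithinAt t (hα t ht))
  simp only at hα0
  have hbound : ∀ t ∈ Icc 0 T, (α t).1 ^ 2 + (α t).2 ^ 2 ≤
      (x₀ ^ 2 + y₀ ^ 2) * Real.exp ((1 + M) * |t - s|) := by
    intro t ht
    have h := le_mul_exp_abs (g := fun t => (α t).1 ^ 2 + (α t).2 ^ 2)
      (g' := fun t => 2 * (α t).1 * cl (α t).2 - 2 * q t * (α t).2 * cl (α t).1) (k := 1 + M)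
      (fun t ht => ?_) (fun t ht => ?_) hs ht
    · simpa only [hα0] using h
    · refine (((hd1 t ht).fun_pow 2).add ((hd2 t ht).fun_pow 2)).congr_deriv ?_
      push_cast
      ring
    · have h1 := abs_sub (2 * (α t).1 * cl (α t).2) (2 * q t * (α t).2 * cl (α t).1)
      refine h1.trans ?_
      simp only [abs_mul, abs_of_pos (two_pos (α := ℝ))]
      have h2 : |(α t).1| * |cl (α t).2| ≤ |(α t).1| * |(α t).2| :=
        mul_le_mul_of_nonneg_left (abs_clamp_le_abs hR _) (abs_nonneg _)
      have h3 : |q t| * (|(α t).2| * |cl (α t).1|) ≤ M * (|(α t).2| * |(α t).1|) :=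
        mul_le_mul (hq t ht) (mul_le_mul_of_nonneg_left (abs_clamp_le_abs hR _) (abs_nonneg _))
          (by positivity) hM
      have h4 : 2 * (|(α t).1| * |(α t).2|) ≤ (α t).1 ^ 2 + (α t).2 ^ 2 := by
        rw [← sq_abs (α t).1, ← sq_abs (α t).2]
        nlinarith [sq_nonneg (|(α t).1| - |(α t).2|)]
      nlinarith
  have hR1 : ∀ t ∈ Icc 0 T, (α t).1 ^ 2 + (α t).2 ^ 2 ≤ R ^ 2 := by
    intro t ht
    rw [hRdef, Real.sq_sqrt (by positivity)]
    refine (hbound t ht).trans ?_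
    gcongr
    rw [abs_le]
    constructor <;> linarith [ht.1, ht.2, hs.1, hs.2]
  have hc1 : ∀ t ∈ Icc 0 T, cl (α t).1 = (α t).1 := fun t ht =>
    clamp_of_abs_le (abs_le_of_sq_le_sq (by nlinarith [hR1 t ht, sq_nonneg (α t).2]) hR)
  have hc2 : ∀ t ∈ Icc 0 T, cl (α t).2 = (α t).2 := fun t ht =>
    clamp_of_abs_le (abs_le_of_sq_le_sq (by nlinarith [hR1 t ht, sq_nonneg (α t).1]) hR)
  refine ⟨fun t => (α t).1, fun t => (α t).2, ⟨fun t ht => ?_, fun t ht => ?_⟩, by simp [hα0],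
    by simp [hα0], hbound⟩
  · simpa only [hc2 t ht] using hd1 t ht
  · simpa only [hc1 t ht] using hd2 t ht

end Energy

/-! ### The resonant coefficient. -/

open Real (sin cos exp)

/-- The `π`-periodic coefficient of an equation with an exponentially growing solution. -/
noncomputable def bump (x : ℝ) : ℝ := 1 - 4 / 5 * (sin x * cos x) - 1 / 25 * sin x ^ 4

/-- The exponent in `bumpSol`. -/
noncomputable def bumpExp (x : ℝ) : ℝ := (x - sin x * cos x) / 10

/-- The exponentially growing solution of `w'' + bump w = 0`. -/
noncomputable def bumpSol (x : ℝ) : ℝ := sin x * exp (bumpExp x)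

/-- The derivative of `bumpSol`. -/
noncomputable def bumpSol' (x : ℝ) : ℝ := (cos x + sin x ^ 3 / 5) * exp (bumpExp x)

lemma abs_sin_mul_cos_le (x : ℝ) : |sin x * cos x| ≤ 1 / 2 := by
  rw [abs_le]
  constructor <;> nlinarith [Real.sin_sq_add_cos_sq x, sq_nonneg (sin x - cos x),
    sq_nonneg (sin x + cos x)]

lemma sin_pow_four_mem (x : ℝ) : 0 ≤ sin x ^ 4 ∧ sin x ^ 4 ≤ 1 := by
  have h : sin x ^ 2 ≤ 1 := Real.sin_sq_le_one x
  have h2 : sin x ^ 4 = (sin x ^ 2) ^ 2 := by ring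
  rw [h2]
  exact ⟨by positivity, pow_le_one₀ (sq_nonneg _) h⟩

lemma bump_mem (x : ℝ) : 1 / 2 ≤ bump x ∧ bump x ≤ 3 / 2 := by
  have h1 := abs_le.1 (abs_sin_mul_cos_le x)
  have h2 := sin_pow_four_mem x
  unfold bump
  constructor <;> linarith [h1.1, h1.2, h2.1, h2.2]

lemma hasDerivAt_sin_mul_cos (x : ℝ) :
    HasDerivAt (fun x => sin x * cos x) (1 - 2 * sin x ^ 2) x := by
  refine ((Real.hasDerivAt_sin x).mul (Real.hasDerivAt_cos x)).congr_deriv ?_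
  nlinarith [Real.sin_sq_add_cos_sq x]

lemma hasDerivAt_bump (x : ℝ) :
    HasDerivAt bump (-(4 / 5 * (1 - 2 * sin x ^ 2)) - 4 / 25 * (sin x ^ 3 * cos x)) x := by
  have h := ((hasDerivAt_sin_mul_cos x).const_mul (4 / 5)).const_sub 1
  refine (h.sub (((Real.hasDerivAt_sin x).pow 4).const_mul (1 / 25))).congr_deriv ?_
  push_cast
  ring

lemma abs_bump_deriv_le (x : ℝ) :
    |-(4 / 5 * (1 - 2 * sin x ^ 2)) - 4 / 25 * (sin x ^ 3 * cos x)| ≤ 1 := by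
  have h1 := abs_le.1 (abs_sin_mul_cos_le x)
  have h2 : sin x ^ 2 ≤ 1 := Real.sin_sq_le_one x
  have h3 : |sin x ^ 2 * (sin x * cos x)| ≤ 1 * (1 / 2) := by
    rw [abs_mul, abs_of_nonneg (sq_nonneg _)]
    exact mul_le_mul h2 (abs_sin_mul_cos_le x) (abs_nonneg _) zero_le_one
  have h4 := abs_le.1 h3
  have h5 : sin x ^ 3 * cos x = sin x ^ 2 * (sin x * cos x) := by ring
  rw [h5, abs_le]
  have h6 := sq_nonneg (sin x)
  constructor <;> linarith [h4.1, h4.2]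

lemma abs_bump_sub_le (x y : ℝ) : |bump x - bump y| ≤ |x - y| := by
  have := convex_univ.norm_image_sub_le_of_norm_hasDerivWithin_le (f := bump) (C := 1)
    (fun z _ => (hasDerivAt_bump z).hasDerivWithinAt) (fun z _ => abs_bump_deriv_le z)
    (mem_univ y) (mem_univ x)
  simpa using this

/-- The derivative of `bump` is at least `-1` and `2 * bump` is at least `1`. -/
lemma monotone_bump_mul_exp : Monotone fun x => bump x * exp (2 * x) := by
  have hd : ∀ x, HasDerivAt (fun x => bump x * exp (2 * x))
      ((-(4 / 5 * (1 - 2 * sin x ^ 2)) - 4 / 25 * (sin x ^ 3 * cos x) + 2 * bump x)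
        * exp (2 * x)) x := fun x => by
    refine ((hasDerivAt_bump x).mul (((hasDerivAt_id x).const_mul 2).exp)).congr_deriv ?_
    simp only [id]
    ring
  refine monotone_of_hasDerivAt_nonneg hd fun x => ?_
  refine mul_nonneg ?_ (Real.exp_nonneg _)
  have h1 := (abs_le.1 (abs_bump_deriv_le x)).1
  have h2 := (bump_mem x).1
  linarith

lemma hasDerivAt_bumpExp (x : ℝ) : HasDerivAt bumpExp (sin x ^ 2 / 5) x := by
  refine (((hasDerivAt_id x).sub (hasDerivAt_sin_mul_cos x)).div_const 10).congr_deriv ?_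
  ring

lemma hasDerivAt_bumpSol (x : ℝ) : HasDerivAt bumpSol (bumpSol' x) x := by
  refine ((Real.hasDerivAt_sin x).mul (hasDerivAt_bumpExp x).exp).congr_deriv ?_
  unfold bumpSol'
  ring

/-- The coefficient is read off from the solution: `bump` is `-w'' / w` for `w = sin ·
exp(bumpExp)`, where the derivative `sin² / 5` of `bumpExp` makes this quotient free of
singularities at the zeros of `sin`. -/
lemma hasDerivAt_bumpSol' (x : ℝ) : HasDerivAt bumpSol' (-(bump x * bumpSol x)) x := by
  refine (((Real.hasDerivAt_cos x).add (((Real.hasDerivAt_sin x).pow 3).div_const 5)).mul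
    (hasDerivAt_bumpExp x).exp).congr_deriv ?_
  simp only [Pi.add_apply, Pi.pow_apply]
  unfold bumpSol bump
  push_cast
  ring

lemma sin_pi_mul (N : ℕ) : sin (2 * Real.pi * N) = 0 := by
  have := Real.sin_nat_mul_pi (2 * N)
  push_cast at this
  rwa [mul_right_comm] at this

lemma cos_pi_mul (N : ℕ) : cos (2 * Real.pi * N) = 1 := by
  rw [mul_comm]
  exact Real.cos_nat_mul_two_pi N

lemma bump_pi_mul (N : ℕ) : bump (2 * Real.pi * N) = 1 := by
  simp [bump, sin_pi_mul]

/-! ### The profile of a single stage. -/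

/-- The profile of one stage of the coefficient: a ramp, then `40 N` periods of `bump`, then
the constant `1`. -/
noncomputable def profile (N : ℕ) (x : ℝ) : ℝ :=
  max 0 (min (x / (Real.pi * N) - 1) 1) * bump (max (2 * Real.pi * N) (min x (82 * Real.pi * N)))

section Profile

variable {N : ℕ} (hN : 1 ≤ N)

include hN

lemma pi_mul_pos : 0 < Real.pi * N := by
  have : (1 : ℝ) ≤ N := by exact_mod_cast hN
  have := Real.pi_pos
  positivity

omit hN in
lemma ramp_mem (x : ℝ) : 0 ≤ max 0 (min x 1) ∧ max 0 (min x 1) ≤ 1 :=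
  ⟨le_max_left _ _, max_le zero_le_one (min_le_right _ _)⟩

omit hN in
lemma profile_nonneg (x : ℝ) : 0 ≤ profile N x := by
  have := bump_mem (max (2 * Real.pi * N) (min x (82 * Real.pi * N)))
  exact mul_nonneg (ramp_mem _).1 (by linarith [this.1])

omit hN in
lemma profile_le (x : ℝ) : profile N x ≤ 3 / 2 := by
  have := bump_mem (max (2 * Real.pi * N) (min x (82 * Real.pi * N)))
  have h2 := ramp_mem (x / (Real.pi * N) - 1)
  unfold profile
  nlinarith

lemma profile_of_le_pi {x : ℝ} (hx : x ≤ Real.pi * N) : profile N x = 0 := by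
  have hp := pi_mul_pos hN
  have : x / (Real.pi * N) ≤ 1 := (div_le_one hp).2 hx
  unfold profile
  rw [max_eq_left, zero_mul]
  exact (min_le_left _ _).trans (by linarith)

omit hN in
lemma profile_of_le {x : ℝ} (hx : x ≤ 2 * Real.pi * N) : profile N x ≤ 1 := by
  unfold profile
  rw [max_eq_left ((min_le_left _ _).trans hx), bump_pi_mul, mul_one]
  exact (ramp_mem _).2

lemma ramp_eq_one {x : ℝ} (hx : 2 * Real.pi * N ≤ x) : max 0 (min (x / (Real.pi * N) - 1) 1) = 1 := by
  have hp := pi_mul_pos hN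
  have : 2 ≤ x / (Real.pi * N) := (le_div_iff₀ hp).2 (by linarith)
  rw [min_eq_right (by linarith), max_eq_right zero_le_one]

lemma profile_of_mem {x : ℝ} (hx : 2 * Real.pi * N ≤ x) (hx' : x ≤ 82 * Real.pi * N) :
    profile N x = bump x := by
  unfold profile
  rw [ramp_eq_one hN hx, min_eq_left hx', max_eq_right hx, one_mul]

lemma half_le_profile {x : ℝ} (hx : 2 * Real.pi * N ≤ x) : 1 / 2 ≤ profile N x := by
  unfold profile
  rw [ramp_eq_one hN hx, one_mul]
  exact (bump_mem _).1

lemma profile_of_ge {x : ℝ} (hx : 82 * Real.pi * N ≤ x) : profile N x = 1 := by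
  have hp := pi_mul_pos hN
  have h2 : 2 * Real.pi * N ≤ 82 * Real.pi * N := by linarith
  unfold profile
  rw [ramp_eq_one hN (h2.trans hx), min_eq_right hx, max_eq_right h2, one_mul]
  have := bump_pi_mul (41 * N)
  push_cast at this
  rw [← this]
  congr 1
  ring

/-- The ramp has slope `1 / (π N) ≤ 1`, so the Lipschitz constant does not depend on the length of
the stage. -/
lemma abs_profile_sub_le (x y : ℝ) : |profile N x - profile N y| ≤ 3 * |x - y| := by
  have hp := pi_mul_pos hN
  have hp1 : 1 ≤ Real.pi * N := by
    have h1 : (1 : ℝ) ≤ N := by exact_mod_cast hN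
    nlinarith [Real.pi_gt_three]
  set r := max 0 (min (x / (Real.pi * N) - 1) 1)
  set r' := max 0 (min (y / (Real.pi * N) - 1) 1)
  set b := max (2 * Real.pi * N) (min x (82 * Real.pi * N))
  set b' := max (2 * Real.pi * N) (min y (82 * Real.pi * N))
  have hcl : ∀ p q u w : ℝ, |max p (min u q) - max p (min w q)| ≤ |u - w| := fun p q u w => by
    rw [max_comm, max_comm p]
    refine (abs_max_sub_max_le_abs _ _ _).trans ((abs_min_sub_min_le_max _ _ _ _).trans ?_)
    simp
  have h1 : |r - r'| ≤ |x - y| := by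
    refine (hcl _ _ _ _).trans ?_
    have : x / (Real.pi * N) - 1 - (y / (Real.pi * N) - 1) = (x - y) / (Real.pi * N) := by ring
    rw [this, abs_div, abs_of_pos hp]
    exact div_le_self (abs_nonneg _) hp1
  have h2 : |bump b - bump b'| ≤ |x - y| := (abs_bump_sub_le _ _).trans (hcl _ _ _ _)
  have e : profile N x - profile N y = (r - r') * bump b + r' * (bump b - bump b') := by
    unfold profile; ring
  rw [e]
  refine (abs_add_le _ _).trans ?_
  rw [abs_mul, abs_mul]
  have h3 : |bump b| ≤ 3 / 2 := by
    have := bump_mem b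
    rw [abs_of_nonneg (by linarith [this.1])]; exact this.2
  have h4 : |r'| ≤ 1 := by
    rw [abs_of_nonneg (ramp_mem _).1]; exact (ramp_mem _).2
  have h5 := mul_le_mul h1 h3 (abs_nonneg _) (abs_nonneg _)
  have h6 := mul_le_mul h4 h2 (abs_nonneg _) zero_le_one
  linarith [abs_nonneg (x - y)]

/-- The ramp is nondecreasing, so the profile can decrease only through `bump`, whose relative rate
of decrease is at most `2`. -/
lemma monotone_profile_mul_exp : Monotone fun x => profile N x * exp (2 * x) := by
  have hp := pi_mul_pos hN
  intro x y hxy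
  have hr : max 0 (min (x / (Real.pi * N) - 1) 1) ≤ max 0 (min (y / (Real.pi * N) - 1) 1) := by
    gcongr
  set b := max (2 * Real.pi * N) (min x (82 * Real.pi * N)) with hb
  set b' := max (2 * Real.pi * N) (min y (82 * Real.pi * N)) with hb'
  have hbb : b ≤ b' := by rw [hb, hb']; gcongr
  -- Clamping is 1-Lipschitz, so the part of `x` removed by it is nondecreasing too. This lets `exp
  -- (2 * x)` be split into a factor for `bump b` and a monotone remainder.
  have hcl : x - b ≤ y - b' := by
    have h2 : 2 * Real.pi * N ≤ 82 * Real.pi * N := by linarith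
    rw [hb, hb']
    rcases le_total x (82 * Real.pi * N) with h | h <;> rcases le_total y (82 * Real.pi * N) with h' | h' <;>
      rcases le_total x (2 * Real.pi * N) with h3 | h3 <;> rcases le_total y (2 * Real.pi * N) with h4 | h4 <;>
      simp only [min_eq_left, min_eq_right, max_eq_left, max_eq_right, h, h', h3, h4, h2] <;>
      linarith
  have h1 := monotone_bump_mul_exp hbb
  simp only at h1
  have h2 : exp (2 * (x - b)) ≤ exp (2 * (y - b')) := by gcongr
  have e : ∀ u w : ℝ, exp (2 * u) = exp (2 * w) * exp (2 * (u - w)) := fun u w => by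
    rw [← Real.exp_add]; congr 1; ring
  unfold profile
  simp only
  rw [← hb, ← hb', e x b, e y b', mul_assoc, mul_assoc, ← mul_assoc (bump b),
    ← mul_assoc (bump b')]
  have hb0 : 0 ≤ bump b * exp (2 * b) :=
    mul_nonneg (by linarith [(bump_mem b).1]) (Real.exp_nonneg _)
  have hb0' : 0 ≤ bump b' * exp (2 * b') := hb0.trans h1
  exact mul_le_mul hr (mul_le_mul h1 h2 (Real.exp_nonneg _) hb0')
    (mul_nonneg hb0 (Real.exp_nonneg _)) (ramp_mem _).1

end Profile

/-! ### The cascade of stages accumulating at time zero. -/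

/-- The parameters of the coefficient: frequencies `S`, amplitudes `W`, numbers of periods `N`. -/
structure IsCascade (ω : ℝ → ℝ) (S W : ℕ → ℝ) (N : ℕ → ℕ) : Prop where
  freq_pos : ∀ i, 0 < S i
  amp_eq : ∀ i, W i = ω (1 / S i)
  amp_le : ∀ i, W i ≤ 1
  amp_quarter : ∀ i, W (i + 1) ≤ W i / 4
  one_le : ∀ i, 1 ≤ N i
  time_le : ∀ i, 82 * Real.pi * N (i + 1) / S (i + 1) ≤ Real.pi * N i / S i

/-- The coefficient of the linear equation. -/
noncomputable def coef (S W : ℕ → ℝ) (N : ℕ → ℕ) (t : ℝ) : ℝ :=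
  ⨆ i, W i * profile (N i) (S i * t)

section Coef

variable {ω : ℝ → ℝ} {S W : ℕ → ℝ} {N : ℕ → ℕ}

lemma IsCascade.amp_pos (h : IsCascade ω S W N) (hω : IsContinuityModulus ω) (i : ℕ) :
    0 < W i := by
  rw [h.amp_eq]
  exact hω.pos _ (one_div_pos.2 (h.freq_pos i))

variable (h : IsCascade ω S W N) (hω : IsContinuityModulus ω)

include h hω

lemma IsCascade.amp_lt {i j : ℕ} (hij : i < j) : W j ≤ W i / 4 := by
  induction j, hij using Nat.le_induction with
  | base => exact h.amp_quarter i
  | succ j hj ih =>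
    have := h.amp_quarter j
    have h2 := h.amp_pos hω i
    have h3 := h.amp_pos hω j
    linarith

omit hω in
-- Stages are run in reverse order of index: a stage of larger index is over before one of smaller
-- index leaves zero.
lemma IsCascade.time_lt {i j : ℕ} (hij : i < j) : 82 * Real.pi * N j / S j ≤ Real.pi * N i / S i := by
  induction j, hij using Nat.le_induction with
  | base => exact h.time_le i
  | succ j hj ih =>
    refine (h.time_le j).trans (le_trans ?_ ih)
    have := h.freq_pos j
    have := pi_mul_pos (h.one_le j)
    gcongr
    linarith [Real.pi_pos]

lemma IsCascade.term_mem (i : ℕ) (t : ℝ) :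
    0 ≤ W i * profile (N i) (S i * t) ∧ W i * profile (N i) (S i * t) ≤ 3 / 2 * W i := by
  have h1 := h.amp_pos hω i
  have h3 := profile_nonneg (N := N i) (S i * t)
  have h4 := profile_le (N := N i) (S i * t)
  exact ⟨by positivity, by nlinarith⟩

lemma IsCascade.bddAbove (t : ℝ) :
    BddAbove (range fun i => W i * profile (N i) (S i * t)) := by
  refine ⟨3 / 2, ?_⟩
  rintro _ ⟨i, rfl⟩
  have := (h.term_mem hω i t).2
  have h2 := h.amp_le i
  simp only
  linarith

lemma IsCascade.term_le (i : ℕ) (t : ℝ) : W i * profile (N i) (S i * t) ≤ coef S W N t :=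
  le_ciSup (h.bddAbove hω t) i

lemma IsCascade.coef_mem (t : ℝ) : coef S W N t ∈ Icc 0 (3 / 2) := by
  refine ⟨(h.term_mem hω 0 t).1.trans (h.term_le hω 0 t), ciSup_le fun i => ?_⟩
  have := (h.term_mem hω i t).2
  have h2 := h.amp_le i
  linarith

/-- A modulus common to all terms passes to the supremum. At distances above `1 / S i` the amplitude
`W i = ω (1 / S i)` suffices; below, the Lipschitz bound with constant `3 * S i * W i` is compared
with `ω` by the monotonicity of `s / ω s`. -/
lemma IsCascade.abs_coef_sub_le (hq : MonotoneOn (fun s => s / ω s) (Ioi 0)) (a b : ℝ) :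
    |coef S W N a - coef S W N b| ≤ 3 * ω |a - b| := by
  have key : ∀ i, ∀ a b, |W i * profile (N i) (S i * a) - W i * profile (N i) (S i * b)| ≤
      3 * ω |a - b| := by
    intro i a b
    rcases eq_or_ne a b with rfl | hab
    · simp [hω.map_zero]
    have hd : 0 < |a - b| := abs_pos.2 (sub_ne_zero.2 hab)
    have hS := h.freq_pos i
    have hW := h.amp_pos hω i
    rw [← mul_sub, abs_mul, abs_of_pos hW]
    rcases le_total (1 / S i) |a - b| with hle | hle
    · have h1 : W i ≤ ω |a - b| := by
        rw [h.amp_eq]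
        exact hω.monotoneOn (mem_Ici.2 (by positivity)) (mem_Ici.2 hd.le) hle
      have h2 : |profile (N i) (S i * a) - profile (N i) (S i * b)| ≤ 3 := by
        have p1 := profile_nonneg (N := N i) (S i * a)
        have p2 := profile_nonneg (N := N i) (S i * b)
        have p3 := profile_le (N := N i) (S i * a)
        have p4 := profile_le (N := N i) (S i * b)
        rw [abs_le]; constructor <;> linarith
      nlinarith
    · have h1 := hq (mem_Ioi.2 hd) (mem_Ioi.2 (one_div_pos.2 hS)) hle
      simp only at h1
      have hωd := hω.pos _ hd
      rw [← h.amp_eq, div_le_div_iff₀ hωd hW] at h1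
      have h2 := abs_profile_sub_le (h.one_le i) (S i * a) (S i * b)
      rw [← mul_sub, abs_mul, abs_of_pos hS] at h2
      have h3 : S i * (|a - b| * W i) ≤ ω |a - b| := by
        calc S i * (|a - b| * W i) ≤ S i * (1 / S i * ω |a - b|) := by gcongr
          _ = ω |a - b| := by field_simp
      nlinarith
  have hle : ∀ a b, coef S W N a ≤ coef S W N b + 3 * ω |a - b| := by
    intro a b
    refine ciSup_le fun i => ?_
    have h1 := (abs_le.1 (key i a b)).2
    have h2 := h.term_le hω i b
    linarith
  rw [abs_le]
  have h1 := hle a b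
  have h2 := hle b a
  rw [abs_sub_comm] at h2
  constructor <;> linarith

lemma IsCascade.continuous_coef (hq : MonotoneOn (fun s => s / ω s) (Ioi 0)) :
    Continuous (coef S W N) := by
  rw [continuous_iff_continuousAt]
  intro t
  rw [ContinuousAt, tendsto_iff_dist_tendsto_zero]
  have h1 : Tendsto (fun s => 3 * ω |s - t|) (𝓝 t) (𝓝 (3 * ω 0)) := by
    refine Tendsto.const_mul 3 ?_
    have h2 : Tendsto (fun s => |s - t|) (𝓝 t) (𝓝[Ici 0] 0) := by
      refine tendsto_nhdsWithin_iff.2 ⟨?_, Eventually.of_forall fun s => mem_Ici.2 (abs_nonneg _)⟩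
      have : Continuous fun s : ℝ => |s - t| := by fun_prop
      simpa using this.tendsto t
    exact (hω.continuousOn 0 (mem_Ici.2 le_rfl)).tendsto.comp h2
  rw [hω.map_zero, mul_zero] at h1
  exact squeeze_zero (fun s => dist_nonneg) (fun s => h.abs_coef_sub_le hω hq s t) h1

omit hω in
lemma IsCascade.term_eq_zero {i j : ℕ} (hji : j < i) {t : ℝ} (ht : t ≤ 82 * Real.pi * N i / S i) :
    W j * profile (N j) (S j * t) = 0 := by
  rw [profile_of_le_pi (h.one_le j), mul_zero]
  have h1 := ht.trans (h.time_lt hji)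
  rwa [le_div_iff₀ (h.freq_pos j), mul_comm] at h1

/-- The height `3/2` times the amplitude ratio `1/4` stays below `1/2`, the minimum of `bump`, so
the stages of larger index stay hidden under the current one. -/
lemma IsCascade.term_le_half {i j : ℕ} (hij : i < j) (t : ℝ) :
    W j * profile (N j) (S j * t) ≤ W i / 2 := by
  have h1 := (h.term_mem hω j t).2
  have h2 := h.amp_lt hω hij
  have h3 := h.amp_pos hω i
  linarith

lemma IsCascade.coef_le {i : ℕ} {t : ℝ} (ht : t ≤ 2 * Real.pi * N i / S i) :
    coef S W N t ≤ W i := by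
  have hW := h.amp_pos hω i
  have hS := h.freq_pos i
  have hp := pi_mul_pos (h.one_le i)
  refine ciSup_le fun j => ?_
  rcases lt_trichotomy j i with hj | rfl | hj
  · rw [h.term_eq_zero hj]
    · exact hW.le
    · refine ht.trans ?_
      gcongr
      norm_num
  · rw [le_div_iff₀ hS, mul_comm] at ht
    exact mul_le_of_le_one_right hW.le (profile_of_le ht)
  · linarith [h.term_le_half hω hj t]

/-- While stage `i` oscillates, stages of smaller index are still zero and those of larger index lie
below it, so the supremum is the term `i`. -/
lemma IsCascade.coef_eq {i : ℕ} {t : ℝ} (ht : 2 * Real.pi * N i / S i ≤ t)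
    (ht' : t ≤ 82 * Real.pi * N i / S i) : coef S W N t = W i * bump (S i * t) := by
  have hW := h.amp_pos hω i
  have hS := h.freq_pos i
  have ht1 := ht
  have ht2 := ht'
  rw [div_le_iff₀ hS, mul_comm t] at ht1
  rw [le_div_iff₀ hS, mul_comm t] at ht2
  have hprof := profile_of_mem (h.one_le i) ht1 ht2
  have hb := bump_mem (S i * t)
  refine le_antisymm (ciSup_le fun j => ?_) (hprof ▸ h.term_le hω i t)
  rcases lt_trichotomy j i with hj | rfl | hj
  · rw [h.term_eq_zero hj ht']
    nlinarith
  · rw [hprof]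
  · have := h.term_le_half hω hj t
    nlinarith

lemma IsCascade.half_amp_le_coef {i : ℕ} {t : ℝ} (ht : 2 * Real.pi * N i / S i ≤ t) :
    W i / 2 ≤ coef S W N t := by
  have hW := h.amp_pos hω i
  have hS := h.freq_pos i
  rw [div_le_iff₀ hS, mul_comm t] at ht
  have h1 := half_le_profile (h.one_le i) ht
  have h2 := h.term_le hω i t
  nlinarith

lemma IsCascade.coef_time {i : ℕ} : coef S W N (82 * Real.pi * N i / S i) = W i := by
  have hS := h.freq_pos i
  have hp := pi_mul_pos (h.one_le i)
  rw [h.coef_eq hω _ le_rfl]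
  · have e : S i * (82 * Real.pi * N i / S i) = 2 * Real.pi * (41 * N i : ℕ) := by
      field_simp
      push_cast
      ring
    rw [e, bump_pi_mul, mul_one]
  · gcongr
    norm_num

/-- Once stage `i` has settled at `W i`, only stages `j < i` can bring the coefficient down, at
relative rate at most `2 * S j`. Stages of index above `i` stay below the plateau `W i`, whatever
they do. -/
lemma IsCascade.monotoneOn_coef_mul_exp {i : ℕ} {ρ : ℝ} (hρ0 : 0 ≤ ρ)
    (hρ : ∀ j < i, 2 * S j ≤ ρ) :
    MonotoneOn (fun t => coef S W N t * exp (ρ * t)) (Ici (82 * Real.pi * N i / S i)) := by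
  intro t ht t' ht' htt
  have hS := h.freq_pos i
  have hW := h.amp_pos hω i
  have ht0 : 0 ≤ t := by
    have := pi_mul_pos (h.one_le i)
    exact le_trans (by positivity) (mem_Ici.1 ht)
  have hprof : ∀ t, 82 * Real.pi * N i / S i ≤ t → profile (N i) (S i * t) = 1 := fun t ht => by
    rw [div_le_iff₀ hS, mul_comm t] at ht
    exact profile_of_ge (h.one_le i) ht
  have hexp : exp (ρ * t) ≤ exp (ρ * t') := by gcongr
  have hWc : W i ≤ coef S W N t' := by
    have := h.term_le hω i t'
    rwa [hprof t' ht', mul_one] at this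
  have key : ∀ j, W j * profile (N j) (S j * t) * exp (ρ * t) ≤ coef S W N t' * exp (ρ * t') := by
    intro j
    have hWj := h.amp_pos hω j
    rcases lt_trichotomy j i with hj | rfl | hj
    · have hSj := h.freq_pos j
      have h1 := monotone_profile_mul_exp (h.one_le j) (mul_le_mul_of_nonneg_left htt hSj.le)
      simp only at h1
      have e : ∀ s, exp (ρ * s) = exp (2 * (S j * s)) * exp ((ρ - 2 * S j) * s) := fun s => by
        rw [← Real.exp_add]; congr 1; ring
      have h2 : exp ((ρ - 2 * S j) * t) ≤ exp ((ρ - 2 * S j) * t') := by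
        gcongr
        linarith [hρ j hj]
      have h0 : 0 ≤ profile (N j) (S j * t) * exp (2 * (S j * t)) :=
        mul_nonneg (profile_nonneg _) (Real.exp_nonneg _)
      calc W j * profile (N j) (S j * t) * exp (ρ * t)
          = W j * (profile (N j) (S j * t) * exp (2 * (S j * t)) * exp ((ρ - 2 * S j) * t)) := by
            rw [e t]; ring
        _ ≤ W j * (profile (N j) (S j * t') * exp (2 * (S j * t')) *
              exp ((ρ - 2 * S j) * t')) := by
            refine mul_le_mul_of_nonneg_left ?_ hWj.le
            exact mul_le_mul h1 h2 (Real.exp_nonneg _) (h0.trans h1)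
        _ = W j * profile (N j) (S j * t') * exp (ρ * t') := by rw [e t']; ring
        _ ≤ _ := mul_le_mul_of_nonneg_right (h.term_le hω j t') (Real.exp_nonneg _)
    · rw [hprof t ht, mul_one]
      exact mul_le_mul hWc hexp (Real.exp_nonneg _) (hW.le.trans hWc)
    · have h1 : W j * profile (N j) (S j * t) ≤ coef S W N t' := by
        linarith [h.term_le_half hω hj t]
      exact mul_le_mul h1 hexp (Real.exp_nonneg _) (hW.le.trans hWc)
  have hpos := Real.exp_pos (ρ * t)
  simp only
  rw [← le_div_iff₀ hpos]
  exact ciSup_le fun j => (le_div_iff₀ hpos).2 (key j)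

end Coef

/-! ### Growth of a resonating mode. -/

lemma bumpExp_of_sin_eq_zero {x : ℝ} (hx : sin x = 0) : bumpExp x = x / 10 := by
  simp [bumpExp, hx]

lemma bumpSol_pi_mul (N : ℕ) : bumpSol (2 * Real.pi * N) = 0 := by
  simp [bumpSol, sin_pi_mul]

lemma bumpSol'_pi_mul (N : ℕ) : bumpSol' (2 * Real.pi * N) = exp (2 * Real.pi * N / 10) := by
  simp [bumpSol', bumpExp_of_sin_eq_zero (sin_pi_mul N), sin_pi_mul, cos_pi_mul]

lemma exp_bumpExp_sq_le {x y : ℝ} (hxy : x ≤ y) : exp (bumpExp x) ^ 2 ≤ 2.72 * exp (y / 5) := by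
  have h1 := abs_le.1 (abs_sin_mul_cos_le x)
  have h2 : 2 * bumpExp x ≤ 1 + y / 5 := by
    unfold bumpExp
    linarith [h1.1]
  calc exp (bumpExp x) ^ 2 = exp (2 * bumpExp x) := by
        rw [← Real.exp_nat_mul]; norm_num
    _ ≤ exp (1 + y / 5) := Real.exp_le_exp.2 h2
    _ = exp 1 * exp (y / 5) := Real.exp_add _ _
    _ ≤ 2.72 * exp (y / 5) := by
        gcongr
        linarith [Real.exp_one_lt_d9]

lemma bumpSol_sq_le {x y : ℝ} (hxy : x ≤ y) : bumpSol x ^ 2 ≤ 4 * exp (y / 5) := by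
  have h1 := exp_bumpExp_sq_le hxy
  have h2 := Real.sin_sq_le_one x
  have h3 := Real.exp_pos (y / 5)
  rw [bumpSol, mul_pow]
  calc sin x ^ 2 * exp (bumpExp x) ^ 2 ≤ 1 * (2.72 * exp (y / 5)) := by gcongr
    _ ≤ _ := by linarith

lemma bumpSol'_sq_le {x y : ℝ} (hxy : x ≤ y) : bumpSol' x ^ 2 ≤ 4 * exp (y / 5) := by
  have h1 := exp_bumpExp_sq_le hxy
  have h3 := Real.exp_pos (y / 5)
  have h2 : (cos x + sin x ^ 3 / 5) ^ 2 ≤ 1.44 := by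
    have hs : |sin x ^ 3| ≤ 1 := by
      rw [abs_pow]
      exact pow_le_one₀ (abs_nonneg _) (Real.abs_sin_le_one x)
    have hc := abs_le.1 (Real.abs_cos_le_one x)
    have hs' := abs_le.1 hs
    have : |cos x + sin x ^ 3 / 5| ≤ 1.2 := by
      rw [abs_le]
      constructor <;> linarith [hc.1, hc.2, hs'.1, hs'.2]
    rw [← sq_abs]
    calc |cos x + sin x ^ 3 / 5| ^ 2 ≤ 1.2 ^ 2 := by gcongr
      _ = 1.44 := by norm_num
  rw [bumpSol', mul_pow]
  calc (cos x + sin x ^ 3 / 5) ^ 2 * exp (bumpExp x) ^ 2 ≤ 1.44 * (2.72 * exp (y / 5)) := by gcongr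
    _ ≤ _ := by linarith

/-- At this phase `sin = 1` and `cos = 0`; moving back by `3π/2` costs a factor `exp(-3π/10)`, which
exceeds `exp(-1)` and so `1/4`. -/
lemma le_bumpSol_sq {N : ℕ} (hN : 1 ≤ N) :
    exp (2 * Real.pi * N / 5) / 4 ≤ bumpSol (2 * Real.pi * N - 3 * Real.pi / 2) ^ 2 := by
  have e : 2 * Real.pi * N - 3 * Real.pi / 2 = Real.pi / 2 + ((N - 1 : ℕ) : ℝ) * (2 * Real.pi) := by
    push_cast [Nat.cast_sub hN]
    ring
  have hs : sin (2 * Real.pi * N - 3 * Real.pi / 2) = 1 := by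
    rw [e, Real.sin_add_nat_mul_two_pi, Real.sin_pi_div_two]
  have hc : cos (2 * Real.pi * N - 3 * Real.pi / 2) = 0 := by
    rw [e, Real.cos_add_nat_mul_two_pi, Real.cos_pi_div_two]
  have h1 : exp (-1) ≥ 1 / 4 := by
    rw [Real.exp_neg, ge_iff_le, one_div]
    gcongr
    linarith [Real.exp_one_lt_d9]
  rw [bumpSol, hs, one_mul, bumpExp, hc, mul_zero, sub_zero, ← Real.exp_nat_mul]
  calc exp (2 * Real.pi * N / 5) / 4 ≤ exp (2 * Real.pi * N / 5) * exp (-1) := by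
        nlinarith [Real.exp_pos (2 * Real.pi * N / 5)]
    _ = exp (2 * Real.pi * N / 5 + -1) := (Real.exp_add _ _).symm
    _ ≤ _ := by
        rw [Real.exp_le_exp]
        push_cast
        linarith [Real.pi_lt_d2]

section GrowingMode

variable {ω : ℝ → ℝ} {S W : ℕ → ℝ} {N : ℕ → ℕ}

set_option maxHeartbeats 1000000 in
/-- A solution of the equation with the frequency of the stage `i` of the cascade: very small
at time `0`, of size `β` at the end of the stage, and controlled afterwards. -/
theorem IsCascade.exists_mode (h : IsCascade ω S W N) (hω : IsContinuityModulus ω)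
    (hq : MonotoneOn (fun s => s / ω s) (Ioi 0)) (i : ℕ) {T lam ρ β : ℝ}
    (hT : 82 * Real.pi * N i / S i ≤ T) (hT1 : T ≤ 1)
    (hlam : lam ^ 2 * W i = S i ^ 2) (hρ0 : 0 ≤ ρ) (hρ : ∀ j < i, 2 * S j ≤ ρ) :
    ∃ v v' : ℝ → ℝ, IsOscillation (fun t => lam ^ 2 * coef S W N t) T v v' ∧
      (∀ t ∈ Icc 0 T, v t ^ 2 ≤ 4 * exp ρ * β ^ 2) ∧
      (∀ t ∈ Icc 0 T, v' t ^ 2 ≤ 4 * exp ρ * β ^ 2 * lam ^ 2) ∧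
      v' 0 ^ 2 + S i ^ 2 * v 0 ^ 2 ≤ β ^ 2 * S i ^ 2 * exp (-(14 * Real.pi * N i)) ∧
      (∀ t ∈ Icc (82 * Real.pi * N i / S i) T,
        β ^ 2 * S i ^ 2 * exp (-ρ) ≤ v' t ^ 2 + lam ^ 2 * coef S W N t * v t ^ 2) ∧
      ∃ τ ∈ Ioc 0 (82 * Real.pi * N i / S i), β ^ 2 / 4 ≤ v τ ^ 2 := by
  have hS := h.freq_pos i
  have hW := h.amp_pos hω i
  have hWle := h.amp_le i
  have hp := pi_mul_pos (h.one_le i)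
  set s := 2 * Real.pi * N i / S i with hs
  set e := 82 * Real.pi * N i / S i with he
  have hs0 : 0 < s := by
    have : 0 < 2 * Real.pi * N i := by linarith
    exact div_pos this hS
  have hse : s ≤ e := by rw [hs, he]; gcongr; norm_num
  have hSs : S i * s = 2 * Real.pi * N i := by rw [hs]; field_simp
  have hSe : S i * e = 2 * Real.pi * (41 * N i : ℕ) := by
    rw [he]; push_cast; field_simp; ring
  have hcm := h.coef_mem hω
  have hcc := h.continuous_coef hω hq
  have hSlam : S i ^ 2 ≤ lam ^ 2 := by nlinarith [sq_nonneg lam]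
  have hlam0 : 0 ≤ lam ^ 2 := sq_nonneg _
  have hexpρ : 1 ≤ exp ρ := Real.one_le_exp hρ0
  have hβ := sq_nonneg β
  -- Data are prescribed at the start `s` of the oscillations, where `bumpSol` vanishes. From `s` to
  -- `e` the phase advances by `80 π N` and the amplitude grows like `exp(phase / 10)`, so the
  -- factor `exp(-8πN)` produces `|v' e| = |β| S i`.
  obtain ⟨v, v', hosc, hv0, hv0', -⟩ := exists_oscillation (q := fun t => lam ^ 2 * coef S W N t)
    (T := T) (M := lam ^ 2 * (3 / 2)) (by fun_prop) (fun t _ => by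
      rw [abs_of_nonneg (mul_nonneg hlam0 (hcm t).1)]
      exact mul_le_mul_of_nonneg_left (hcm t).2 hlam0)
    (s := s) ⟨hs0.le, hse.trans hT⟩ 0 (β * S i * exp (-(8 * Real.pi * N i)))
  have hsub : ∀ {a b : ℝ}, 0 ≤ a → b ≤ T → Icc a b ⊆ Icc 0 T := fun ha hb => Icc_subset_Icc ha hb
  -- the growth stage
  set B := β * exp (-(82 * Real.pi * N i / 10)) with hB
  have hBexp : B ^ 2 * exp (2 * Real.pi * (41 * N i : ℕ) / 5) = β ^ 2 := by
    rw [hB, mul_pow, ← Real.exp_nat_mul, mul_assoc, ← Real.exp_add]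
    have : ((2 : ℕ) : ℝ) * -(82 * Real.pi * N i / 10) + 2 * Real.pi * (41 * N i : ℕ) / 5 = 0 := by
      push_cast; ring
    rw [this, Real.exp_zero, mul_one]
  have hgrow : ∀ t ∈ Icc s e, v t = B * bumpSol (S i * t) ∧ v' t = B * S i * bumpSol' (S i * t) := by
    intro t ht
    have hl : ∀ t : ℝ, HasDerivAt (fun t => S i * t) (S i) t := fun t => by
      simpa using (hasDerivAt_id t).const_mul (S i)
    refine eqOn_of_oscillation (q := fun t => lam ^ 2 * coef S W N t) (M := lam ^ 2 * (3 / 2))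
      (a := s) (b := e) (w := fun t => B * bumpSol (S i * t))
      (w' := fun t => B * S i * bumpSol' (S i * t)) (fun t _ => ?_)
      (fun t ht => (hosc.deriv t (hsub hs0.le hT ht)).mono (hsub hs0.le hT))
      (fun t ht => (hosc.deriv2 t (hsub hs0.le hT ht)).mono (hsub hs0.le hT))
      (fun t ht => ?_) (fun t ht => ?_) (s := s) ⟨le_rfl, hse⟩ ?_ ?_ ht
    · rw [abs_of_nonneg (mul_nonneg hlam0 (hcm t).1)]
      exact mul_le_mul_of_nonneg_left (hcm t).2 hlam0
    · refine (((hasDerivAt_bumpSol (S i * t)).comp t (hl t)).const_mul B).hasDerivWithinAt.congr_deriv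
        ?_
      ring
    · refine (((hasDerivAt_bumpSol' (S i * t)).comp t (hl t)).const_mul
        (B * S i)).hasDerivWithinAt.congr_deriv ?_
      rw [h.coef_eq hω ht.1 ht.2, ← mul_assoc (lam ^ 2), hlam]
      ring
    · rw [hv0, hSs, bumpSol_pi_mul, mul_zero]
    · rw [hv0', hSs, bumpSol'_pi_mul, hB]
      have : exp (-(8 * Real.pi * N i)) = exp (-(82 * Real.pi * N i / 10)) *
          exp (2 * Real.pi * N i / 10) := by
        rw [← Real.exp_add]; congr 1; ring
      rw [this]
      ring
  have hve : v e = 0 ∧ v' e ^ 2 = β ^ 2 * S i ^ 2 := by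
    obtain ⟨h1, h2⟩ := hgrow e ⟨hse, le_rfl⟩
    rw [hSe, bumpSol_pi_mul, mul_zero] at h1
    rw [hSe, bumpSol'_pi_mul] at h2
    refine ⟨h1, ?_⟩
    rw [h2, mul_pow, mul_pow, ← hBexp, ← Real.exp_nat_mul]
    have : ((2 : ℕ) : ℝ) * (2 * Real.pi * (41 * N i : ℕ) / 10) =
      2 * Real.pi * (41 * N i : ℕ) / 5 := by push_cast; ring
    rw [this]
    ring
  -- the stage before
  have hback : ∀ t ∈ Icc 0 s, v' t ^ 2 + S i ^ 2 * v t ^ 2 ≤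
      β ^ 2 * S i ^ 2 * exp (-(16 * Real.pi * N i)) * exp (S i * (s - t)) := by
    intro t ht
    have h1 := energy_backward (c := coef S W N) (lam := lam) (σ := S i) (a := 0) (b := s) hS.le
      (fun t ht => ⟨mul_nonneg hlam0 (hcm t).1, ?_⟩)
      (fun t ht => (hosc.deriv t (hsub le_rfl (hse.trans hT) ht)).mono (hsub le_rfl (hse.trans hT)))
      (fun t ht => (hosc.deriv2 t (hsub le_rfl (hse.trans hT) ht)).mono
        (hsub le_rfl (hse.trans hT))) ht
    · refine h1.trans_eq ?_
      rw [hv0, hv0', mul_pow, mul_pow, ← Real.exp_nat_mul]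
      have : ((2 : ℕ) : ℝ) * -(8 * Real.pi * N i) = -(16 * Real.pi * N i) := by push_cast; ring
      rw [this]
      ring
    · rw [← hlam]
      exact mul_le_mul_of_nonneg_left (h.coef_le hω ht.2) hlam0
  -- the stage after
  have hcpos : ∀ t ∈ Icc e T, 0 < coef S W N t := fun t ht =>
    (half_pos hW).trans_le (h.half_amp_le_coef hω (hse.trans ht.1))
  have he0 : 0 ≤ e := hs0.le.trans hse
  have hmono : MonotoneOn (fun t => coef S W N t * exp (ρ * t)) (Icc e T) :=
    (h.monotoneOn_coef_mul_exp hω hρ0 hρ).mono Icc_subset_Ici_self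
  have hd1 : ∀ t ∈ Icc e T, HasDerivWithinAt v (v' t) (Icc e T) t := fun t ht =>
    (hosc.deriv t (hsub he0 le_rfl ht)).mono (hsub he0 le_rfl)
  have hd2 : ∀ t ∈ Icc e T, HasDerivWithinAt v' (-(lam ^ 2 * coef S W N t * v t)) (Icc e T) t :=
    fun t ht => (hosc.deriv2 t (hsub he0 le_rfl ht)).mono (hsub he0 le_rfl)
  have hafter : ∀ t ∈ Icc e T, v' t ^ 2 / coef S W N t + lam ^ 2 * v t ^ 2 ≤
      β ^ 2 * lam ^ 2 * exp ρ := by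
    intro t ht
    have h1 := le_mul_exp_sub (energy_upper hcc.continuousOn hcpos hmono hρ0 hd1 hd2 ht)
    rw [h.coef_time hω, hve.1, hve.2, ← hlam] at h1
    refine h1.trans ?_
    have h2 : β ^ 2 * (lam ^ 2 * W i) / W i + lam ^ 2 * 0 ^ 2 = β ^ 2 * lam ^ 2 := by
      field_simp; ring
    rw [h2]
    gcongr
    nlinarith [ht.1, ht.2]
  have hlow : ∀ t ∈ Icc e T, β ^ 2 * S i ^ 2 * exp (-ρ) ≤
      v' t ^ 2 + lam ^ 2 * coef S W N t * v t ^ 2 := by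
    intro t ht
    have h1 := energy_lower hcc.continuousOn hmono hρ0 hd1 hd2 ht
    rw [hve.1, hve.2] at h1
    have h2 := le_mul_exp_sub h1
    have h3 : β ^ 2 * S i ^ 2 ≤
        (v' t ^ 2 + lam ^ 2 * coef S W N t * v t ^ 2) * exp ρ := by
      have hE : 0 ≤ v' t ^ 2 + lam ^ 2 * coef S W N t * v t ^ 2 := by
        have := (hcm t).1
        positivity
      calc β ^ 2 * S i ^ 2 = β ^ 2 * S i ^ 2 + lam ^ 2 * coef S W N e * 0 ^ 2 := by ring
        _ ≤ _ := h2
        _ ≤ _ := by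
          gcongr
          nlinarith [ht.1, ht.2]
    rw [Real.exp_neg, ← div_eq_mul_inv, div_le_iff₀ (Real.exp_pos _)]
    exact h3
  have hlampos : 0 < lam ^ 2 := lt_of_lt_of_le (by positivity) hSlam
  have hβρ : β ^ 2 ≤ exp ρ * β ^ 2 := le_mul_of_one_le_left hβ hexpρ
  have hβlam : β ^ 2 * S i ^ 2 ≤ exp ρ * β ^ 2 * lam ^ 2 := mul_le_mul hβρ hSlam (sq_nonneg _)
    (by positivity)
  have hbefore : ∀ t ∈ Icc 0 s, v' t ^ 2 + S i ^ 2 * v t ^ 2 ≤ β ^ 2 * S i ^ 2 := by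
    intro t ht
    have h1 := hback t ht
    rw [mul_assoc, ← Real.exp_add] at h1
    refine h1.trans (mul_le_of_le_one_right (by positivity) ?_)
    rw [Real.exp_le_one_iff, mul_sub, hSs]
    have := mul_nonneg hS.le ht.1
    linarith
  refine ⟨v, v', hosc, fun t ht => ?_, fun t ht => ?_, ?_, hlow, ?_⟩
  · have h0 : 0 ≤ exp ρ * β ^ 2 := by positivity
    rcases le_total t s with hts | hts
    · have h1 := hbefore t ⟨ht.1, hts⟩
      have h3 : S i ^ 2 * v t ^ 2 ≤ S i ^ 2 * β ^ 2 := by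
        linarith [sq_nonneg (v' t)]
      have h4 := le_of_mul_le_mul_left h3 (by positivity)
      linarith
    rcases le_total t e with hte | hte
    · rw [(hgrow t ⟨hts, hte⟩).1, mul_pow]
      have h1 := bumpSol_sq_le (x := S i * t) (y := 2 * Real.pi * (41 * N i : ℕ))
        (by rw [← hSe]; gcongr)
      have h2 := mul_le_mul_of_nonneg_left h1 (sq_nonneg B)
      linarith
    · have h1 := hafter t ⟨hte, ht.2⟩
      have h2 : 0 ≤ v' t ^ 2 / coef S W N t := div_nonneg (sq_nonneg _) (hcm t).1
      have h3 : lam ^ 2 * v t ^ 2 ≤ lam ^ 2 * (exp ρ * β ^ 2) := by linarith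
      have h4 := le_of_mul_le_mul_left h3 hlampos
      linarith
  · have h0 : 0 ≤ exp ρ * β ^ 2 * lam ^ 2 := by positivity
    rcases le_total t s with hts | hts
    · have h1 := hbefore t ⟨ht.1, hts⟩
      have h2 : 0 ≤ S i ^ 2 * v t ^ 2 := by positivity
      linarith
    rcases le_total t e with hte | hte
    · rw [(hgrow t ⟨hts, hte⟩).2, mul_pow, mul_pow]
      have h1 := bumpSol'_sq_le (x := S i * t) (y := 2 * Real.pi * (41 * N i : ℕ))
        (by rw [← hSe]; gcongr)
      have h2 := mul_le_mul_of_nonneg_left h1 (mul_nonneg (sq_nonneg B) (sq_nonneg (S i)))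
      have h3 : B ^ 2 * S i ^ 2 * (4 * exp (2 * Real.pi * (41 * N i : ℕ) / 5)) =
        4 * (β ^ 2 * S i ^ 2) := by rw [← hBexp]; ring
      linarith
    · have h1 := hafter t ⟨hte, ht.2⟩
      have hc := hcpos t ⟨hte, ht.2⟩
      have h2 : v' t ^ 2 / coef S W N t ≤ β ^ 2 * lam ^ 2 * exp ρ := by
        linarith [mul_nonneg hlam0 (sq_nonneg (v t))]
      rw [div_le_iff₀ hc] at h2
      have h3 : β ^ 2 * lam ^ 2 * exp ρ * coef S W N t ≤ β ^ 2 * lam ^ 2 * exp ρ * (3 / 2) := by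
        gcongr
        exact (hcm t).2
      linarith
  -- Going back from `s` to `0` can cost `exp(S s) = exp(2πN)` in the energy, leaving `exp(-14πN)`
  -- of the initial `exp(-16πN)`.
  · refine (hback 0 ⟨le_rfl, hs0.le⟩).trans_eq ?_
    rw [sub_zero, hSs, mul_assoc, ← Real.exp_add]
    congr 2
    ring
  -- The solution vanishes at `e`, so the peak is taken three quarters of a turn earlier, where the
  -- sine equals `1`.
  · refine ⟨e - 3 * Real.pi / 2 / S i, ⟨?_, ?_⟩, ?_⟩
    · rw [he, ← sub_div]
      have : (1 : ℝ) ≤ N i := by exact_mod_cast h.one_le i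
      refine div_pos ?_ hS
      nlinarith [Real.pi_pos]
    · have := Real.pi_pos
      exact sub_le_self _ (by positivity)
    · have hN1 : (1 : ℝ) ≤ N i := by exact_mod_cast h.one_le i
      have hmem : e - 3 * Real.pi / 2 / S i ∈ Icc s e := by
        constructor
        · rw [he, hs, ← sub_div]
          gcongr
          nlinarith [Real.pi_pos]
        · have := Real.pi_pos
          exact sub_le_self _ (by positivity)
      rw [(hgrow _ hmem).1, mul_sub, hSe, mul_pow]
      have h1 : S i * (3 * Real.pi / 2 / S i) = 3 * Real.pi / 2 := by field_simp
      rw [h1]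
      have h2 := le_bumpSol_sq (N := 41 * N i) (by have := h.one_le i; omega)
      have h3 := mul_le_mul_of_nonneg_left h2 (sq_nonneg B)
      linarith

end GrowingMode

/-! ### The mode that makes the energy increase. -/

/-- A mode which moves away from zero on a time interval depending only on its frequency. -/
theorem exists_moving_mode (lam : ℝ) : ∃ T, 0 < T ∧ T ≤ 1 ∧ ∀ c : ℝ → ℝ, Continuous c →
    (∀ t, c t ∈ Icc (0 : ℝ) (3 / 2)) → ∃ v v' : ℝ → ℝ, ∃ C : ℝ,
      IsOscillation (fun t => lam ^ 2 * c t) T v v' ∧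
      (∀ t ∈ Icc 0 T, 1 / 2 ≤ v t * v' t) ∧
      (∀ t ∈ Icc 0 T, v t ^ 2 ≤ C) ∧ (∀ t ∈ Icc 0 T, v' t ^ 2 ≤ C) := by
  set M := lam ^ 2 * (3 / 2)
  have hM0 : 0 ≤ M := by positivity
  set R := √(2 * exp (1 + M)) with hR
  have hR0 : 0 < R := by positivity
  -- With data `v = v' = 1`, Gronwall gives `|v| ≤ R` up to time `1`, hence `|v''| ≤ (1 + M) R` and
  -- `v'` cannot fall below `1/2` before `T`. The choice precedes `c` because the stages of `c` will
  -- be placed inside `[0, T / 2]`.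
  refine ⟨min 1 (1 / (2 * (1 + M) * R)), by positivity, min_le_left _ _, fun c hc hcm => ?_⟩
  set T := min 1 (1 / (2 * (1 + M) * R))
  have hT0 : 0 < T := by positivity
  have hT1 : T ≤ 1 := min_le_left _ _
  have hTR : (1 + M) * R * T ≤ 1 / 2 := by
    have h1 : T ≤ 1 / (2 * (1 + M) * R) := min_le_right _ _
    calc (1 + M) * R * T ≤ (1 + M) * R * (1 / (2 * (1 + M) * R)) := by gcongr
      _ = 1 / 2 := by field_simp
  have hqM : ∀ t, |lam ^ 2 * c t| ≤ M := fun t => by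
    rw [abs_of_nonneg (mul_nonneg (sq_nonneg _) (hcm t).1)]
    exact mul_le_mul_of_nonneg_left (hcm t).2 (sq_nonneg _)
  have h0T : (0 : ℝ) ∈ Icc 0 T := ⟨le_rfl, hT0.le⟩
  obtain ⟨v, v', hosc, hv0, hv0', hb⟩ := exists_oscillation (q := fun t => lam ^ 2 * c t) (T := T)
    (M := M) (by fun_prop) (fun t _ => hqM t) h0T 1 1
  have hb2 : ∀ t ∈ Icc 0 T, v t ^ 2 + v' t ^ 2 ≤ R ^ 2 := by
    intro t ht
    refine (hb t ht).trans ?_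
    rw [hR, Real.sq_sqrt (by positivity), sub_zero, abs_of_nonneg ht.1]
    norm_num
    nlinarith [ht.1, ht.2]
  have hv : ∀ t ∈ Icc 0 T, |v t| ≤ R := fun t ht =>
    abs_le_of_sq_le_sq (by nlinarith [hb2 t ht, sq_nonneg (v' t)]) hR0.le
  have h1 : ∀ t ∈ Icc 0 T, 1 / 2 ≤ v' t := by
    intro t ht
    have h2 := abs_sub_le_of_hasDerivWithinAt hosc.deriv2 (B := (1 + M) * R) (fun t ht => by
      rw [abs_neg, abs_mul]
      refine mul_le_mul (by linarith [hqM t]) (hv t ht) (abs_nonneg _) (by positivity)) ht h0T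
    rw [hv0', sub_zero, abs_of_nonneg ht.1] at h2
    have h3 : (1 + M) * R * t ≤ (1 + M) * R * T := by
      have := ht.2
      gcongr
    linarith [(abs_le.1 h2).1]
  have h2 : ∀ t ∈ Icc 0 T, 1 ≤ v t := by
    intro t ht
    have hmono : MonotoneOn v (Icc 0 T) :=
      monotoneOn_of_hasDerivWithinAt_nonneg (convex_Icc 0 T)
        (fun t ht => (hosc.deriv t ht).continuousWithinAt)
        (fun t ht => (hosc.deriv t (interior_subset ht)).mono interior_subset)
        fun t ht => by linarith [h1 t (interior_subset ht)]
    rw [← hv0]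
    exact hmono h0T ht ht.1
  refine ⟨v, v', R ^ 2, hosc, fun t ht => ?_, fun t ht => ?_, fun t ht => ?_⟩
  · nlinarith [h1 t ht, h2 t ht]
  · linarith [hb2 t ht, sq_nonneg (v' t)]
  · linarith [hb2 t ht, sq_nonneg (v t)]

/-! ### Choice of the frequencies and of the numbers of periods. -/

/-- The rate at which the frequencies of a cascade have to dominate the previous ones. -/
noncomputable def growthRate (s : ℝ) (i : ℕ) : ℝ := 4 ^ (i + 1) * exp (4 * s)

lemma four_pow_le_growthRate {s : ℝ} (hs : 0 ≤ s) (i : ℕ) : 4 ^ (i + 1) ≤ growthRate s i :=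
  le_mul_of_one_le_right (by positivity) (Real.one_le_exp (by linarith))

/-- The exponent `i + 1` beats any fixed `ε`: as soon as `4 ε (i + 1) ≥ 2`, the power `lam i ^ (4 *
ε)` dominates the square of the rate. -/
lemma tendsto_rpow_div_growthRate {lam s : ℕ → ℝ} (hs : ∀ i, 0 ≤ s i)
    (h : ∀ i, growthRate (s i) i ^ (i + 1) ≤ lam i) {ε C : ℝ} (hε : 0 < ε) (hC : 0 < C) :
    Tendsto (fun i => C * (lam i ^ (4 * ε) / growthRate (s i) i)) atTop atTop := by
  have h4 : Tendsto (fun i : ℕ => C * (4:ℝ) ^ (i + 1)) atTop atTop :=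
    ((tendsto_add_atTop_iff_nat 1).2
      (tendsto_pow_atTop_atTop_of_one_lt (by norm_num))).const_mul_atTop hC
  refine tendsto_atTop_mono' _ ?_ h4
  obtain ⟨m, hm⟩ := exists_nat_ge (2 / (4 * ε))
  filter_upwards [eventually_ge_atTop m] with i hi
  have hJ := four_pow_le_growthRate (hs i) i
  have hJ1 : (1 : ℝ) ≤ growthRate (s i) i := (one_le_pow₀ (by norm_num)).trans hJ
  have hJ0 : 0 < growthRate (s i) i := by linarith
  have h5 : (2 : ℝ) ≤ ((i + 1 : ℕ) : ℝ) * (4 * ε) := by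
    rw [div_le_iff₀ (by positivity)] at hm
    have : (m : ℝ) ≤ (i + 1 : ℕ) := by exact_mod_cast (by omega : m ≤ i + 1)
    nlinarith
  have h6 : growthRate (s i) i ^ 2 ≤ lam i ^ (4 * ε) := by
    calc growthRate (s i) i ^ 2 = growthRate (s i) i ^ (2 : ℝ) := (Real.rpow_two _).symm
      _ ≤ growthRate (s i) i ^ (((i + 1 : ℕ) : ℝ) * (4 * ε)) :=
          Real.rpow_le_rpow_of_exponent_le hJ1 h5
      _ = (growthRate (s i) i ^ (i + 1)) ^ (4 * ε) := by
          rw [Real.rpow_mul hJ0.le, Real.rpow_natCast]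
      _ ≤ lam i ^ (4 * ε) := Real.rpow_le_rpow (by positivity) (h i) (by positivity)
  refine mul_le_mul_of_nonneg_left (hJ.trans ?_) hC.le
  rw [le_div_iff₀ hJ0, ← sq]
  exact h6

section Selection

variable {lam σ : ℕ → ℝ} {ω φ : ℝ → ℝ}

/-- The relation between two consecutive stages (frequency index and number of periods). -/
structure IsNextStage (lam σ : ℕ → ℝ) (ω φ : ℝ → ℝ) (T : ℝ) (i : ℕ) (p p' : ℕ × ℕ) : Prop where
  lt : p.1 < p'.1
  one_le : 1 ≤ p'.2
  amp_le : ω (1 / σ p'.1) ≤ 1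
  amp_quarter : ω (1 / σ p'.1) ≤ ω (1 / σ p.1) / 4
  freq_le : σ p.1 ≤ σ p'.1
  one_le_freq : 1 ≤ σ p'.1
  time_le : 82 * Real.pi * p'.2 / σ p'.1 ≤ Real.pi * p.2 / σ p.1
  time_le' : 82 * Real.pi * p'.2 / σ p'.1 ≤ T
  weight_le : (i + 1) * φ (lam p'.1) ≤ 2 * Real.pi * p'.2
  growth_le : growthRate (σ p.1) i ^ (i + 1) ≤ lam p'.1

/-- Every requirement holds for all large frequencies once the previous stage is fixed. The
available time `τ` is then a constant, and `σ / φ → ∞` makes the number of periods fitting into it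
exceed any multiple of `φ`. -/
theorem exists_next_stage (hlam_mono : Monotone lam) (hlam_unbdd : ¬ BddAbove (range lam))
    (hω : IsContinuityModulus ω) (hφ : ∀ k, 1 ≤ φ (lam k))
    (hσ_pos : ∀ k, 0 < σ k) (hloss : Tendsto (fun k => σ k / φ (lam k)) atTop atTop)
    {T : ℝ} (hT : 0 < T) (i : ℕ) (p : ℕ × ℕ) (hp : 1 ≤ p.2) :
    ∃ p', IsNextStage lam σ ω φ T i p p' := by
  have hlam : Tendsto lam atTop atTop := tendsto_atTop_atTop_of_monotone' hlam_mono hlam_unbdd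
  have hσ : Tendsto σ atTop atTop := by
    refine tendsto_atTop_mono (fun k => ?_) hloss
    exact div_le_self (hσ_pos k).le (hφ k)
  have hωlim : Tendsto (fun k => ω (1 / σ k)) atTop (𝓝 0) := by
    rw [← hω.map_zero]
    refine ((hω.continuousOn 0 (mem_Ici.2 le_rfl)).tendsto).comp ?_
    refine tendsto_nhdsWithin_iff.2 ⟨?_, Eventually.of_forall fun k => mem_Ici.2 ?_⟩
    · simpa only [one_div, Function.comp_def] using tendsto_inv_atTop_zero.comp hσ
    · exact one_div_nonneg.2 (hσ_pos k).le
  have hpos := pi_mul_pos hp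
  set τ := min (Real.pi * p.2 / σ p.1) T
  have hτ0 : 0 < τ := lt_min (div_pos hpos (hσ_pos _)) hT
  have hpi := Real.pi_pos
  have hω4 : 0 < ω (1 / σ p.1) / 4 := by
    have := hω.pos _ (one_div_pos.2 (hσ_pos p.1))
    positivity
  have hev := (((((eventually_gt_atTop p.1).and
    (hωlim.eventually (ge_mem_nhds zero_lt_one))).and
    (hωlim.eventually (ge_mem_nhds hω4))).and
    ((hσ.eventually_ge_atTop (σ p.1)).and (hσ.eventually_ge_atTop 1))).and
    ((hσ.eventually_ge_atTop (82 * Real.pi / τ)).and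
    (hloss.eventually_ge_atTop (82 * (i + 1) / τ)))).and
    (hlam.eventually_ge_atTop (growthRate (σ p.1) i ^ (i + 1)))
  obtain ⟨k, ⟨⟨⟨⟨h1, h2⟩, h3⟩, h4, h5⟩, h6, h7⟩, h8⟩ := hev.exists
  have hσk := hσ_pos k
  set x := σ k * τ / (82 * Real.pi) with hx
  have hx1 : 1 ≤ x := by
    rw [hx, le_div_iff₀ (by positivity)]
    rw [div_le_iff₀ hτ0] at h6
    linarith
  have hfl : (⌊x⌋₊ : ℝ) ≤ x := Nat.floor_le (by linarith)
  have hfl1 : 1 ≤ ⌊x⌋₊ := Nat.one_le_floor_iff x |>.2 hx1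
  -- Rounding down loses at most a factor `2` because `x ≥ 1`.
  have hfl2 : x / 2 ≤ ⌊x⌋₊ := by
    have h9 := Nat.lt_floor_add_one x
    have h10 : (1 : ℝ) ≤ ⌊x⌋₊ := by exact_mod_cast hfl1
    linarith
  have htime : 82 * Real.pi * ⌊x⌋₊ / σ k ≤ τ := by
    rw [div_le_iff₀ hσk]
    calc 82 * Real.pi * ⌊x⌋₊ ≤ 82 * Real.pi * x := by gcongr
      _ = τ * σ k := by rw [hx]; field_simp
  refine ⟨(k, ⌊x⌋₊), h1, hfl1, h2, h3, h4, h5, htime.trans (min_le_left _ _),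
    htime.trans (min_le_right _ _), ?_, h8⟩
  have hφk : 0 < φ (lam k) := by linarith [hφ k]
  rw [div_le_div_iff₀ hτ0 hφk] at h7
  have h9 : 2 * Real.pi * (x / 2) ≤ 2 * Real.pi * ⌊x⌋₊ := by gcongr
  have h10 : 2 * Real.pi * (x / 2) = σ k * τ / 82 := by rw [hx]; field_simp
  simp only
  linarith

theorem exists_stages (hlam_mono : Monotone lam) (hlam_unbdd : ¬ BddAbove (range lam))
    (hω : IsContinuityModulus ω) (hφ : ∀ k, 1 ≤ φ (lam k))
    (hσ_pos : ∀ k, 0 < σ k) (hloss : Tendsto (fun k => σ k / φ (lam k)) atTop atTop)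
    {T : ℝ} (hT : 0 < T) :
    ∃ p : ℕ → ℕ × ℕ, (p 0).1 = 0 ∧ ∀ i, IsNextStage lam σ ω φ T i (p i) (p (i + 1)) := by
  have hex : ∀ (i : ℕ) (p : {p : ℕ × ℕ // 1 ≤ p.2}), ∃ p' : {p : ℕ × ℕ // 1 ≤ p.2},
      IsNextStage lam σ ω φ T i p p' := fun i p => by
    obtain ⟨p', hp'⟩ := exists_next_stage hlam_mono hlam_unbdd hω hφ hσ_pos hloss hT i p p.2
    exact ⟨⟨p', hp'.one_le⟩, hp'⟩
  choose next hnext using hex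
  -- Index `0` is reserved for the moving mode, at the lowest frequency, with a dummy period count;
  -- the stages of the cascade are `p 1, p 2, ...`.
  let q : ℕ → {p : ℕ × ℕ // 1 ≤ p.2} := fun i =>
    Nat.rec ⟨(0, 1), le_rfl⟩ (fun i p => next i p) i
  let p : ℕ → ℕ × ℕ := fun i => (q i).1
  exact ⟨p, rfl, fun i => hnext i (q i)⟩

theorem isCascade_of_stages (hσ_pos : ∀ k, 0 < σ k) {T : ℝ} {p : ℕ → ℕ × ℕ}
    (h : ∀ i, IsNextStage lam σ ω φ T i (p i) (p (i + 1))) :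
    IsCascade ω (fun i => σ (p (i + 1)).1) (fun i => ω (1 / σ (p (i + 1)).1))
      (fun i => (p (i + 1)).2) where
  freq_pos _ := hσ_pos _
  amp_eq _ := rfl
  amp_le i := (h i).amp_le
  amp_quarter i := (h (i + 1)).amp_quarter
  one_le i := (h i).one_le
  time_le i := (h (i + 1)).time_le

end Selection

/-! ### Modes normalized in the phase space. -/

section Cascade

variable {ω : ℝ → ℝ} {S W : ℕ → ℝ} {N : ℕ → ℕ}

lemma IsCascade.tendsto_time (h : IsCascade ω S W N) :
    Tendsto (fun i => 82 * Real.pi * N i / S i) atTop (𝓝 0) := by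
  have hpos : ∀ i, 0 < Real.pi * N i / S i := fun i =>
    div_pos (pi_mul_pos (h.one_le i)) (h.freq_pos i)
  have hgeom : ∀ i, 82 * Real.pi * N i / S i ≤ (82 * Real.pi * N 0 / S 0) * (1 / 2) ^ i := by
    intro i
    induction i with
    | zero => simp
    | succ i ih =>
      have h1 := h.time_le i
      have h2 := hpos i
      have h3 : 82 * Real.pi * N i / S i = 82 * (Real.pi * N i / S i) := by ring
      rw [pow_succ]
      linarith
  refine squeeze_zero (fun i => ?_) hgeom ?_
  · have h3 : 82 * Real.pi * N i / S i = 82 * (Real.pi * N i / S i) := by ring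
    rw [h3]
    linarith [hpos i]
  · simpa using (tendsto_pow_atTop_nhds_zero_of_lt_one (r := (1 / 2 : ℝ)) (by norm_num)
      (by norm_num)).const_mul (82 * Real.pi * N 0 / S 0)

/-- A growing mode, normalized in `D(A^{3/4}) × D(A^{1/4})`. -/
theorem IsCascade.exists_normalized_mode (h : IsCascade ω S W N) (hω : IsContinuityModulus ω)
    (hq : MonotoneOn (fun s => s / ω s) (Ioi 0)) (i : ℕ) {T lam ρ Q : ℝ}
    (hT : 82 * Real.pi * N i / S i ≤ T) (hT1 : T ≤ 1) (hlam0 : 0 < lam) (hS1 : 1 ≤ S i)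
    (hlam : lam ^ 2 * W i = S i ^ 2) (hρ0 : 0 ≤ ρ) (hρ : ∀ j < i, 2 * S j ≤ ρ) :
    ∃ v v' : ℝ → ℝ, IsOscillation (fun t => lam ^ 2 * coef S W N t) T v v' ∧
      (∀ t ∈ Icc 0 T, lam ^ 3 * v t ^ 2 ≤ Q ^ 2) ∧
      (∀ t ∈ Icc 0 T, lam * v' t ^ 2 ≤ Q ^ 2) ∧
      lam ^ 3 * v 0 ^ 2 ≤ Q ^ 2 * exp (-(14 * Real.pi * N i)) ∧
      lam * v' 0 ^ 2 ≤ Q ^ 2 * exp (-(14 * Real.pi * N i)) ∧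
      (∀ t ∈ Icc (82 * Real.pi * N i / S i) T,
        ω 1 / 4 * Q ^ 2 / (exp (2 * ρ) * lam ^ 2) ≤
          v' t ^ 2 + lam ^ 2 * coef S W N t * v t ^ 2) ∧
      ∃ τ ∈ Ioc 0 (82 * Real.pi * N i / S i), Q ^ 2 / 16 / (exp (2 * ρ) * lam ^ 3) ≤ v τ ^ 2 := by
  have hK := Real.exp_pos ρ
  have hK1 := Real.one_le_exp hρ0
  have hS := h.freq_pos i
  have hW := h.amp_pos hω i
  have hW1 := h.amp_le i
  -- This `β` turns the bound `v² ≤ 4 e^ρ β²` into `lam³ v² ≤ Q²`, and likewise for `v'`.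
  have hβ : √(Q ^ 2 / (4 * exp ρ * lam ^ 3)) ^ 2 = Q ^ 2 / (4 * exp ρ * lam ^ 3) :=
    Real.sq_sqrt (by positivity)
  obtain ⟨v, v', hosc, hv, hv', hdata, hlow, τ, hτ, hpeak⟩ := h.exists_mode hω hq i
    (β := √(Q ^ 2 / (4 * exp ρ * lam ^ 3))) hT hT1 hlam hρ0 hρ
  simp only [hβ] at hv hv' hdata hlow hpeak
  have hSlam : S i ^ 2 ≤ lam ^ 2 := by nlinarith [sq_nonneg lam]
  have hSl : S i ≤ lam := le_of_sq_le_sq hSlam hlam0.le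
  have hexp0 := Real.exp_pos (-(14 * Real.pi * N i))
  have hQ4 : Q ^ 2 / (4 * exp ρ * lam ^ 3) * lam ^ 3 ≤ Q ^ 2 := by
    have e : Q ^ 2 / (4 * exp ρ * lam ^ 3) * lam ^ 3 = Q ^ 2 / (4 * exp ρ) := by field_simp
    rw [e]
    exact div_le_self (sq_nonneg _) (by linarith)
  have h2ρ : exp (2 * ρ) = exp ρ * exp ρ := by rw [two_mul, Real.exp_add]
  refine ⟨v, v', hosc, fun t ht => ?_, fun t ht => ?_, ?_, ?_, fun t ht => ?_, τ, hτ, ?_⟩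
  · calc lam ^ 3 * v t ^ 2 ≤ lam ^ 3 * (4 * exp ρ * (Q ^ 2 / (4 * exp ρ * lam ^ 3))) := by
          gcongr; exact hv t ht
      _ = Q ^ 2 := by field_simp
  · calc lam * v' t ^ 2 ≤ lam * (4 * exp ρ * (Q ^ 2 / (4 * exp ρ * lam ^ 3)) * lam ^ 2) := by
          gcongr; exact hv' t ht
      _ = Q ^ 2 := by field_simp
  · have h1 : S i ^ 2 * v 0 ^ 2 ≤ S i ^ 2 * (Q ^ 2 / (4 * exp ρ * lam ^ 3) *
        exp (-(14 * Real.pi * N i))) := by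
      linarith [sq_nonneg (v' 0)]
    have h2 := le_of_mul_le_mul_left h1 (by positivity)
    calc lam ^ 3 * v 0 ^ 2 ≤ lam ^ 3 * (Q ^ 2 / (4 * exp ρ * lam ^ 3) *
          exp (-(14 * Real.pi * N i))) := by gcongr
      _ = Q ^ 2 / (4 * exp ρ * lam ^ 3) * lam ^ 3 * exp (-(14 * Real.pi * N i)) := by ring
      _ ≤ _ := by gcongr
  · have h1 : v' 0 ^ 2 ≤ Q ^ 2 / (4 * exp ρ * lam ^ 3) * S i ^ 2 *
        exp (-(14 * Real.pi * N i)) := by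
      have : 0 ≤ S i ^ 2 * v 0 ^ 2 := by positivity
      linarith
    calc lam * v' 0 ^ 2 ≤ lam * (Q ^ 2 / (4 * exp ρ * lam ^ 3) * lam ^ 2 *
          exp (-(14 * Real.pi * N i))) := by
          gcongr
          refine h1.trans ?_
          gcongr
      _ = Q ^ 2 / (4 * exp ρ * lam ^ 3) * lam ^ 3 * exp (-(14 * Real.pi * N i)) := by ring
      _ ≤ _ := by gcongr
  · refine le_trans ?_ (hlow t ht)
    -- Since `S ≥ 1`, monotonicity of `s / ω s` gives `ω 1 ≤ S W ≤ lam W`; multiplying by `lam`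
    -- turns the right side into `S²`. This bounds the persistent energy from below in terms of
    -- `lam` alone.
    have hω1 : lam * ω 1 ≤ S i ^ 2 := by
      have h1 := hq (mem_Ioi.2 (one_div_pos.2 hS)) (mem_Ioi.2 one_pos)
        ((div_le_one hS).2 hS1)
      simp only at h1
      rw [← h.amp_eq, div_le_div_iff₀ hW (hω.pos 1 one_pos), one_mul, one_div,
        inv_mul_le_iff₀ hS] at h1
      rw [← hlam]
      calc lam * ω 1 ≤ lam * (lam * W i) := by
            gcongr
            exact h1.trans (by gcongr)
        _ = _ := by ring
    rw [Real.exp_neg, h2ρ]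
    calc ω 1 / 4 * Q ^ 2 / (exp ρ * exp ρ * lam ^ 2)
        = Q ^ 2 / (4 * exp ρ * lam ^ 3) * (lam * ω 1) * (exp ρ)⁻¹ := by field_simp
      _ ≤ _ := by gcongr
  · refine le_trans ?_ hpeak
    rw [h2ρ]
    calc Q ^ 2 / 16 / (exp ρ * exp ρ * lam ^ 3) ≤ Q ^ 2 / 16 / (exp ρ * 1 * lam ^ 3) := by gcongr
      _ = _ := by field_simp; norm_num

end Cascade

/-! ### The coefficient together with all its modes. -/

section Family

variable {lam σ : ℕ → ℝ} {ω φ : ℝ → ℝ}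

set_option maxHeartbeats 1000000 in
/-- The scalar part of the construction: a coefficient `c`, a subsequence `n` of the frequencies,
and solutions of the corresponding linear equations. -/
theorem exists_modeFamily (hlam_pos : ∀ k, 0 < lam k) (hlam_mono : Monotone lam)
    (hlam_unbdd : ¬ BddAbove (range lam))
    (hω : IsContinuityModulus ω) (hω_quot : MonotoneOn (fun s => s / ω s) (Ioi 0))
    (hφ : ∀ k, 1 ≤ φ (lam k)) (hσ_pos : ∀ k, 0 < σ k) (hσ : ∀ k, lam k ^ 2 * ω (1 / σ k) = σ k ^ 2)
    (hloss : Tendsto (fun k => σ k / φ (lam k)) atTop atTop) :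
    ∃ (n : ℕ → ℕ) (c : ℝ → ℝ) (T : ℝ) (Q : ℕ → ℝ) (V V' : ℕ → ℝ → ℝ), StrictMono n ∧ 0 < T ∧
      (∀ a b, |c a - c b| ≤ 3 * ω |a - b|) ∧ (∀ t, c t ∈ Icc 0 (3 / 2)) ∧
      IsModeFamily (fun i => lam (n i)) c T Q V V' ∧
      (∀ t ∈ Icc 0 T, 1 / 2 ≤ V 0 t * V' 0 t) ∧
      ∑' k, 2 * Q (k + 1) ^ 2 ≤ lam (n 0) ^ 2 / 2 ∧
      (∀ r, Summable fun i => lam (n i) ^ 3 * V i 0 ^ 2 * exp (r * φ (lam (n i)))) ∧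
      (∀ r, Summable fun i => lam (n i) * V' i 0 ^ 2 * exp (r * φ (lam (n i)))) ∧
      (∀ ε : ℝ, 0 < ε → ∀ t ∈ Ioc 0 (T / 2), Tendsto (fun i => lam (n (i + 1)) ^ (4 * ε) *
        (lam (n (i + 1)) ^ 2 * (V' (i + 1) t ^ 2 + lam (n (i + 1)) ^ 2 * c t * V (i + 1) t ^ 2)))
        atTop atTop) ∧
      ∃ τ : ℕ → ℝ, (∀ i, τ i ∈ Ioc 0 (T / 2)) ∧ Tendsto τ atTop (𝓝 0) ∧
        ∀ ε : ℝ, 0 < ε → Tendsto (fun i => lam (n (i + 1)) ^ (4 * ε) *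
          (lam (n (i + 1)) ^ 3 * V (i + 1) (τ i) ^ 2)) atTop atTop := by
  obtain ⟨T, hT0, hT1, hmov⟩ := exists_moving_mode (lam 0)
  obtain ⟨p, hp0, hp⟩ := exists_stages hlam_mono hlam_unbdd hω hφ hσ_pos hloss (half_pos hT0)
  have hC := isCascade_of_stages hσ_pos hp
  set c := coef (fun i => σ (p (i + 1)).1) (fun i => ω (1 / σ (p (i + 1)).1))
    (fun i => (p (i + 1)).2)
  have hn : StrictMono fun i => (p i).1 := strictMono_nat_of_lt_succ fun i => (hp i).lt
  have hσmono : Monotone fun i => σ (p i).1 := monotone_nat_of_le_succ fun i => (hp i).freq_le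
  obtain ⟨v₀, v₀', C, hosc₀, hmov₀, hv₀, hv₀'⟩ := hmov c (hC.continuous_coef hω hω_quot)
    (hC.coef_mem hω)
  set δ := lam 0 / 4 with hδ
  have hδ0 : 0 < δ := by have := hlam_pos 0; positivity
  -- Stage `i` uses the frequency of `p (i + 1)`, so the frequencies of the earlier indices are at
  -- most `σ (p i).1`, and twice this value serves as `ρ`.
  have hmode := fun i => hC.exists_normalized_mode hω hω_quot i (T := T)
    (lam := lam (p (i + 1)).1) (ρ := 2 * σ (p i).1) (Q := δ / 2 ^ (i + 1))
    (((hp i).time_le').trans (by linarith)) hT1 (hlam_pos _) (hp i).one_le_freq (hσ _)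
    (by linarith [hσ_pos (p i).1])
    (fun j hj => by linarith [hσmono (show j + 1 ≤ i by omega)])
  choose v v' hosc hv hv' hd hd' hlow τ hτ hpeak using hmode
  have hC0 : 0 ≤ C := (sq_nonneg _).trans (hv₀ 0 ⟨le_rfl, hT0.le⟩)
  let V : ℕ → ℝ → ℝ := fun k => Nat.casesOn k v₀ v
  let V' : ℕ → ℝ → ℝ := fun k => Nat.casesOn k v₀' v'
  let Q : ℕ → ℝ := fun k => Nat.casesOn k (√((lam 0 ^ 3 + lam 0) * C)) fun i => δ / 2 ^ (i + 1)
  have hl0 := hlam_pos 0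
  have hQ0 : Q 0 ^ 2 = (lam 0 ^ 3 + lam 0) * C := Real.sq_sqrt (by positivity)
  have hQ1 : ∀ i, Q (i + 1) ^ 2 = δ ^ 2 / 4 * (1 / 4) ^ i := fun i => by
    change (δ / 2 ^ (i + 1)) ^ 2 = _
    rw [div_pow, ← pow_mul, mul_comm (i + 1) 2, pow_mul, pow_succ, one_div, inv_pow]
    norm_num
    field_simp
    ring
  have hgeom : Summable fun i : ℕ => (1 / 4 : ℝ) ^ i :=
    summable_geometric_of_lt_one (by norm_num) (by norm_num)
  have hQs1 : Summable fun i => Q (i + 1) ^ 2 := by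
    simp only [hQ1]
    exact hgeom.mul_left _
  -- For fixed `r`, all but finitely many stages have enough periods for the smallness `exp(-14πN)`
  -- at time `0` to absorb the Gevrey weight.
  have hweight : ∀ (r : ℝ) (i : ℕ), r ≤ i → r * φ (lam (p (i + 1)).1) ≤
      14 * Real.pi * (p (i + 1)).2 := fun r i hri => by
    have h1 := (hp i).weight_le
    have h2 := hφ (p (i + 1)).1
    have h3 : r * φ (lam (p (i + 1)).1) ≤ (i + 1) * φ (lam (p (i + 1)).1) := by
      gcongr
      linarith
    have h4 : 0 ≤ Real.pi * (p (i + 1)).2 := by positivity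
    linarith
  have hsum : ∀ (r : ℝ) (a : ℕ → ℝ), (∀ i, 0 ≤ a i) →
      (∀ i, a (i + 1) ≤ Q (i + 1) ^ 2 * exp (-(14 * Real.pi * (p (i + 1)).2))) →
      Summable fun i => a i * exp (r * φ (lam (p i).1)) := by
    intro r a ha0 ha
    rw [← summable_nat_add_iff 1]
    refine Summable.of_norm_bounded_eventually_nat hQs1 ?_
    obtain ⟨m, hm⟩ := exists_nat_ge r
    filter_upwards [eventually_ge_atTop m] with i hi
    have h1 : r ≤ i := hm.trans (by exact_mod_cast hi)
    rw [Real.norm_of_nonneg (mul_nonneg (ha0 _) (Real.exp_nonneg _))]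
    calc a (i + 1) * exp (r * φ (lam (p (i + 1)).1))
        ≤ Q (i + 1) ^ 2 * exp (-(14 * Real.pi * (p (i + 1)).2)) *
          exp (14 * Real.pi * (p (i + 1)).2) := by
          refine mul_le_mul (ha i) (Real.exp_le_exp.2 (hweight r i h1)) (Real.exp_nonneg _)
            (by positivity)
      _ = Q (i + 1) ^ 2 := by rw [mul_assoc, ← Real.exp_add]; simp
  -- This identity is the origin of `growthRate`: the squared normalization contributes `4 ^ (i +
  -- 1)` and `exp(2ρ)` contributes `exp(4σ)`.
  have hrate : ∀ i, (δ / 2 ^ (i + 1)) ^ 2 / exp (2 * (2 * σ (p i).1)) =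
      δ ^ 2 / growthRate (σ (p i).1) i := fun i => by
    rw [growthRate, div_pow, ← pow_mul, mul_comm (i + 1) 2, pow_mul, div_div, ← mul_assoc 2 2]
    norm_num
  have hlim : ∀ ε : ℝ, 0 < ε → ∀ C : ℝ, 0 < C → Tendsto (fun i => C * (lam (p (i + 1)).1 ^ (4 * ε) /
      growthRate (σ (p i).1) i)) atTop atTop := fun ε hε C hC =>
    tendsto_rpow_div_growthRate (fun i => (hσ_pos _).le) (fun i => (hp i).growth_le) hε hC
  refine ⟨fun i => (p i).1, c, T, Q, V, V', hn, hT0, hC.abs_coef_sub_le hω hω_quot,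
    hC.coef_mem hω, ⟨⟨lam 0, hl0, fun k => hlam_mono (Nat.zero_le _)⟩, ?_,
    (summable_nat_add_iff 1).1 hQs1, ?_, ?_⟩, hmov₀, ?_, fun r => ?_, fun r => ?_,
    fun ε hε t ht => ?_, τ, fun i => ⟨(hτ i).1, (hτ i).2.trans (hp i).time_le'⟩, ?_,
    fun ε hε => ?_⟩
  · rintro (_ | i)
    · change IsOscillation (fun t => lam (p 0).1 ^ 2 * c t) T v₀ v₀'
      rw [hp0]
      exact hosc₀
    · exact hosc i
  · rintro (_ | i) t ht
    · change lam (p 0).1 ^ 3 * v₀ t ^ 2 ≤ Q 0 ^ 2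
      rw [hQ0, hp0]
      have h1 := mul_le_mul_of_nonneg_left (hv₀ t ht) (pow_nonneg hl0.le 3)
      have h2 := mul_nonneg hl0.le hC0
      linarith
    · exact hv i t ht
  · rintro (_ | i) t ht
    · change lam (p 0).1 * v₀' t ^ 2 ≤ Q 0 ^ 2
      rw [hQ0, hp0]
      have h1 := mul_le_mul_of_nonneg_left (hv₀' t ht) hl0.le
      have h2 := mul_nonneg (pow_nonneg hl0.le 3) hC0
      linarith
    · exact hv' i t ht
  · simp only [hQ1, hp0]
    rw [tsum_mul_left, tsum_mul_left, tsum_geometric_of_lt_one (by norm_num) (by norm_num), hδ]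
    nlinarith [sq_nonneg (lam 0)]
  · refine hsum r (fun i => lam (p i).1 ^ 3 * V i 0 ^ 2) (fun i => ?_) fun i => hd i
    have := hlam_pos (p i).1
    positivity
  · refine hsum r (fun i => lam (p i).1 * V' i 0 ^ 2) (fun i => ?_) fun i => hd' i
    have := hlam_pos (p i).1
    positivity
  · have hω1 := hω.pos 1 one_pos
    refine tendsto_atTop_mono' _ ?_ (hlim ε hε (ω 1 / 4 * δ ^ 2) (by positivity))
    -- For fixed `t > 0` all but finitely many stages have ended before `t`, so the persistent lower
    -- bound applies to their modes.
    filter_upwards [hC.tendsto_time.eventually (ge_mem_nhds ht.1)] with i hi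
    have h1 := hlow i t ⟨hi, by linarith [ht.2]⟩
    have hl := hlam_pos (p (i + 1)).1
    have h2 := mul_le_mul_of_nonneg_left h1
      (mul_nonneg (Real.rpow_nonneg hl.le (4 * ε)) (sq_nonneg (lam (p (i + 1)).1)))
    have e : lam (p (i + 1)).1 ^ (4 * ε) * lam (p (i + 1)).1 ^ 2 *
        (ω 1 / 4 * (δ / 2 ^ (i + 1)) ^ 2 / (exp (2 * (2 * σ (p i).1)) * lam (p (i + 1)).1 ^ 2)) =
        ω 1 / 4 * lam (p (i + 1)).1 ^ (4 * ε) *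
          ((δ / 2 ^ (i + 1)) ^ 2 / exp (2 * (2 * σ (p i).1))) := by
      field_simp
    rw [e, hrate i] at h2
    refine le_trans (le_of_eq ?_) (h2.trans (le_of_eq ?_))
    · ring
    · change _ = lam (p (i + 1)).1 ^ (4 * ε) * (lam (p (i + 1)).1 ^ 2 *
        (v' i t ^ 2 + lam (p (i + 1)).1 ^ 2 * c t * v i t ^ 2))
      ring
  · exact squeeze_zero (fun i => (hτ i).1.le) (fun i => (hτ i).2) hC.tendsto_time
  · refine tendsto_atTop_mono (fun i => ?_) (hlim ε hε (δ ^ 2 / 16) (by positivity))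
    have hl := hlam_pos (p (i + 1)).1
    have h2 := mul_le_mul_of_nonneg_left (hpeak i)
      (mul_nonneg (Real.rpow_nonneg hl.le (4 * ε)) (pow_nonneg hl.le 3))
    have e : lam (p (i + 1)).1 ^ (4 * ε) * lam (p (i + 1)).1 ^ 3 *
        ((δ / 2 ^ (i + 1)) ^ 2 / 16 / (exp (2 * (2 * σ (p i).1)) * lam (p (i + 1)).1 ^ 3)) =
        lam (p (i + 1)).1 ^ (4 * ε) / 16 *
          ((δ / 2 ^ (i + 1)) ^ 2 / exp (2 * (2 * σ (p i).1))) := by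
      field_simp
    rw [e, hrate i] at h2
    refine le_trans (le_of_eq ?_) (h2.trans (le_of_eq ?_))
    · ring
    · change _ = lam (p (i + 1)).1 ^ (4 * ε) * (lam (p (i + 1)).1 ^ 3 * v i (τ i) ^ 2)
      ring

end Family

/-! ### Reading the loss of regularity from single coordinates. -/

section Loss

variable {H : Type*} [NormedAddCommGroup H] [InnerProductSpace ℝ H] [CompleteSpace H]
  {A : H →ₗ.[ℝ] H} {f : ℕ → H} {Λ : ℕ → ℝ}

lemma le_powNorm (hA : IsSelfAdjoint A) (hE : IsEigenSystem A f Λ) (α : ℝ) {x : ℕ → ℝ} {X : H}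
    (hX : HasSum (fun k => x k • f k) X) (k : ℕ) :
    ENNReal.ofReal (Λ k ^ (4 * α) * x k ^ 2) ^ (1 / 2 : ℝ) ≤ powNorm A α X := by
  rw [powNorm_of_hasSum hA hE α hX]
  exact ENNReal.rpow_le_rpow (ENNReal.le_tsum k) (by norm_num)

lemma exists_bound_of_mem_powDomain (hA : IsSelfAdjoint A) (hE : IsEigenSystem A f Λ) {α : ℝ}
    {x : ℕ → ℝ} {X : H} (hX : HasSum (fun k => x k • f k) X) (h : X ∈ powDomain A α) :
    ∃ B : ℝ, ∀ k, Λ k ^ (4 * α) * x k ^ 2 ≤ B := by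
  refine ⟨(powNorm A α X).toReal ^ 2, fun k => ?_⟩
  have hnn : 0 ≤ Λ k ^ (4 * α) * x k ^ 2 :=
    mul_nonneg (Real.rpow_nonneg (hE.pos k).le _) (sq_nonneg _)
  have h1 := ENNReal.toReal_mono (ne_of_lt h) (le_powNorm hA hE α hX k)
  rw [← ENNReal.toReal_rpow, ENNReal.toReal_ofReal hnn, ← Real.sqrt_eq_rpow] at h1
  calc Λ k ^ (4 * α) * x k ^ 2 = √(Λ k ^ (4 * α) * x k ^ 2) ^ 2 := (Real.sq_sqrt hnn).symm
    _ ≤ _ := by gcongr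

lemma rpow_add_natCast_mul {l : ℝ} (hl : 0 < l) (n : ℕ) {α ε : ℝ} (hα : 4 * α = n + 4 * ε)
    (y : ℝ) : l ^ (4 * α) * y = l ^ (4 * ε) * (l ^ n * y) := by
  rw [hα, Real.rpow_add hl, Real.rpow_natCast]
  ring

end Loss

end Kirchhoff

theorem mainTheorem5 {H : Type*} [NormedAddCommGroup H] [InnerProductSpace ℝ H] [CompleteSpace H]
    (A : H →ₗ.[ℝ] H) (hA : IsSelfAdjoint A) (hA_nonneg : Kirchhoff.IsNonneg A)
    (e : ℕ → H) (he : Orthonormal ℝ e)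
    (lam : ℕ → ℝ) (hlam_pos : ∀ k, 0 < lam k) (hlam_mono : Monotone lam)
    (hlam_unbdd : ¬ BddAbove (range lam))
    (heig : ∀ k, ∃ h : e k ∈ A.domain, A ⟨e k, h⟩ = (lam k ^ 2) • e k)
    (ω : ℝ → ℝ) (hω : Kirchhoff.IsContinuityModulus ω)
    (hω_quot : MonotoneOn (fun s => s / ω s) (Ioi 0))
    (φ : ℝ → ℝ) (hφ : ∀ s, 0 ≤ s → 1 ≤ φ s)
    (σ : ℕ → ℝ) (hσ_pos : ∀ k, 0 < σ k) (hσ : ∀ k, σ k / √(ω (1 / σ k)) = lam k)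
    (hloss : Tendsto (fun k => σ k / φ (σ k / √(ω (1 / σ k)))) atTop atTop) :
    ∃ m : ℝ → ℝ, Kirchhoff.IsOmegaContinuous ω m ∧ (∀ a, 0 ≤ a → m a ∈ Icc 0 (3 / 2)) ∧
      ∃ T > 0, ∃ u u' : ℝ → H, Kirchhoff.IsSolution A m T u u' ∧
        Kirchhoff.HasStrongDerivativeLoss A φ (1 / 2) T u u' ∧
        Kirchhoff.HasWeakDerivativeLoss A φ (1 / 4) T u u' := by
  have hσ2 : ∀ k, lam k ^ 2 * ω (1 / σ k) = σ k ^ 2 := fun k => by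
    have hω1 := hω.pos _ (one_div_pos.2 (hσ_pos k))
    rw [← hσ k, div_pow, Real.sq_sqrt hω1.le]
    field_simp
  simp only [hσ] at hloss
  obtain ⟨n, c, T, Q, V, V', hn, hT, hcω, hcm, hfam, hmov, hQ, hG, hG', hstrong, τ, hτ, hτ0,
    hweak⟩ := Kirchhoff.exists_modeFamily hlam_pos hlam_mono hlam_unbdd hω hω_quot
      (fun k => hφ _ (hlam_pos k).le) hσ_pos hσ2 hloss
  have hE : Kirchhoff.IsEigenSystem A (fun i => e (n i)) (fun i => lam (n i)) :=
    ⟨he.comp n hn.injective, fun i => hlam_pos _, fun i => heig _⟩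
  have hl0 := hlam_pos (n 0)
  -- With `V 0 * V' 0 ≥ 1/2` the first mode supplies a slope `lam (n 0) ^ 2`, which is `2 κ`.
  obtain ⟨m, hm, hmI, hmc⟩ := Kirchhoff.exists_nonlinearity hω hT.le
    (κ := lam (n 0) ^ 2 / 2) (by positivity) (by norm_num) hfam.continuousOn_energy
    (fun s hs t ht hst => hfam.increments (fun t ht => by
      have := mul_le_mul_of_nonneg_left (hmov t ht) (sq_nonneg (lam (n 0)))
      linarith) hQ hs ht hst) hcω hcm
  have hT2 : T / 2 ∈ Ioo 0 T := ⟨half_pos hT, half_lt_self hT⟩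
  have hfam2 := hfam.mono hT2.2.le
  have h0T : (0 : ℝ) ∈ Icc 0 T := ⟨le_rfl, hT.le⟩
  have hreg : Kirchhoff.IsRegularWithSmoothData A φ (T / 2)
      (Kirchhoff.modeSum (fun i => e (n i)) V) (Kirchhoff.modeSum (fun i => e (n i)) V') := by
    refine ⟨hfam2.isC1 hA hE, hfam2.isC0 hA hE (n := 3) (by norm_num) le_rfl,
      fun r _ => ?_, fun r _ => ?_⟩
    · refine Kirchhoff.mem_gevrey_of_hasSum hA hE φ r _ (hfam.hasSum hE.orthonormal h0T) ?_
      have e1 : (4 * (3 / 4) : ℝ) = (3 : ℕ) := by norm_num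
      simpa only [e1, Real.rpow_natCast] using hG r
    · refine Kirchhoff.mem_gevrey_of_hasSum hA hE φ r _ (hfam.hasSum' hE.orthonormal h0T) ?_
      have e1 : (4 * (1 / 4) : ℝ) = 1 := by norm_num
      simpa only [e1, Real.rpow_one] using hG' r
  refine ⟨m, hm, fun a _ => hmI a, T, hT, _, _, hfam.isSolution hA hE (M := 3 / 2)
    (fun t _ => abs_le.2 ⟨by linarith [(hcm t).1], (hcm t).2⟩) hmc,
    ⟨T / 2, hT2, hreg, fun ε hε t ht => ?_⟩, ⟨T / 2, hT2, hreg, τ, hτ, hτ0, fun ε hε => ?_⟩⟩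
  · rintro ⟨h1, h2⟩
    have ht' : t ∈ Icc 0 T := ⟨ht.1.le, ht.2.trans hT2.2.le⟩
    obtain ⟨B, hB⟩ := Kirchhoff.exists_bound_of_mem_powDomain hA hE
      (hfam.hasSum hE.orthonormal ht') h1
    obtain ⟨B', hB'⟩ := Kirchhoff.exists_bound_of_mem_powDomain hA hE
      (hfam.hasSum' hE.orthonormal ht') h2
    -- If both memberships held, `lam^{4ε} (lam² v'² + c lam⁴ v²)` would be at most `B' + 3/2 B` for
    -- all modes, because `c ≤ 3/2`.
    obtain ⟨i, hi⟩ := ((hstrong ε hε t ht).eventually_gt_atTop (B' + 3 / 2 * B)).exists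
    have h3 := hB (i + 1)
    have h4 := hB' (i + 1)
    have hl := hlam_pos (n (i + 1))
    rw [Kirchhoff.rpow_add_natCast_mul hl 4 (ε := ε) (by push_cast; ring)] at h3
    rw [Kirchhoff.rpow_add_natCast_mul hl 2 (ε := ε) (by push_cast; ring)] at h4
    have h5 := mul_le_mul_of_nonneg_right (hcm t).2 (mul_nonneg
      (Real.rpow_nonneg hl.le (4 * ε)) (mul_nonneg (pow_nonneg hl.le 4) (sq_nonneg (V (i + 1) t))))
    nlinarith
  · have hlim := ENNReal.tendsto_ofReal_nhds_top.2 (hweak ε hε)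
    have hlim2 := (ENNReal.continuous_rpow_const (y := (1 / 2 : ℝ))).tendsto ∞ |>.comp hlim
    rw [ENNReal.top_rpow_of_pos (by norm_num)] at hlim2
    refine tendsto_nhds_top_mono hlim2 (Eventually.of_forall fun i => ?_)
    have hτi : τ i ∈ Icc 0 T := ⟨(hτ i).1.le, (hτ i).2.trans hT2.2.le⟩
    have h1 := Kirchhoff.le_powNorm hA hE (1 / 4 + 1 / 2 + ε) (hfam.hasSum hE.orthonormal hτi)
      (i + 1)
    rw [Kirchhoff.rpow_add_natCast_mul (hlam_pos (n (i + 1))) 3 (ε := ε)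
      (by push_cast; ring)] at h1
    exact h1
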